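/- Let $\Phi(t,x)=\frac1{4\pi t}e^{-|x|^2/(4t)}$ be the heat kernel on $\mathbb R^2$. For $\alpha>0$ and $f\in L^1(\mathbb R^2)$ let $H_\alpha(f)\in L^1(\mathbb R^2)$ denote the (unique) solution $g$ of the Helmholtz equation $g-\alpha^2\Delta g=f$ in the sense of distributions, and let $B(\omega)(x)=\frac1{2\pi}\int_{\mathbb R^2}\frac{(x-y)^\perp}{|x-y|^2}\,\omega(y)\,dy$, $x^\perp=(-x_2,x_1)$, be the Biot–Savart operator. There is an absolute constant $C$ such that the following holds for every $\alpha>0$. For every $\tilde v_0\in L^1(\mathbb R^2)$ the two-dimensional viscous Camassa–Holm vorticity equation $$\tilde v_t+u\cdot\nabla\tilde v=\Delta\tilde v,\qquad u=B(H_\alpha(\tilde v)),\qquad \tilde v(0)=\tilde v_0,$$ has a unique global mild solution $\tilde v\in L^\infty([0,\infty);L^1(\mathbb R^2))$, that is, a unique solution in this class of $\tilde v(0)=\tilde v_0$ and $$\tilde v(t)=\Phi(t)*\tilde v_0-\int_0^t\nabla\Phi(t-s)*\big[B(H_\alpha(\tilde v(s)))\,\tilde v(s)\big]\,ds\quad\text{in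 }L^1(\mathbb R^2),\qquad t>0,$$ where the convolution with $\nabla\Phi$ includes the scalar product of the two vector fields. (If the integral equation is only required for almost every $t$, the solution is still unique up to equality for almost every $t$.) Moreover, for all $1\le p\le\infty$ and all $t>0$, $$|\tilde v(t)|_p\le C\,t^{-(1-\frac1p)}\,|\tilde v_0|_1,$$ where $|\cdot|_p$ is the norm of $L^p(\mathbb R^2)$. -/

import Mathlib

open MeasureTheory Set Laplacian
open scoped ENNReal Gradient

noncomputable section

namespace VCHE

/-- The Euclidean plane `ℝ²`. -/
abbrev Plane : Type := EuclideanSpace ℝ (Fin 2)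

/-- The Lebesgue space `L¹(ℝ²)` of real-valued functions (modulo a.e. equality). -/
abbrev L1 : Type := Lp ℝ 1 (volume : Measure Plane)

/-- The fundamental solution of the heat equation in the plane,
`Φ(t, x) = (4πt)⁻¹ exp(-|x|² / (4t))`, for `t > 0`. -/
def heatKernel (t : ℝ) (x : Plane) : ℝ :=
  1 / (4 * Real.pi * t) * Real.exp (-‖x‖ ^ 2 / (4 * t))

/-- Rotation by a right angle, `x^⊥ = (-x₂, x₁)`. -/
def perp (x : Plane) : Plane := !₂[-x 1, x 0]

/-- The Biot-Savart operator
`B(f)(x) = (2π)⁻¹ ∫ (x - y)^⊥ / |x - y|² f(y) dy`. -/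
def biotSavart (f : Plane → ℝ) (x : Plane) : Plane :=
  (1 / (2 * Real.pi)) • ∫ y : Plane, (f y / ‖x - y‖ ^ 2) • perp (x - y)

/-- `g ∈ L¹` solves the Helmholtz equation `g - α² Δ g = f` on `ℝ²`, in the sense of
distributions. -/
def IsHelmholtzSolution (α : ℝ) (f g : L1) : Prop :=
  ∀ φ : Plane → ℝ, ContDiff ℝ (⊤ : ℕ∞) φ → HasCompactSupport φ →
    ∫ x : Plane, g x * (φ x - α ^ 2 * Δ φ x) = ∫ x : Plane, f x * φ x

/-- The filter `H_α`: `helmholtz α f` is the solution `g ∈ L¹` of `g - α² Δ g = f`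
(for `α ≠ 0` and `f ∈ L¹` there is exactly one). -/
def helmholtz (α : ℝ) (f : L1) : L1 :=
  Classical.epsilon fun g : L1 => IsHelmholtzSolution α f g

/-- The filtered velocity `u = B(H_α(f))` generated by the vorticity `f`. -/
def velocity (α : ℝ) (f : L1) : Plane → Plane :=
  biotSavart (helmholtz α f)

/-- The heat flow `e^{tΔ} f` for `t > 0`. -/
def heatFlow (t : ℝ) (f : L1) (x : Plane) : ℝ :=
  ∫ y : Plane, heatKernel t (x - y) * f y

/-- The bilinear Duhamel term
`∫₀ᵗ ∇Φ(t - s) ∗ [B(H_α(v(s))) ⊗ v(s)] ds`, evaluated at `x`. The convolution contracts the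
gradient with the vector field `B(H_α(v(s))) v(s)`. -/
def duhamel (α : ℝ) (v : ℝ → L1) (t : ℝ) (x : Plane) : ℝ :=
  ∫ s in (0 : ℝ)..t, ∫ y : Plane,
    inner ℝ (∇ (heatKernel (t - s)) (x - y)) (v s y • velocity α (v s) y)

/-- The integral form of the vorticity equation with initial vorticity `v₀` holds at time
`t ≥ 0`, as an identity in `L¹(ℝ²)`; at `t = 0` this is the initial condition `v(0) = v₀`. -/
def MildEquationAt (α : ℝ) (v₀ : L1) (v : ℝ → L1) (t : ℝ) : Prop :=
  (t = 0 → v 0 = v₀) ∧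
  (0 < t → ∀ᵐ x : Plane, v t x = heatFlow t v₀ x - duhamel α v t x)

/-- `v ∈ L^∞([0, ∞); L¹(ℝ²))`: strongly measurable in time and essentially bounded. -/
def MemLinftyL1 (v : ℝ → L1) : Prop :=
  MemLp v (⊤ : ℝ≥0∞) (volume.restrict (Ici (0 : ℝ)))

/-- A global mild solution of the vorticity equation in `L^∞([0, ∞); L¹(ℝ²))`. -/
structure IsMildSolution (α : ℝ) (v₀ : L1) (v : ℝ → L1) : Prop where
  mem : MemLinftyL1 v
  equation : ∀ t : ℝ, 0 ≤ t → MildEquationAt α v₀ v t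

end VCHE

end

/-! Write S(t) for the heat semigroup on L¹ and u_f = B(H_α f). The filter H_α is convolution with
∫₀^∞ e^{-s} Φ(α²s) ds (`helmholtz_eq`), and ∫ Φ(τ, z - y)/|x - z| dz is at most a constant times
τ^{-1/2}. Hence |u_f|_∞ ≤ U|f|_1 with U of order 1/α. The nonlinearity -∇Φ(τ) ∗ (f u_f) is therefore
Lipschitz on balls of L¹ with a constant of order τ^{-1/2}, which is integrable at 0, and a Grönwall
lemma for this singularity gives uniqueness (`ae_eq_of_integral_equation`). This constant depends on
α, so the decay with an absolute constant has to come from div u = 0 alone.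

Existence and decay are obtained together, from an approximation in which no derivative of the
vorticity occurs. Transport is replaced by jumps: mass at y jumps at rate 1/h to X(y) = y + h w(y),
where w is a regularised divergence-free velocity, and it diffuses between jumps. Conditioning on
the last jump time gives v(t) = e^{-t/h} S(t)v₀ + ∫₀ᵗ h⁻¹ e^{-(t-s)/h} κ⁻¹ S(t-s) X_# v(s) ds. The
weights have total mass one, so a closed convex subset of L¹ that contains the free term and all the
jump terms also contains v(t) (`jump_average_mem`). The factor κ ≥ 1 pays for the compression of
areas by X. Since the derivative of w has trace zero, det(1 + h Dw) = 1 + O(h²), and κ can be taken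
so close to 1 that (1 - κ⁻¹)/h tends to 0. The jump equation implies a Duhamel equation with
nonlinearity h⁻¹(κ⁻¹ S(τ)X_# - S(τ)) (`duhamel_of_jump`), which approximates -∇Φ(τ) ∗ (f u_f) with
an error that is integrable in τ and vanishes in the limit (`norm_jump_sub_drift_le`). So the
solutions converge to a mild solution (`exists_tendsto_volterra`).

The decay is a Nash–Moser argument for the jump equation. For g ≥ 0 let P_τ g = S(τ)X_# g and y(τ) =
|P_τ g|_2². Symmetry and the semigroup law give y(τ) = ∫ g · (P_{2τ} g)∘X, so Cauchy–Schwarz and the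
area bound yield y(τ)² ≤ κ|g|_2² y(2τ). Iterated over doubled times and combined with y(τ) ≤
|g|_1²/τ, this gives 1/y(τ) ≥ 1/(κ|g|_2²) + τ/(8|g|_1²) when the quantities are positive: an
integrated form of Nash's differential inequality (`lintegral_pushHeat_sq_nash`). Applied to g =
|f|^{2^k}, together with Jensen's inequality, it shows that if ∫|v|^{2^k} ≤ N from time t₀ on, then
a bound 8N²/(T - t₀) for ∫|v(T)|^{2^{k+1}} is preserved by a jump followed by diffusion. Such bounds
define closed convex sets, so they pass through the Picard iterates of the jump equation
(`powInt_jumpIter_le`). With t₀ = (1 - 2^{-k-1})t, induction on k gives ∫|v(t)|^{2^k} ≤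
(128M/t)^{2^k} t/2^{k+7}, where M = |v₀|_1. Letting k tend to infinity gives |v(t)|_∞ ≤ 128M/t, and
interpolation with the L¹ bound gives all p. -/

noncomputable section

/-! ### The planar heat kernel: semigroup law and Gaussian bounds. -/

namespace VCHE

/-- The heat kernel extended by zero to nonpositive times. -/
def hk (τ : ℝ) (x : Plane) : ℝ := if 0 < τ then heatKernel τ x else 0

/-- The gradient of the heat kernel, extended by zero to nonpositive times. -/
def hkGrad (τ : ℝ) (x : Plane) : Plane := -(hk τ x / (2 * τ)) • x

lemma hk_of_pos {τ : ℝ} (hτ : 0 < τ) (x : Plane) :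
    hk τ x = 1 / (4 * Real.pi * τ) * Real.exp (-‖x‖ ^ 2 / (4 * τ)) := by
  simp [hk, hτ, heatKernel]

lemma hk_of_nonpos {τ : ℝ} (hτ : τ ≤ 0) (x : Plane) : hk τ x = 0 := by
  simp [hk, hτ.not_gt]

lemma hk_nonneg (τ : ℝ) (x : Plane) : 0 ≤ hk τ x := by
  by_cases h : 0 < τ
  · rw [hk_of_pos h]; positivity
  · rw [hk_of_nonpos (not_lt.1 h)]

lemma hk_neg (τ : ℝ) (x : Plane) : hk τ (-x) = hk τ x := by
  simp [hk, heatKernel]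

lemma hk_sub_comm (τ : ℝ) (x y : Plane) : hk τ (x - y) = hk τ (y - x) := by
  rw [← neg_sub, hk_neg]

lemma hk_eq_of_norm_eq (τ : ℝ) {x y : Plane} (h : ‖x‖ = ‖y‖) : hk τ x = hk τ y := by
  simp [hk, heatKernel, h]

lemma hk_le {τ : ℝ} (hτ : 0 < τ) (x : Plane) : hk τ x ≤ 1 / (4 * Real.pi * τ) := by
  rw [hk_of_pos hτ]
  refine mul_le_of_le_one_right (by positivity) (Real.exp_le_one_iff.2 ?_)
  rw [neg_div]
  have : 0 ≤ ‖x‖ ^ 2 / (4 * τ) := by positivity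
  linarith

lemma measurable_hk : Measurable fun p : ℝ × Plane => hk p.1 p.2 := by
  unfold hk heatKernel
  refine Measurable.ite (measurableSet_lt measurable_const measurable_fst) ?_ measurable_const
  fun_prop

@[fun_prop]
lemma Measurable.hk {ι : Type*} [MeasurableSpace ι] {f : ι → ℝ} {g : ι → Plane}
    (hf : Measurable f) (hg : Measurable g) : Measurable fun i => hk (f i) (g i) :=
  measurable_hk.comp (hf.prodMk hg)

@[fun_prop]
lemma Measurable.hkGrad {ι : Type*} [MeasurableSpace ι] {f : ι → ℝ} {g : ι → Plane}
    (hf : Measurable f) (hg : Measurable g) : Measurable fun i => hkGrad (f i) (g i) := by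
  unfold VCHE.hkGrad
  have := Measurable.hk hf hg
  fun_prop

lemma continuous_hk (τ : ℝ) : Continuous (hk τ) := by
  unfold hk heatKernel
  by_cases h : 0 < τ <;> simp only [h, if_true, if_false] <;> fun_prop

lemma continuous_hkGrad (τ : ℝ) : Continuous (hkGrad τ) := by
  unfold hkGrad
  have := continuous_hk τ
  fun_prop

lemma integral_hk {τ : ℝ} (hτ : 0 < τ) : ∫ x, hk τ x = 1 := by
  have h := GaussianFourier.integral_rexp_neg_mul_sq_norm (V := Plane)
    (b := 1 / (4 * τ)) (by positivity)
  have h2 : ∀ x : Plane, hk τ x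
      = 1 / (4 * Real.pi * τ) * Real.exp (-(1 / (4 * τ)) * ‖x‖ ^ 2) := by
    intro x; rw [hk_of_pos hτ]; congr 2; ring
  simp_rw [h2]
  rw [integral_const_mul, h]
  simp only [finrank_euclideanSpace, Fintype.card_fin]
  norm_num
  field_simp

lemma integrable_hk (τ : ℝ) : Integrable (hk τ) := by
  by_cases h : 0 < τ
  -- The integral of a non-integrable function is 0 by convention, so the value 1 forces
  -- integrability.
  · by_contra hn
    have := integral_hk h
    rw [integral_undef hn] at this
    norm_num at this
  · have : hk τ = fun _ => 0 := funext fun x => hk_of_nonpos (not_lt.1 h) x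
    rw [this]; simp

lemma integral_hk_sub {τ : ℝ} (hτ : 0 < τ) (a : Plane) : ∫ x, hk τ (x - a) = 1 := by
  rw [integral_sub_right_eq_self (hk τ) a, integral_hk hτ]

lemma lintegral_hk {τ : ℝ} (hτ : 0 < τ) : ∫⁻ x, ENNReal.ofReal (hk τ x) = 1 := by
  rw [← ofReal_integral_eq_lintegral_ofReal (integrable_hk τ)
    (Filter.Eventually.of_forall fun x => hk_nonneg τ x), integral_hk hτ]
  simp

lemma lintegral_hk_sub {τ : ℝ} (hτ : 0 < τ) (a : Plane) :
    ∫⁻ x, ENNReal.ofReal (hk τ (x - a)) = 1 := by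
  rw [lintegral_sub_right_eq_self (fun x => ENNReal.ofReal (hk τ x)) a, lintegral_hk hτ]

lemma lintegral_hk_sub_le (τ : ℝ) (a : Plane) :
    ∫⁻ x, ENNReal.ofReal (hk τ (x - a)) ≤ 1 := by
  by_cases h : 0 < τ
  · exact (lintegral_hk_sub h a).le
  · simp [hk_of_nonpos (not_lt.1 h)]

lemma lintegral_hk_sub_left {τ : ℝ} (hτ : 0 < τ) (a : Plane) :
    ∫⁻ x, ENNReal.ofReal (hk τ (a - x)) = 1 := by
  simp_rw [hk_sub_comm τ a, lintegral_hk_sub hτ a]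

/-- Chapman-Kolmogorov for the heat kernel. -/
lemma integral_hk_mul_hk {s t : ℝ} (hs : 0 < s) (ht : 0 < t) (x z : Plane) :
    ∫ y, hk s (x - y) * hk t (y - z) = hk (s + t) (x - z) := by
  have hst : 0 < s + t := by positivity
  -- Completing the square: as a function of y the product is a heat kernel at time σ, centred at a
  -- convex combination of x and z.
  set σ := s * t / (s + t) with hσ
  have hσ0 : 0 < σ := by positivity
  have key : ∀ y : Plane, hk s (x - y) * hk t (y - z)
      = hk (s + t) (x - z) * hk σ (y - ((t / (s + t)) • x + (s / (s + t)) • z)) := by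
    intro y
    rw [hk_of_pos hs, hk_of_pos ht, hk_of_pos hst, hk_of_pos hσ0]
    have e1 : -‖x - y‖ ^ 2 / (4 * s) + -‖y - z‖ ^ 2 / (4 * t) = -‖x - z‖ ^ 2 / (4 * (s + t))
        + -‖y - ((t / (s + t)) • x + (s / (s + t)) • z)‖ ^ 2 / (4 * σ) := by
      simp only [EuclideanSpace.norm_sq_eq, Fin.sum_univ_two, PiLp.sub_apply, PiLp.add_apply,
        PiLp.smul_apply, smul_eq_mul, Real.norm_eq_abs, sq_abs]
      rw [hσ]
      field_simp
      ring
    calc _ = 1 / (4 * Real.pi * s) * (1 / (4 * Real.pi * t)) *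
          Real.exp (-‖x - y‖ ^ 2 / (4 * s) + -‖y - z‖ ^ 2 / (4 * t)) := by
          rw [Real.exp_add]; ring
      _ = _ := by
          rw [e1, Real.exp_add, hσ]
          field_simp
  simp_rw [key]
  rw [integral_const_mul, integral_hk_sub hσ0, mul_one]

lemma integrable_hk_mul_hk (s t : ℝ) (x z : Plane) :
    Integrable fun y => hk s (x - y) * hk t (y - z) := by
  by_cases hs : 0 < s
  · refine ((integrable_hk t).comp_sub_right z).bdd_mul (c := 1 / (4 * Real.pi * s)) ?_ ?_
    · exact ((continuous_hk s).comp (by fun_prop)).aestronglyMeasurable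
    · refine Filter.Eventually.of_forall fun y => ?_
      rw [Real.norm_of_nonneg (hk_nonneg _ _)]
      exact hk_le hs _
  · simp [hk_of_nonpos (not_lt.1 hs)]

lemma lintegral_hk_mul_hk {s t : ℝ} (hs : 0 < s) (ht : 0 < t) (x z : Plane) :
    ∫⁻ y, ENNReal.ofReal (hk s (x - y)) * ENNReal.ofReal (hk t (y - z))
      = ENNReal.ofReal (hk (s + t) (x - z)) := by
  rw [← integral_hk_mul_hk hs ht,
    ofReal_integral_eq_lintegral_ofReal (integrable_hk_mul_hk s t x z)
      (Filter.Eventually.of_forall fun y => mul_nonneg (hk_nonneg _ _) (hk_nonneg _ _))]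
  simp_rw [ENNReal.ofReal_mul (hk_nonneg _ _)]

lemma hasGradientAt_heatKernel {τ : ℝ} (hτ : 0 < τ) (x : Plane) :
    HasGradientAt (heatKernel τ) (hkGrad τ x) x := by
  rw [hasGradientAt_iff_hasFDerivAt]
  have h1 : HasFDerivAt (fun y : Plane => ‖y‖ ^ 2) (2 • (innerSL ℝ x)) x :=
    (hasStrictFDerivAt_norm_sq x).hasFDerivAt
  have h2 : HasFDerivAt (fun y : Plane => -‖y‖ ^ 2 / (4 * τ))
      ((4 * τ)⁻¹ • -((2 : ℕ) • (innerSL ℝ x : Plane →L[ℝ] ℝ))) x := by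
    simpa [div_eq_mul_inv] using h1.neg.mul_const ((4 * τ)⁻¹)
  have h3 := (h2.exp).const_mul (1 / (4 * Real.pi * τ))
  refine h3.congr_fderiv ?_
  ext w
  simp [hkGrad, hk_of_pos hτ]
  ring

lemma gradient_heatKernel {τ : ℝ} (hτ : 0 < τ) (x : Plane) :
    ∇ (heatKernel τ) x = hkGrad τ x := (hasGradientAt_heatKernel hτ x).gradient

lemma hasFDerivAt_hk (τ : ℝ) (x : Plane) :
    HasFDerivAt (hk τ) (innerSL ℝ (hkGrad τ x)) x := by
  by_cases hτ : 0 < τ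
  · have h := (hasGradientAt_heatKernel hτ x).hasFDerivAt
    have e : hk τ = heatKernel τ := by ext; simp [hk, hτ]
    rw [e]
    refine h.congr_fderiv ?_
    ext w; simp
  · have e : hk τ = fun _ => 0 := funext fun x => hk_of_nonpos (not_lt.1 hτ) x
    have e2 : hkGrad τ x = 0 := by simp [hkGrad, hk_of_nonpos (not_lt.1 hτ)]
    rw [e, e2]
    simpa using hasFDerivAt_const (0 : ℝ) x

/-- Half of the Gaussian exponent absorbs the factor q = |x|²/(4τ), by q e^{-q/2} ≤ 1. The other
half is, up to the factor 2, the kernel at time 2τ. -/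
lemma sq_mul_hk_le {τ : ℝ} (hτ : 0 < τ) (x : Plane) :
    ‖x‖ ^ 2 / (4 * τ) * hk τ x ≤ 2 * hk (2 * τ) x := by
  rw [hk_of_pos hτ, hk_of_pos (by positivity)]
  set q := ‖x‖ ^ 2 / (4 * τ) with hq
  have e1 : -‖x‖ ^ 2 / (4 * τ) = -(q / 2) + -(q / 2) := by rw [hq]; ring
  have e2 : -‖x‖ ^ 2 / (4 * (2 * τ)) = -(q / 2) := by rw [hq]; field_simp
  rw [e1, e2, Real.exp_add]
  have hq0 : 0 ≤ q := by positivity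
  have h3 : q * Real.exp (-(q / 2)) ≤ 1 := by
    rw [Real.exp_neg, ← div_eq_mul_inv, div_le_one (Real.exp_pos _)]
    have := Real.quadratic_le_exp_of_nonneg (x := q / 2) (by positivity)
    nlinarith [sq_nonneg (q / 2 - 1)]
  have e3 : 2 * (1 / (4 * Real.pi * (2 * τ)) * Real.exp (-(q / 2)))
      = 1 / (4 * Real.pi * τ) * Real.exp (-(q / 2)) := by field_simp
  rw [e3]
  have h4 : 0 ≤ 1 / (4 * Real.pi * τ) * Real.exp (-(q / 2)) := by positivity
  nlinarith

/-- The same absorption, now by q e^{-q²/2} ≤ 1 with q = |x|/(2√τ). Domination by a heat kernel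
reduces L¹ bounds on the gradient to the unit mass of that kernel. -/
lemma norm_hkGrad_le {τ : ℝ} (hτ : 0 < τ) (x : Plane) :
    ‖hkGrad τ x‖ ≤ 2 / √τ * hk (2 * τ) x := by
  rw [hkGrad, norm_smul, norm_neg, Real.norm_of_nonneg (div_nonneg (hk_nonneg _ _) (by positivity)),
    hk_of_pos hτ, hk_of_pos (show 0 < 2 * τ by positivity)]
  have hs : 0 < √τ := Real.sqrt_pos.2 hτ
  have hss : √τ * √τ = τ := Real.mul_self_sqrt hτ.le
  set q := ‖x‖ / (2 * √τ) with hq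
  have hq0 : 0 ≤ q := by positivity
  have e0 : ‖x‖ = q * (2 * √τ) := by rw [hq]; field_simp
  have e1 : -‖x‖ ^ 2 / (4 * τ) = -(q ^ 2 / 2) + -(q ^ 2 / 2) := by
    rw [e0, mul_pow, mul_pow, Real.sq_sqrt hτ.le]; field_simp; ring
  have e2 : -‖x‖ ^ 2 / (4 * (2 * τ)) = -(q ^ 2 / 2) := by
    rw [e0, mul_pow, mul_pow, Real.sq_sqrt hτ.le]; field_simp; ring
  rw [e1, e2, Real.exp_add]
  have h3 : q * Real.exp (-(q ^ 2 / 2)) ≤ 1 := by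
    rw [Real.exp_neg, ← div_eq_mul_inv, div_le_one (Real.exp_pos _)]
    have := Real.add_one_le_exp (q ^ 2 / 2)
    nlinarith [sq_nonneg (q - 1)]
  have e3 : 2 / √τ * (1 / (4 * Real.pi * (2 * τ)) * Real.exp (-(q ^ 2 / 2)))
      = 1 / (4 * Real.pi * τ * √τ) * Real.exp (-(q ^ 2 / 2)) := by field_simp
  rw [e3]
  have h4 : 0 ≤ 1 / (4 * Real.pi * τ * √τ) * Real.exp (-(q ^ 2 / 2)) := by positivity
  have e4 : 1 / (4 * Real.pi * τ) * (Real.exp (-(q ^ 2 / 2)) * Real.exp (-(q ^ 2 / 2))) / (2 * τ)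
      * ‖x‖ = 1 / (4 * Real.pi * τ * √τ) * Real.exp (-(q ^ 2 / 2)) *
        (q * Real.exp (-(q ^ 2 / 2))) := by
    rw [e0]
    field_simp
    rw [Real.sq_sqrt hτ.le]
    ring
  rw [e4]
  nlinarith

lemma hkGrad_of_nonpos {τ : ℝ} (hτ : τ ≤ 0) (x : Plane) : hkGrad τ x = 0 := by
  simp [hkGrad, hk_of_nonpos hτ]

end VCHE
end

/-! ### Taylor expansion of the heat kernel in L¹. -/

noncomputable section

namespace VCHE

lemma enorm_sub_le_lintegral_of_hasDerivAt {φ φ' : ℝ → ℝ} (h : ∀ r, HasDerivAt φ (φ' r) r)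
    (hc : Continuous φ') {r : ℝ} (hr : r ∈ Icc (0 : ℝ) 1) :
    ‖φ r - φ 0‖ₑ ≤ ∫⁻ ρ in Icc (0 : ℝ) 1, ‖φ' ρ‖ₑ := by
  rw [← intervalIntegral.integral_eq_sub_of_hasDerivAt (fun x _ => h x)
    (hc.intervalIntegrable _ _), intervalIntegral.integral_of_le hr.1]
  refine (enorm_integral_le_lintegral_enorm _).trans (lintegral_mono_set ?_)
  exact fun x hx => ⟨hx.1.le, hx.2.trans hr.2⟩

/-- Taylor's formula of second order on the unit interval, with a crude remainder. -/
lemma enorm_taylor_le_lintegral_of_hasDerivAt {φ φ' φ'' : ℝ → ℝ}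
    (h : ∀ r, HasDerivAt φ (φ' r) r) (h' : ∀ r, HasDerivAt φ' (φ'' r) r)
    (hc' : Continuous φ'') :
    ‖φ 1 - φ 0 - φ' 0‖ₑ ≤ ∫⁻ ρ in Icc (0 : ℝ) 1, ‖φ'' ρ‖ₑ := by
  have hc : Continuous φ' := continuous_iff_continuousAt.2 fun r => (h' r).continuousAt
  have h2 := enorm_sub_le_lintegral_of_hasDerivAt (φ := fun r => φ r - r * φ' 0)
    (φ' := fun r => φ' r - φ' 0)
    (fun r => by
      have := (h r).fun_sub ((hasDerivAt_id r).mul_const (φ' 0))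
      simp only [one_mul] at this
      exact this)
    (by fun_prop) (r := 1) (by simp)
  have e : φ 1 - φ 0 - φ' 0 = φ 1 - 1 * φ' 0 - (φ 0 - 0 * φ' 0) := by ring
  rw [e]
  refine h2.trans ?_
  calc ∫⁻ ρ in Icc (0 : ℝ) 1, ‖φ' ρ - φ' 0‖ₑ
      ≤ ∫⁻ ρ in Icc (0 : ℝ) 1, (∫⁻ ρ in Icc (0 : ℝ) 1, ‖φ'' ρ‖ₑ) :=
        setLIntegral_mono' measurableSet_Icc fun r hr =>
          enorm_sub_le_lintegral_of_hasDerivAt h' hc' hr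
    _ = _ := by simp

/-- After Tonelli each point of the segment contributes the same integral, by translation
invariance, so averaging along a segment costs nothing in L¹. -/
lemma lintegral_enorm_le_of_segment {F : Plane → ℝ} {m : Plane → ℝ≥0∞} (hm : Measurable m)
    (a w : Plane) (h : ∀ x, ‖F x‖ₑ ≤ ∫⁻ ρ in Icc (0 : ℝ) 1, m (x - a - ρ • w)) :
    ∫⁻ x, ‖F x‖ₑ ≤ ∫⁻ x, m x := by
  calc ∫⁻ x, ‖F x‖ₑ ≤ ∫⁻ x, ∫⁻ ρ in Icc (0 : ℝ) 1, m (x - a - ρ • w) := lintegral_mono h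
    _ = ∫⁻ ρ in Icc (0 : ℝ) 1, ∫⁻ x, m (x - a - ρ • w) := by
        rw [lintegral_lintegral_swap]
        exact (hm.comp (by fun_prop)).aemeasurable
    _ = ∫⁻ ρ in Icc (0 : ℝ) 1, ∫⁻ x, m x := by
        refine lintegral_congr fun ρ => ?_
        have := lintegral_sub_right_eq_self (μ := volume) m (a + ρ • w)
        simp_rw [← this, sub_sub]
    _ = _ := by simp

lemma hasDerivAt_hk_segment (τ : ℝ) (z w : Plane) (r : ℝ) :
    HasDerivAt (fun r : ℝ => hk τ (z - r • w)) (-inner ℝ (hkGrad τ (z - r • w)) w) r := by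
  have h1 : HasDerivAt (fun r : ℝ => z - r • w) (-w) r := by
    simpa using ((hasDerivAt_id r).smul_const w).const_sub z
  have h2 := (hasFDerivAt_hk τ (z - r • w)).comp_hasDerivAt r h1
  simp only [map_neg, innerSL_apply_apply] at h2
  exact h2

/-- The `L¹` modulus of continuity of the heat kernel. -/
lemma lintegral_hk_sub_sub_hk_sub {τ : ℝ} (hτ : 0 < τ) (a b : Plane) :
    ∫⁻ x, ‖hk τ (x - a) - hk τ (x - b)‖ₑ ≤ ENNReal.ofReal (2 / √τ * ‖a - b‖) := by
  have hm : Measurable fun z : Plane => ENNReal.ofReal (2 / √τ * ‖a - b‖ * hk (2 * τ) z) := by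
    fun_prop
  have hi : ∫⁻ z : Plane, ENNReal.ofReal (2 / √τ * ‖a - b‖ * hk (2 * τ) z)
      = ENNReal.ofReal (2 / √τ * ‖a - b‖) := by
    simp_rw [ENNReal.ofReal_mul (show 0 ≤ 2 / √τ * ‖a - b‖ by positivity)]
    rw [lintegral_const_mul _ (by fun_prop), lintegral_hk (by positivity), mul_one]
  rw [← hi]
  refine lintegral_enorm_le_of_segment hm b (a - b) fun x => ?_
  have h := enorm_sub_le_lintegral_of_hasDerivAt (hasDerivAt_hk_segment τ (x - b) (a - b))
    (by have := continuous_hkGrad τ; fun_prop) (r := 1) (by simp)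
  have e1 : x - b - (1 : ℝ) • (a - b) = x - a := by simp
  have e2 : x - b - (0 : ℝ) • (a - b) = x - b := by simp
  rw [e1, e2] at h
  refine h.trans (lintegral_mono fun ρ => ?_)
  rw [Real.enorm_eq_ofReal_abs, abs_neg]
  refine ENNReal.ofReal_le_ofReal ?_
  refine (abs_real_inner_le_norm _ _).trans ?_
  have := mul_le_mul_of_nonneg_right (norm_hkGrad_le hτ (x - b - ρ • (a - b)))
    (norm_nonneg (a - b))
  linarith

lemma hasDerivAt_hkGrad_segment (τ : ℝ) (z w : Plane) (r : ℝ) :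
    HasDerivAt (fun r : ℝ => -inner ℝ (hkGrad τ (z - r • w)) w)
      ((inner ℝ (z - r • w) w ^ 2 / (2 * τ) ^ 2 - ‖w‖ ^ 2 / (2 * τ)) * hk τ (z - r • w)) r := by
  have h1 : HasDerivAt (fun r : ℝ => z - r • w) (-w) r := by
    simpa using ((hasDerivAt_id r).smul_const w).const_sub z
  have h2 := (((hasDerivAt_hk_segment τ z w r).div_const (2 * τ)).mul
    (h1.inner ℝ (hasDerivAt_const r w)))
  have e : (fun r : ℝ => -inner ℝ (hkGrad τ (z - r • w)) w)
      = (fun r : ℝ => hk τ (z - r • w) / (2 * τ)) * fun r => inner ℝ (z - r • w) w := by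
    ext r
    simp only [hkGrad, Pi.mul_apply, inner_smul_left, neg_smul, inner_neg_left]
    simp
  rw [e]
  refine h2.congr_deriv ?_
  simp only [hkGrad, inner_smul_left, neg_smul, inner_neg_left, inner_zero_right,
    real_inner_self_eq_norm_sq]
  simp
  ring

/-- The first order Taylor expansion of the heat kernel in `L¹`. -/
lemma lintegral_hk_taylor {τ : ℝ} (hτ : 0 < τ) (a w : Plane) :
    ∫⁻ x, ‖hk τ (x - a - w) - hk τ (x - a) + inner ℝ (hkGrad τ (x - a)) w‖ₑ
      ≤ ENNReal.ofReal (5 / (2 * τ) * ‖w‖ ^ 2) := by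
  -- The second derivative along the segment is at most (|w|²/τ)(|z|²/(4τ) + 1/2)Φ(τ, z). Absorbing
  -- the quadratic factor gives m, of mass (1/(2τ) + 2/τ)|w|².
  set m : Plane → ℝ≥0∞ := fun z => ENNReal.ofReal (‖w‖ ^ 2 / (2 * τ) * hk τ z) +
    ENNReal.ofReal (2 * ‖w‖ ^ 2 / τ * hk (2 * τ) z) with hm
  have hmm : Measurable m := by rw [hm]; fun_prop
  have hi : ∫⁻ z : Plane, m z = ENNReal.ofReal (5 / (2 * τ) * ‖w‖ ^ 2) := by
    rw [hm]
    simp_rw [ENNReal.ofReal_mul (show 0 ≤ ‖w‖ ^ 2 / (2 * τ) by positivity),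
      ENNReal.ofReal_mul (show 0 ≤ 2 * ‖w‖ ^ 2 / τ by positivity)]
    rw [lintegral_add_left (by fun_prop), lintegral_const_mul _ (by fun_prop),
      lintegral_const_mul _ (by fun_prop), lintegral_hk hτ, lintegral_hk (by positivity),
      mul_one, mul_one, ← ENNReal.ofReal_add (by positivity) (by positivity)]
    congr 1
    field_simp
    norm_num
  rw [← hi]
  refine lintegral_enorm_le_of_segment hmm a w fun x => ?_
  have h := enorm_taylor_le_lintegral_of_hasDerivAt (hasDerivAt_hk_segment τ (x - a) w)
    (hasDerivAt_hkGrad_segment τ (x - a) w) (by have := continuous_hk τ; fun_prop)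
  simp only [one_smul, zero_smul, sub_zero, sub_neg_eq_add] at h
  refine h.trans (lintegral_mono fun ρ => ?_)
  simp only [hm]
  set z := x - a - ρ • w
  rw [← ENNReal.ofReal_add (mul_nonneg (by positivity) (hk_nonneg _ _))
    (mul_nonneg (by positivity) (hk_nonneg _ _)), Real.enorm_eq_ofReal_abs]
  refine ENNReal.ofReal_le_ofReal ?_
  rw [abs_mul, abs_of_nonneg (hk_nonneg τ z)]
  have h1 : |inner ℝ z w ^ 2 / (2 * τ) ^ 2 - ‖w‖ ^ 2 / (2 * τ)|
      ≤ ‖z‖ ^ 2 * ‖w‖ ^ 2 / (2 * τ) ^ 2 + ‖w‖ ^ 2 / (2 * τ) := by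
    refine (abs_sub _ _).trans ?_
    rw [abs_of_nonneg (by positivity : 0 ≤ inner ℝ z w ^ 2 / (2 * τ) ^ 2),
      abs_of_nonneg (by positivity : 0 ≤ ‖w‖ ^ 2 / (2 * τ))]
    gcongr
    rw [← mul_pow]
    refine sq_le_sq.2 ?_
    rw [abs_of_nonneg (by positivity : 0 ≤ ‖z‖ * ‖w‖)]
    exact abs_real_inner_le_norm z w
  calc _ ≤ (‖z‖ ^ 2 * ‖w‖ ^ 2 / (2 * τ) ^ 2 + ‖w‖ ^ 2 / (2 * τ)) * hk τ z :=
        mul_le_mul_of_nonneg_right h1 (hk_nonneg _ _)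
    _ = ‖w‖ ^ 2 / (2 * τ) * hk τ z + ‖w‖ ^ 2 / τ * (‖z‖ ^ 2 / (4 * τ) * hk τ z) := by
        field_simp; ring
    _ ≤ ‖w‖ ^ 2 / (2 * τ) * hk τ z + ‖w‖ ^ 2 / τ * (2 * hk (2 * τ) z) := by
        exact add_le_add le_rfl (mul_le_mul_of_nonneg_left (sq_mul_hk_le hτ z) (by positivity))
    _ = _ := by ring

lemma lintegral_hkGrad_sub_le {τ : ℝ} (hτ : 0 < τ) (a : Plane) :
    ∫⁻ x, ‖hkGrad τ (x - a)‖ₑ ≤ ENNReal.ofReal (2 / √τ) := by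
  calc ∫⁻ x, ‖hkGrad τ (x - a)‖ₑ
      ≤ ∫⁻ x, ENNReal.ofReal (2 / √τ) * ENNReal.ofReal (hk (2 * τ) (x - a)) := by
        refine lintegral_mono fun x => ?_
        rw [← ENNReal.ofReal_mul (by positivity), ← ofReal_norm]
        exact ENNReal.ofReal_le_ofReal (norm_hkGrad_le hτ _)
    _ = _ := by
        rw [lintegral_const_mul _ (by fun_prop), lintegral_hk_sub (by positivity), mul_one]

end VCHE
end

/-! ### Measurability in L¹ and integral operators on L¹. -/

noncomputable section

namespace VCHE

instance instMeasurableSpaceL1 : MeasurableSpace L1 := borel L1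

instance instBorelSpaceL1 : BorelSpace L1 := ⟨rfl⟩

instance instSecondCountableL1 : SecondCountableTopology L1 :=
  haveI : Fact ((1 : ℝ≥0∞) ≠ ⊤) := ⟨ENNReal.one_ne_top⟩
  Lp.SecondCountableTopology

lemma L1.integrable (f : L1) : Integrable f volume := L1.integrable_coeFn f

lemma L1.lintegral_enorm (f : L1) : ∫⁻ x, ‖f x‖ₑ = ENNReal.ofReal ‖f‖ := by
  rw [L1.norm_eq_integral_norm, ofReal_integral_norm_eq_lintegral_enorm (L1.integrable f)]

lemma L1.norm_le_of_lintegral {f : L1} {A : ℝ} (hA : 0 ≤ A)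
    (h : ∫⁻ x, ‖f x‖ₑ ≤ ENNReal.ofReal A) : ‖f‖ ≤ A := by
  rw [L1.lintegral_enorm] at h
  exact (ENNReal.ofReal_le_ofReal_iff hA).1 h

/-- A map into `L¹` is measurable as soon as it has a jointly measurable representative. -/
lemma measurable_L1_of_uncurry {Ω : Type*} [MeasurableSpace Ω] {F : Ω → L1}
    {φ : Ω → Plane → ℝ} (hφ : StronglyMeasurable (Function.uncurry φ))
    (h : ∀ ω, F ω =ᵐ[volume] φ ω) : Measurable F := by
  have hd : ∀ g : L1, Measurable fun ω => dist (F ω) g := by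
    intro g
    have e : ∀ ω, dist (F ω) g = ∫ x, ‖φ ω x - g x‖ := by
      intro ω
      rw [dist_eq_norm, L1.norm_eq_integral_norm]
      refine integral_congr_ae ?_
      filter_upwards [h ω, Lp.coeFn_sub (F ω) g] with x h1 h2
      rw [h2, Pi.sub_apply, h1]
    simp_rw [e]
    have : StronglyMeasurable (Function.uncurry fun (ω : Ω) x => ‖φ ω x - g x‖) :=
      (hφ.sub ((Lp.stronglyMeasurable g).comp_measurable measurable_snd)).norm
    exact this.integral_prod_right.measurable
  -- In a separable metric space open sets are countable unions of balls, so measurability of the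
  -- distances to fixed points suffices.
  refine measurable_of_isOpen fun U hU => ?_
  have hr : ∀ x : U, ∃ r > 0, Metric.ball (x : L1) r ⊆ U := fun x =>
    Metric.isOpen_iff.1 hU x x.2
  choose r hr0 hrU using hr
  obtain ⟨T, hT, hTU⟩ := TopologicalSpace.isOpen_iUnion_countable
    (fun x : U => Metric.ball (x : L1) (r x)) fun x => Metric.isOpen_ball
  have hU2 : U = ⋃ x ∈ T, Metric.ball (x : L1) (r x) := by
    rw [hTU]
    refine Subset.antisymm (fun x hx => mem_iUnion.2 ⟨⟨x, hx⟩, Metric.mem_ball_self (hr0 _)⟩) ?_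
    exact iUnion_subset hrU
  rw [hU2, preimage_iUnion₂]
  exact MeasurableSet.biUnion hT fun x _ => measurableSet_lt (hd x) measurable_const

/-- Integration over a set, as a continuous functional on `L¹`. -/
def setIntegralCLM (s : Set Plane) : L1 →L[ℝ] ℝ :=
  LinearMap.mkContinuous
    { toFun := fun f => ∫ x in s, f x
      map_add' := fun f g => by
        rw [← integral_add (L1.integrable f).integrableOn (L1.integrable g).integrableOn]
        exact integral_congr_ae (ae_restrict_of_ae (Lp.coeFn_add f g))
      map_smul' := fun c f => by
        simp only [RingHom.id_apply]
        rw [← integral_smul]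
        exact integral_congr_ae (ae_restrict_of_ae (Lp.coeFn_smul c f)) }
    1 fun f => by
      simp only [LinearMap.coe_mk, AddHom.coe_mk, one_mul]
      refine (norm_integral_le_integral_norm _).trans ?_
      rw [L1.norm_eq_integral_norm]
      exact setIntegral_le_integral (L1.integrable f).norm
        (Filter.Eventually.of_forall fun x => norm_nonneg _)

/-- The Bochner integral in `L¹` may be computed pointwise. -/
lemma coeFn_integral_L1 {Ω : Type*} [MeasurableSpace Ω] {μ : Measure Ω} [SFinite μ]
    {F : Ω → L1} {φ : Ω → Plane → ℝ} (hF : Integrable F μ)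
    (hφ : AEStronglyMeasurable (Function.uncurry φ) (μ.prod volume))
    (h : ∀ᵐ ω ∂μ, F ω =ᵐ[volume] φ ω) :
    (∫ ω, F ω ∂μ : L1) =ᵐ[volume] fun x => ∫ ω, φ ω x ∂μ := by
  have hInt : Integrable (Function.uncurry φ) (μ.prod volume) := by
    rw [integrable_prod_iff hφ]
    constructor
    · filter_upwards [h] with ω hω
      exact (L1.integrable (F ω)).congr hω
    · refine hF.norm.congr ?_
      filter_upwards [h] with ω hω
      rw [L1.norm_eq_integral_norm]
      exact integral_congr_ae (hω.fun_comp norm)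
  -- Integration over a set is a continuous functional, so it commutes with the Bochner integral.
  -- Fubini then compares the two sides on every set of finite measure.
  refine Integrable.ae_eq_of_forall_setIntegral_eq _ _ (L1.integrable _)
    hInt.integral_prod_right fun s hs _ => ?_
  have e1 : ∫ x in s, (∫ ω, F ω ∂μ : L1) x = ∫ ω, setIntegralCLM s (F ω) ∂μ :=
    ((setIntegralCLM s).integral_comp_comm hF).symm
  rw [e1]
  have e2 : ∀ᵐ ω ∂μ, setIntegralCLM s (F ω) = ∫ x in s, φ ω x := by
    filter_upwards [h] with ω hω
    exact integral_congr_ae (ae_restrict_of_ae hω)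
  rw [integral_congr_ae e2]
  refine integral_integral_swap ?_
  have h2 := hInt.integrableOn (s := univ ×ˢ s)
  rwa [IntegrableOn, ← Measure.prod_restrict, Measure.restrict_univ] at h2

/-- Measurable kernels whose columns have `L¹` norm at most `A`. -/
structure IsKer (k : Plane → Plane → ℝ) (A : ℝ) : Prop where
  meas : Measurable (Function.uncurry k)
  nonneg : 0 ≤ A
  bound : ∀ y, ∫⁻ x, ‖k x y‖ₑ ≤ ENNReal.ofReal A

open Classical in
/-- The operator on `L¹` with kernel `k`. -/
def kerOp (k : Plane → Plane → ℝ) (f : L1) : L1 :=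
  if h : Integrable (fun x => ∫ y, k x y * f y) then h.toL1 _ else 0

namespace IsKer

variable {k k' : Plane → Plane → ℝ} {A A' : ℝ}

lemma aestronglyMeasurable (hk : IsKer k A) (f : L1) :
    AEStronglyMeasurable (fun p : Plane × Plane => k p.1 p.2 * f p.2) (volume.prod volume) :=
  (hk.meas.stronglyMeasurable.mul
    ((Lp.stronglyMeasurable f).comp_measurable measurable_snd)).aestronglyMeasurable

/-- Schur's test at the exponent 1: by Tonelli only the column masses of the kernel matter. -/
lemma lintegral_le (hk : IsKer k A) (f : L1) :
    ∫⁻ x, ∫⁻ y, ‖k x y * f y‖ₑ ≤ ENNReal.ofReal (A * ‖f‖) := by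
  rw [lintegral_lintegral_swap (hk.aestronglyMeasurable f).enorm]
  calc ∫⁻ y, ∫⁻ x, ‖k x y * f y‖ₑ = ∫⁻ y, (∫⁻ x, ‖k x y‖ₑ) * ‖f y‖ₑ := by
        refine lintegral_congr fun y => ?_
        simp_rw [enorm_mul]
        rw [lintegral_mul_const]
        exact (hk.meas.comp measurable_prodMk_right).enorm
    _ ≤ ∫⁻ y, ENNReal.ofReal A * ‖f y‖ₑ := lintegral_mono fun y => by gcongr; exact hk.bound y
    _ = _ := by
        rw [lintegral_const_mul _ (Lp.stronglyMeasurable f).measurable.enorm, L1.lintegral_enorm,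
          ENNReal.ofReal_mul hk.nonneg]

lemma integrable_prod (hk : IsKer k A) (f : L1) :
    Integrable (fun p : Plane × Plane => k p.1 p.2 * f p.2) (volume.prod volume) := by
  refine ⟨hk.aestronglyMeasurable f, ?_⟩
  rw [HasFiniteIntegral, lintegral_prod _ (hk.aestronglyMeasurable f).enorm]
  exact (hk.lintegral_le f).trans_lt ENNReal.ofReal_lt_top

lemma integrable (hk : IsKer k A) (f : L1) : Integrable (fun x => ∫ y, k x y * f y) :=
  (hk.integrable_prod f).integral_prod_left

lemma ae_integrable (hk : IsKer k A) (f : L1) : ∀ᵐ x, Integrable (fun y => k x y * f y) :=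
  (hk.integrable_prod f).prod_right_ae

lemma coeFn (hk : IsKer k A) (f : L1) : kerOp k f =ᵐ[volume] fun x => ∫ y, k x y * f y := by
  rw [kerOp, dif_pos (hk.integrable f)]
  exact Integrable.coeFn_toL1 _

lemma norm_le (hk : IsKer k A) (f : L1) : ‖kerOp k f‖ ≤ A * ‖f‖ := by
  refine L1.norm_le_of_lintegral (mul_nonneg hk.nonneg (norm_nonneg _)) ?_
  refine le_trans (lintegral_mono_ae ?_) (hk.lintegral_le f)
  filter_upwards [hk.coeFn f] with x hx
  rw [hx]
  exact enorm_integral_le_lintegral_enorm _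

lemma map_sub (hk : IsKer k A) (f g : L1) : kerOp k (f - g) = kerOp k f - kerOp k g := by
  refine Lp.ext ?_
  filter_upwards [hk.coeFn f, hk.coeFn g, hk.coeFn (f - g), Lp.coeFn_sub (kerOp k f) (kerOp k g),
    hk.ae_integrable f, hk.ae_integrable g] with x h1 h2 h3 h4 h5 h6
  rw [h3, h4, Pi.sub_apply, h1, h2, ← integral_sub h5 h6]
  refine integral_congr_ae ?_
  filter_upwards [Lp.coeFn_sub f g] with y hy
  rw [hy, Pi.sub_apply, mul_sub]

lemma map_zero (hk : IsKer k A) : kerOp k 0 = 0 := by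
  simpa using hk.map_sub 0 0

lemma sub_ker (hk : IsKer k A) (hk' : IsKer k' A') (f : L1) :
    kerOp k f - kerOp k' f = kerOp (fun x y => k x y - k' x y) f := by
  have hs : IsKer (fun x y => k x y - k' x y) (A + A') := by
    refine ⟨hk.meas.sub hk'.meas, add_nonneg hk.nonneg hk'.nonneg, fun y => ?_⟩
    rw [ENNReal.ofReal_add hk.nonneg hk'.nonneg]
    calc ∫⁻ x, ‖k x y - k' x y‖ₑ ≤ ∫⁻ x, (‖k x y‖ₑ + ‖k' x y‖ₑ) :=
          lintegral_mono fun x => enorm_sub_le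
      _ = _ := lintegral_add_left (hk.meas.comp measurable_prodMk_right).enorm _
      _ ≤ _ := add_le_add (hk.bound y) (hk'.bound y)
  refine Lp.ext ?_
  filter_upwards [hk.coeFn f, hk'.coeFn f, hs.coeFn f, Lp.coeFn_sub (kerOp k f) (kerOp k' f),
    hk.ae_integrable f, hk'.ae_integrable f] with x h1 h2 h3 h4 h5 h6
  rw [h3, h4, Pi.sub_apply, h1, h2, ← integral_sub h5 h6]
  simp_rw [sub_mul]

lemma norm_sub_le (hk : IsKer k A) (hk' : IsKer k' A') {B : ℝ} (hB : 0 ≤ B)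
    (h : ∀ y, ∫⁻ x, ‖k x y - k' x y‖ₑ ≤ ENNReal.ofReal B) (f : L1) :
    ‖kerOp k f - kerOp k' f‖ ≤ B * ‖f‖ := by
  rw [hk.sub_ker hk' f]
  have hs : IsKer (fun x y => k x y - k' x y) B := ⟨hk.meas.sub hk'.meas, hB, h⟩
  exact hs.norm_le f

lemma const_mul (hk : IsKer k A) (c : ℝ) : IsKer (fun x y => c * k x y) (|c| * A) := by
  refine ⟨hk.meas.const_mul c, mul_nonneg (abs_nonneg c) hk.nonneg, fun y => ?_⟩
  simp_rw [enorm_mul]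
  have m : Measurable fun x => ‖k x y‖ₑ := (hk.meas.comp measurable_prodMk_right).enorm
  rw [lintegral_const_mul _ m,
    ENNReal.ofReal_mul (abs_nonneg c), Real.enorm_eq_ofReal_abs]
  gcongr
  exact hk.bound y

lemma smul_ker (hk : IsKer k A) (c : ℝ) (f : L1) :
    kerOp (fun x y => c * k x y) f = c • kerOp k f := by
  refine Lp.ext ?_
  filter_upwards [hk.coeFn f, (hk.const_mul c).coeFn f, Lp.coeFn_smul c (kerOp k f)]
    with x h1 h2 h3
  rw [h2, h3, Pi.smul_apply, h1, smul_eq_mul, ← integral_const_mul]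
  simp_rw [mul_assoc]

end IsKer

/-- Composition of kernel operators. -/
lemma kerOp_kerOp {k k' k'' : Plane → Plane → ℝ} {A A' A'' : ℝ} (hk : IsKer k A)
    (hk' : IsKer k' A') (hk'' : IsKer k'' A'')
    (h : ∀ x y, ∫ z, k x z * k' z y = k'' x y) (f : L1) :
    kerOp k (kerOp k' f) = kerOp k'' f := by
  -- Finiteness of the full triple integral of absolute values justifies Fubini in (z, y) for almost
  -- every x.
  have hprod : ∫⁻ x, ∫⁻ z, ∫⁻ y, ‖k x z‖ₑ * ‖k' z y * f y‖ₑ ≠ ⊤ := by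
    have m1 : Measurable fun p : Plane × Plane => ‖k' p.1 p.2 * f p.2‖ₑ :=
      (hk'.meas.mul ((Lp.stronglyMeasurable f).measurable.comp measurable_snd)).enorm
    have m2 : Measurable fun z => ∫⁻ y, ‖k' z y * f y‖ₑ := m1.lintegral_prod_right'
    have e1 : ∀ x, ∫⁻ z, ∫⁻ y, ‖k x z‖ₑ * ‖k' z y * f y‖ₑ
        = ∫⁻ z, ‖k x z‖ₑ * ∫⁻ y, ‖k' z y * f y‖ₑ := fun x =>
      lintegral_congr fun z => lintegral_const_mul _ (m1.comp measurable_prodMk_left)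
    simp_rw [e1]
    rw [lintegral_lintegral_swap ((hk.meas.enorm.mul (m2.comp measurable_snd)).aemeasurable)]
    refine ne_of_lt (lt_of_le_of_lt (b := ENNReal.ofReal A * ENNReal.ofReal (A' * ‖f‖)) ?_
      (ENNReal.mul_lt_top ENNReal.ofReal_lt_top ENNReal.ofReal_lt_top))
    calc ∫⁻ z, ∫⁻ x, ‖k x z‖ₑ * ∫⁻ y, ‖k' z y * f y‖ₑ
        = ∫⁻ z, (∫⁻ x, ‖k x z‖ₑ) * ∫⁻ y, ‖k' z y * f y‖ₑ :=
          lintegral_congr fun z =>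
            lintegral_mul_const _ (hk.meas.comp measurable_prodMk_right).enorm
      _ ≤ ∫⁻ z, ENNReal.ofReal A * ∫⁻ y, ‖k' z y * f y‖ₑ :=
          lintegral_mono fun z => by gcongr; exact hk.bound z
      _ = ENNReal.ofReal A * ∫⁻ z, ∫⁻ y, ‖k' z y * f y‖ₑ := lintegral_const_mul _ m2
      _ ≤ _ := by gcongr; exact hk'.lintegral_le f
  have m3 : Measurable fun q : Plane × Plane × Plane => ‖k q.1 q.2.1‖ₑ *
      ‖k' q.2.1 q.2.2 * f q.2.2‖ₑ := by
    have a1 : Measurable fun q : Plane × Plane × Plane => k q.1 q.2.1 :=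
      hk.meas.comp (measurable_fst.prodMk measurable_snd.fst)
    have a2 : Measurable fun q : Plane × Plane × Plane => k' q.2.1 q.2.2 :=
      hk'.meas.comp measurable_snd
    have a3 : Measurable fun q : Plane × Plane × Plane => f q.2.2 :=
      (Lp.stronglyMeasurable f).measurable.comp measurable_snd.snd
    exact a1.enorm.mul (a2.mul a3).enorm
  have hfin : ∀ᵐ x, ∫⁻ z, ∫⁻ y, ‖k x z‖ₑ * ‖k' z y * f y‖ₑ < ⊤ := by
    have m4 : Measurable fun x => ∫⁻ z, ∫⁻ y, ‖k x z‖ₑ * ‖k' z y * f y‖ₑ := by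
      have : Measurable fun p : Plane × Plane => ∫⁻ y, ‖k p.1 p.2‖ₑ * ‖k' p.2 y * f y‖ₑ := by
        have := Measurable.lintegral_prod_right' (ν := (volume : Measure Plane))
          (f := fun q : (Plane × Plane) × Plane => ‖k q.1.1 q.1.2‖ₑ * ‖k' q.1.2 q.2 * f q.2‖ₑ)
          (m3.comp (g := fun q : Plane × Plane × Plane => ‖k q.1 q.2.1‖ₑ *
            ‖k' q.2.1 q.2.2 * f q.2.2‖ₑ) (f := fun q : (Plane × Plane) × Plane =>
              (q.1.1, q.1.2, q.2)) (by fun_prop))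
        exact this
      exact this.lintegral_prod_right'
    exact ae_lt_top m4 hprod
  refine Lp.ext ?_
  filter_upwards [hk.coeFn (kerOp k' f), hk''.coeFn f, hfin] with x h1 h2 h3
  rw [h1, h2]
  have e2 : ∫ z, k x z * kerOp k' f z = ∫ z, ∫ y, k x z * (k' z y * f y) := by
    refine integral_congr_ae ?_
    filter_upwards [hk'.coeFn f] with z hz
    rw [hz, integral_const_mul]
  rw [e2, integral_integral_swap]
  · refine integral_congr_ae (Filter.Eventually.of_forall fun y => ?_)
    simp only
    rw [← h x y, ← integral_mul_const]
    simp_rw [mul_assoc]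
  · have m5 : Measurable fun p : Plane × Plane => k x p.1 * (k' p.1 p.2 * f p.2) := by
      have a1 : Measurable fun p : Plane × Plane => k x p.1 :=
        hk.meas.comp (measurable_const.prodMk measurable_fst)
      have a3 : Measurable fun q : Plane × Plane => f q.2 :=
        (Lp.stronglyMeasurable f).measurable.comp measurable_snd
      exact a1.mul (hk'.meas.mul a3)
    refine ⟨m5.aestronglyMeasurable, ?_⟩
    rw [HasFiniteIntegral]
    simp only [Function.uncurry_def]
    rw [lintegral_prod _ m5.enorm.aemeasurable]
    simpa only [enorm_mul] using h3

end VCHE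
end

/-! ### Volterra equations with a τ^{-1/2} singularity. -/

noncomputable section

namespace VCHE

section Volterra

open Filter Topology

lemma integrableOn_reflect {ρ : ℝ → ℝ} {t : ℝ} (h : IntegrableOn ρ (Ioc 0 t)) :
    IntegrableOn (fun s => ρ (t - s)) (Ioc 0 t) := by
  rcases le_or_gt t 0 with ht | ht
  · simp [Ioc_eq_empty ht.not_gt]
  · rw [← intervalIntegrable_iff_integrableOn_Ioc_of_le ht.le] at h ⊢
    simpa using (h.comp_sub_left t).symm

lemma setIntegral_reflect (ρ : ℝ → ℝ) (t : ℝ) :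
    ∫ s in Ioc 0 t, ρ (t - s) = ∫ s in Ioc 0 t, ρ s := by
  rcases le_or_gt t 0 with ht | ht
  · simp [Ioc_eq_empty ht.not_gt]
  · rw [← intervalIntegral.integral_of_le ht.le, ← intervalIntegral.integral_of_le ht.le]
    simp

lemma integrableOn_inv_sqrt (t : ℝ) : IntegrableOn (fun s => 1 / √s) (Ioc 0 t) := by
  rcases le_or_gt t 0 with ht | ht
  · simp [Ioc_eq_empty ht.not_gt]
  · have h := intervalIntegral.intervalIntegrable_rpow' (a := 0) (b := t)
      (r := -(1 / 2)) (by norm_num)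
    rw [intervalIntegrable_iff_integrableOn_Ioc_of_le ht.le] at h
    refine h.congr_fun (fun s hs => ?_) measurableSet_Ioc
    simp only
    rw [Real.rpow_neg hs.1.le, ← Real.sqrt_eq_rpow, one_div]

lemma integrableOn_inv_sqrt_sub (b t : ℝ) :
    IntegrableOn (fun s => b / √(t - s)) (Ioc 0 t) := by
  have h := (integrableOn_reflect (integrableOn_inv_sqrt t)).const_mul b
  simp only [mul_one_div] at h
  exact h

lemma integrableOn_inv_sqrt_sub_mul_exp (b t lam : ℝ) :
    IntegrableOn (fun s => b / √(t - s) * Real.exp (lam * s)) (Ioc 0 t) := by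
  rw [← integrableOn_Icc_iff_integrableOn_Ioc]
  refine IntegrableOn.mul_continuousOn ?_ (by fun_prop) isCompact_Icc
  rw [integrableOn_Icc_iff_integrableOn_Ioc]
  exact integrableOn_inv_sqrt_sub b t

/-- The weakly singular Volterra kernel is a contraction in an exponentially weighted norm. -/
lemma exists_exp_weight {b : ℝ} (hb : 0 ≤ b) :
    ∃ lam > 0, ∀ t, ∫ s in Ioc 0 t, b / √(t - s) * Real.exp (lam * s)
      ≤ 1 / 2 * Real.exp (lam * t) := by
  -- Chosen so that b √(π/λ) ≤ 1/2, where √(π/λ) = ∫₀^∞ τ^{-1/2} e^{-λτ} dτ. The summand 1 keeps λ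
  -- positive when b = 0.
  set lam := 4 * Real.pi * b ^ 2 + 1 with hl
  have hl0 : 0 < lam := by positivity
  refine ⟨lam, hl0, fun t => ?_⟩
  have hG := Real.integral_rpow_mul_exp_neg_mul_Ioi (a := 1 / 2) (r := lam) (by norm_num) hl0
  have hGi : IntegrableOn (fun τ : ℝ => τ ^ ((1 : ℝ) / 2 - 1) * Real.exp (-(lam * τ))) (Ioi 0) := by
    by_contra hn
    rw [integral_undef hn, Real.Gamma_one_half_eq] at hG
    have : 0 < (1 / lam) ^ ((1 : ℝ) / 2) * √Real.pi := by positivity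
    linarith
  have e1 : ∫ s in Ioc 0 t, b / √(t - s) * Real.exp (lam * s)
      = ∫ s in Ioc 0 t, b / √s * Real.exp (lam * (t - s)) := by
    simpa only [sub_sub_cancel] using
      setIntegral_reflect (fun s => b / √s * Real.exp (lam * (t - s))) t
  have e2 : ∫ s in Ioc 0 t, b / √s * Real.exp (lam * (t - s))
      = b * Real.exp (lam * t) * ∫ τ in Ioc 0 t, τ ^ ((1 : ℝ) / 2 - 1) * Real.exp (-(lam * τ)) := by
    rw [← integral_const_mul]
    refine setIntegral_congr_fun measurableSet_Ioc fun s hs => ?_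
    rw [show (1 : ℝ) / 2 - 1 = -(1 / 2) by norm_num, Real.rpow_neg hs.1.le, ← Real.sqrt_eq_rpow,
      show lam * (t - s) = lam * t + -(lam * s) by ring, Real.exp_add]
    ring
  rw [e1, e2]
  have h3 : ∫ τ in Ioc 0 t, τ ^ ((1 : ℝ) / 2 - 1) * Real.exp (-(lam * τ))
      ≤ (1 / lam) ^ ((1 : ℝ) / 2) * √Real.pi := by
    rw [← Real.Gamma_one_half_eq, ← hG]
    refine setIntegral_mono_set hGi ?_ (LE.le.eventuallyLE Ioc_subset_Ioi_self)
    filter_upwards [ae_restrict_mem measurableSet_Ioi] with τ hτ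
    have : 0 < τ := hτ
    positivity
  have h4 : b * ((1 / lam) ^ ((1 : ℝ) / 2) * √Real.pi) ≤ 1 / 2 := by
    rw [← Real.sqrt_eq_rpow, ← Real.sqrt_mul (by positivity)]
    refine abs_le_of_sq_le_sq' ?_ (by norm_num) |>.2
    rw [mul_pow, Real.sq_sqrt (by positivity)]
    rw [one_div_mul_eq_div, mul_div_assoc', div_le_iff₀ hl0, hl]
    nlinarith [Real.pi_pos]
  have h5 := mul_le_mul_of_nonneg_left h3 (mul_nonneg hb (Real.exp_pos (lam * t)).le)
  nlinarith [Real.exp_pos (lam * t)]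

/-- In the norm weighted by e^{-λt} the singular kernel is a contraction with factor 1/2; both
Grönwall lemmas and the Picard iteration rest on this. -/
lemma setIntegral_inv_sqrt_mul_le {b lam : ℝ} (hb : 0 ≤ b)
    (hlam : ∀ t, ∫ s in Ioc 0 t, b / √(t - s) * Real.exp (lam * s) ≤ 1 / 2 * Real.exp (lam * t))
    {D : ℝ → ℝ} {B t : ℝ} (hB : 0 ≤ B) (hD0 : ∀ s, 0 ≤ D s)
    (hD : ∀ᵐ s ∂volume.restrict (Ioc 0 t), D s ≤ B * Real.exp (lam * s)) :
    ∫ s in Ioc 0 t, b / √(t - s) * D s ≤ B / 2 * Real.exp (lam * t) := by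
  calc ∫ s in Ioc 0 t, b / √(t - s) * D s
      ≤ ∫ s in Ioc 0 t, B * (b / √(t - s) * Real.exp (lam * s)) := by
        refine integral_mono_of_nonneg
          (Eventually.of_forall fun s => mul_nonneg (by positivity) (hD0 s))
          ((integrableOn_inv_sqrt_sub_mul_exp b t lam).const_mul B) ?_
        filter_upwards [hD] with s hs
        have := mul_le_mul_of_nonneg_left hs (show 0 ≤ b / √(t - s) by positivity)
        linarith
    _ = B * ∫ s in Ioc 0 t, b / √(t - s) * Real.exp (lam * s) := integral_const_mul _ _
    _ ≤ B * (1 / 2 * Real.exp (lam * t)) := mul_le_mul_of_nonneg_left (hlam t) hB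
    _ = _ := by ring

/-- Grönwall's lemma for the weakly singular kernel, almost everywhere. -/
lemma gronwall_singular_ae {b lam : ℝ} (hb : 0 ≤ b) (hl0 : 0 < lam)
    (hlam : ∀ t, ∫ s in Ioc 0 t, b / √(t - s) * Real.exp (lam * s) ≤ 1 / 2 * Real.exp (lam * t))
    {D : ℝ → ℝ} {a B T : ℝ} (ha : 0 ≤ a) (hD0 : ∀ s, 0 ≤ D s)
    (hDB : ∀ᵐ s ∂volume.restrict (Ioc 0 T), D s ≤ B)
    (hD : ∀ᵐ t ∂volume.restrict (Ioc 0 T), D t ≤ a + ∫ s in Ioc 0 t, b / √(t - s) * D s) :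
    ∀ᵐ t ∂volume.restrict (Ioc 0 T), D t ≤ 2 * a * Real.exp (lam * t) := by
  -- A bound (2a + c)e^{λt} improves to a + (a + c/2)e^{λt}, hence to (2a + c/2)e^{λt} because
  -- e^{λt} ≥ 1. Iteration removes the a priori bound B.
  have key : ∀ n : ℕ, ∀ᵐ t ∂volume.restrict (Ioc 0 T),
      D t ≤ (2 * a + |B| * (1 / 2) ^ n) * Real.exp (lam * t) := by
    intro n
    induction n with
    | zero =>
      filter_upwards [hDB, ae_restrict_mem measurableSet_Ioc] with t h1 ht
      have h2 : 1 ≤ Real.exp (lam * t) := Real.one_le_exp (by have := ht.1; positivity)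
      have h3 : 0 ≤ 2 * a + |B| := by positivity
      simp only [pow_zero, mul_one]
      have h4 := le_abs_self B
      nlinarith
    | succ n ih =>
      filter_upwards [hD, ae_restrict_mem measurableSet_Ioc] with t h1 ht
      have h2 := setIntegral_inv_sqrt_mul_le hb hlam (t := t)
        (B := 2 * a + |B| * (1 / 2) ^ n) (by positivity) hD0
        (ae_restrict_of_ae_restrict_of_subset (Ioc_subset_Ioc_right ht.2) ih)
      have h3 : 1 ≤ Real.exp (lam * t) := Real.one_le_exp (by have := ht.1; positivity)
      rw [pow_succ]
      nlinarith
  filter_upwards [ae_all_iff.2 key] with t ht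
  have h1 : Tendsto (fun n : ℕ => (2 * a + |B| * (1 / 2) ^ n) * Real.exp (lam * t)) atTop
      (𝓝 ((2 * a + |B| * 0) * Real.exp (lam * t))) :=
    ((tendsto_const_nhds.add ((tendsto_pow_atTop_nhds_zero_of_lt_one (by norm_num)
      (by norm_num)).const_mul _)).mul_const _)
  simpa using ge_of_tendsto' h1 ht

/-- Grönwall's lemma for the weakly singular kernel. -/
lemma gronwall_singular {b lam : ℝ} (hb : 0 ≤ b) (hl0 : 0 < lam)
    (hlam : ∀ t, ∫ s in Ioc 0 t, b / √(t - s) * Real.exp (lam * s) ≤ 1 / 2 * Real.exp (lam * t))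
    {D : ℝ → ℝ} {a B T : ℝ} (ha : 0 ≤ a) (hD0 : ∀ s, 0 ≤ D s) (hDB : ∀ s, D s ≤ B)
    (hD : ∀ t ∈ Ioc 0 T, D t ≤ a + ∫ s in Ioc 0 t, b / √(t - s) * D s) :
    ∀ t ∈ Ioc 0 T, D t ≤ 2 * a * Real.exp (lam * t) := by
  intro t ht
  have h := gronwall_singular_ae hb hl0 hlam ha hD0 (B := B) (T := T)
    (Eventually.of_forall hDB) ((ae_restrict_mem measurableSet_Ioc).mono hD)
  -- The integral sees D only almost everywhere, so one further use of the inequality turns the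
  -- almost everywhere bound into a bound at every t.
  have h2 := setIntegral_inv_sqrt_mul_le hb hlam (t := t) (B := 2 * a) (by positivity) hD0
    (ae_restrict_of_ae_restrict_of_subset (Ioc_subset_Ioc_right ht.2) h)
  have h3 : 1 ≤ Real.exp (lam * t) := Real.one_le_exp (by have := ht.1; positivity)
  have h4 := hD t ht
  nlinarith

variable {E : Type*} [NormedAddCommGroup E]

lemma norm_le_of_lipschitz_zero {N : ℝ → E → E} {M b : ℝ} (hM : 0 ≤ M) (hb : 0 ≤ b)
    (hLip : ∀ τ > 0, ∀ f g, ‖f‖ ≤ M → ‖g‖ ≤ M → ‖N τ f - N τ g‖ ≤ b / √τ * ‖f - g‖)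
    (hN0 : ∀ τ, N τ 0 = 0) {τ : ℝ} (hτ : 0 < τ) {f : E} (hf : ‖f‖ ≤ M) :
    ‖N τ f‖ ≤ b * M / √τ := by
  have h := hLip τ hτ f 0 hf (by simpa using hM)
  rw [hN0, sub_zero, sub_zero] at h
  refine h.trans ?_
  rw [mul_div_right_comm]
  gcongr

lemma measurable_comp_sub {F : Type*} [MeasurableSpace F] {N : ℝ → F → F}
    (hN : Measurable (Function.uncurry N)) {v : ℝ → F}
    (hv : Measurable v) : Measurable (Function.uncurry fun t s => N (t - s) (v s)) :=
  hN.comp ((measurable_fst.sub measurable_snd).prodMk (hv.comp measurable_snd))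

/-- The endpoint s = t is a null set; it is removed because the bounds on the kernel at time t - s
are assumed only for t - s > 0. -/
lemma ae_Ioc_sub_pos (t : ℝ) : ∀ᵐ s ∂volume.restrict (Ioc 0 t), 0 < t - s := by
  rw [← restrict_Ioo_eq_restrict_Ioc]
  filter_upwards [ae_restrict_mem measurableSet_Ioo] with s hs
  linarith [hs.2]

variable [MeasurableSpace E] [BorelSpace E] [SecondCountableTopology E]

lemma integrableOn_volterra {N : ℝ → E → E} (hN : Measurable (Function.uncurry N))
    {ρ : ℝ → ℝ} {M : ℝ} {t : ℝ} (hρ : IntegrableOn ρ (Ioc 0 t))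
    (hNρ : ∀ τ > 0, ∀ f, ‖f‖ ≤ M → ‖N τ f‖ ≤ ρ τ) {v : ℝ → E} (hv : Measurable v)
    (hvM : ∀ s, ‖v s‖ ≤ M) : IntegrableOn (fun s => N (t - s) (v s)) (Ioc 0 t) := by
  refine (integrableOn_reflect hρ).mono'
    ((measurable_comp_sub hN hv).comp measurable_prodMk_left).aestronglyMeasurable ?_
  filter_upwards [ae_Ioc_sub_pos t] with s hs
  exact hNρ _ hs _ (hvM s)

variable [NormedSpace ℝ E]

lemma measurable_setIntegral_Ioc {g : ℝ → ℝ → E} (hg : Measurable (Function.uncurry g)) :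
    Measurable fun t => ∫ s in Ioc 0 t, g t s := by
  have h1 : ∀ t, ∫ s in Ioc 0 t, g t s
      = ∫ s, {p : ℝ × ℝ | 0 < p.2 ∧ p.2 ≤ p.1}.indicator (Function.uncurry g) (t, s) := by
    intro t
    rw [← integral_indicator measurableSet_Ioc]
    rfl
  simp_rw [h1]
  have hs : MeasurableSet {p : ℝ × ℝ | 0 < p.2 ∧ p.2 ≤ p.1} :=
    (measurableSet_lt measurable_const measurable_snd).inter
      (measurableSet_le measurable_snd measurable_fst)
  exact ((hg.indicator hs).stronglyMeasurable.integral_prod_right').measurable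

/-- One step of the Picard iteration for a Volterra equation. -/
def picard (N : ℝ → E → E) (a : ℝ → E) (v : ℝ → E) (t : ℝ) : E :=
  a t + ∫ s in Ioc 0 t, N (t - s) (v s)

lemma measurable_picard {N : ℝ → E → E} (hN : Measurable (Function.uncurry N)) {a v : ℝ → E}
    (ha : Measurable a) (hv : Measurable v) : Measurable (picard N a v) :=
  ha.add (measurable_setIntegral_Ioc (measurable_comp_sub hN hv))

variable [CompleteSpace E]

/-- Global solvability of a Volterra equation with weakly singular kernel whose Picard operator
preserves a ball. -/
theorem exists_volterra_solution {N : ℝ → E → E} {a : ℝ → E} {M b : ℝ}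
    (hN : Measurable (Function.uncurry N)) (ha : Measurable a) (hM : 0 ≤ M) (hb : 0 ≤ b)
    (hLip : ∀ τ > 0, ∀ f g, ‖f‖ ≤ M → ‖g‖ ≤ M → ‖N τ f - N τ g‖ ≤ b / √τ * ‖f - g‖)
    (hN0 : ∀ τ, N τ 0 = 0)
    (hinv : ∀ v, Measurable v → (∀ s, ‖v s‖ ≤ M) → ∀ t, ‖picard N a v t‖ ≤ M) :
    ∃ v : ℝ → E, Measurable v ∧ (∀ t, ‖v t‖ ≤ M) ∧ (∀ t, v t = picard N a v t) ∧
      ∀ t, Tendsto (fun j => (picard N a)^[j] 0 t) atTop (𝓝 (v t)) := by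
  set V : ℕ → ℝ → E := fun j => (picard N a)^[j] 0 with hV
  have hVs : ∀ j, V (j + 1) = picard N a (V j) := fun j => Function.iterate_succ_apply' _ _ _
  have hV0 : V 0 = 0 := rfl
  have hVm : ∀ j, Measurable (V j) := by
    intro j
    induction j with
    | zero => exact measurable_const
    | succ j ih => rw [hVs]; exact measurable_picard hN ha ih
  have hVM : ∀ j t, ‖V j t‖ ≤ M := by
    intro j
    induction j with
    | zero => intro t; simpa [hV0] using hM
    | succ j ih => intro t; rw [hVs]; exact hinv _ (hVm j) ih t
  have hNρ : ∀ τ > 0, ∀ f, ‖f‖ ≤ M → ‖N τ f‖ ≤ b * M / √τ := fun τ hτ f hf =>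
    norm_le_of_lipschitz_zero hM hb hLip hN0 hτ hf
  have hρ : ∀ t, IntegrableOn (fun τ => b * M / √τ) (Ioc 0 t) := fun t => by
    have h := (integrableOn_inv_sqrt t).const_mul (b * M)
    simp only [mul_one_div] at h
    exact h
  obtain ⟨lam, hl0, hlam⟩ := exists_exp_weight hb
  have hdiff : ∀ j t, 0 < t → ‖V (j + 1) t - V j t‖ ≤ M * (1 / 2) ^ j * Real.exp (lam * t) := by
    intro j
    induction j with
    | zero =>
      intro t ht
      have h1 : 1 ≤ Real.exp (lam * t) := Real.one_le_exp (by positivity)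
      have h2 := hVM 1 t
      simp only [hV0, Pi.zero_apply, sub_zero, pow_zero, mul_one, zero_add]
      nlinarith
    | succ j ih =>
      intro t ht
      have e : V (j + 1 + 1) t - V (j + 1) t
          = ∫ s in Ioc 0 t, (N (t - s) (V (j + 1) s) - N (t - s) (V j s)) := by
        rw [integral_sub (integrableOn_volterra hN (hρ t) hNρ (hVm _) (hVM _))
          (integrableOn_volterra hN (hρ t) hNρ (hVm _) (hVM _)),
          congrFun (hVs (j + 1)) t, congrFun (hVs j) t, picard, picard]
        abel
      rw [e]
      have h2 := setIntegral_inv_sqrt_mul_le hb hlam (t := t) (B := M * (1 / 2) ^ j)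
        (D := fun s => ‖V (j + 1) s - V j s‖) (by positivity) (fun s => norm_nonneg _)
        ((ae_restrict_mem measurableSet_Ioc).mono fun s hs => ih s hs.1)
      refine (norm_integral_le_of_norm_le (g := fun s => b / √(t - s) * ‖V (j + 1) s - V j s‖)
        ?_ ?_).trans (h2.trans (le_of_eq (by ring)))
      · refine ((integrableOn_inv_sqrt_sub b t).mul_bdd (c := 2 * M) ?_ ?_)
        · exact ((hVm _).sub (hVm _)).norm.aestronglyMeasurable
        · refine Eventually.of_forall fun s => ?_
          rw [norm_norm]
          exact (norm_sub_le _ _).trans (by linarith [hVM (j + 1) s, hVM j s])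
      · filter_upwards [ae_Ioc_sub_pos t] with s hs
        exact hLip _ hs _ _ (hVM _ _) (hVM _ _)
  have hlim : ∀ t, ∃ x, Tendsto (fun j => V j t) atTop (𝓝 x) := by
    intro t
    rcases le_or_gt t 0 with ht | ht
    -- For t ≤ 0 the domain of integration is empty, so all iterates from the index 1 on equal a t.
    · refine ⟨a t, tendsto_atTop_of_eventually_const (i₀ := 1) fun j hj => ?_⟩
      obtain ⟨i, rfl⟩ := Nat.exists_eq_add_of_le' hj
      rw [hVs]
      simp [picard, Ioc_eq_empty ht.not_gt]
    · refine cauchySeq_tendsto_of_complete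
        (cauchySeq_of_le_geometric (1 / 2) (M * Real.exp (lam * t)) (by norm_num) fun j => ?_)
      rw [dist_comm, dist_eq_norm]
      exact (hdiff j t ht).trans (le_of_eq (by ring))
  choose v hv using hlim
  have hvm : Measurable v := measurable_of_tendsto_metrizable hVm (tendsto_pi_nhds.2 hv)
  have hvM : ∀ t, ‖v t‖ ≤ M := fun t => le_of_tendsto' (hv t).norm fun j => hVM j t
  refine ⟨v, hvm, hvM, fun t => ?_, hv⟩
  refine tendsto_nhds_unique ((hv t).comp (tendsto_add_atTop_nat 1)) ?_
  simp only [Function.comp_def, hVs]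
  refine tendsto_const_nhds.add ?_
  refine tendsto_integral_of_dominated_convergence (fun s => b * M / √(t - s)) (fun j => ?_)
    (integrableOn_reflect (hρ t)) (fun j => ?_) ?_
  · exact (integrableOn_volterra hN (hρ t) hNρ (hVm _) (hVM _)).aestronglyMeasurable
  · filter_upwards [ae_Ioc_sub_pos t] with s hs
    exact hNρ _ hs _ (hVM _ _)
  · filter_upwards [ae_Ioc_sub_pos t] with s hs
    rw [tendsto_iff_norm_sub_tendsto_zero]
    have h0 : Tendsto (fun j => b / √(t - s) * ‖V j s - v s‖) atTop (𝓝 (b / √(t - s) * 0)) :=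
      (tendsto_iff_norm_sub_tendsto_zero.1 (hv s)).const_mul _
    rw [mul_zero] at h0
    exact squeeze_zero (fun j => norm_nonneg _) (fun j => hLip _ hs _ _ (hVM _ _) (hvM _)) h0

/-- Solutions of approximate Volterra equations converge to a solution of the limit equation. -/
theorem exists_tendsto_volterra {B : ℝ → E → E} {Bn : ℕ → ℝ → E → E} {z : ℝ → E}
    {vn : ℕ → ℝ → E} {e : ℕ → ℝ} {ρ : ℝ → ℝ} {M b : ℝ} (hM : 0 ≤ M) (hb : 0 ≤ b)
    (hBn : ∀ n, Measurable (Function.uncurry (Bn n)))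
    (hLip : ∀ τ > 0, ∀ f g, ‖f‖ ≤ M → ‖g‖ ≤ M → ‖B τ f - B τ g‖ ≤ b / √τ * ‖f - g‖)
    (hB0 : ∀ τ, B τ 0 = 0) (he0 : ∀ n, 0 ≤ e n) (he : Tendsto e atTop (𝓝 0))
    (hρ0 : ∀ τ, 0 ≤ ρ τ) (hρ : ∀ t, IntegrableOn ρ (Ioc 0 t))
    (happ : ∀ n, ∀ τ > 0, ∀ f, ‖f‖ ≤ M → ‖Bn n τ f - B τ f‖ ≤ e n * ρ τ)
    (hvm : ∀ n, Measurable (vn n)) (hvM : ∀ n t, ‖vn n t‖ ≤ M)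
    (heq : ∀ n, ∀ t > 0, vn n t = z t + ∫ s in Ioc 0 t, Bn n (t - s) (vn n s)) :
    ∃ v : ℝ → E, Measurable v ∧ (∀ t, ‖v t‖ ≤ M) ∧
      (∀ t > 0, v t = z t + ∫ s in Ioc 0 t, B (t - s) (v s)) ∧
      ∀ t > 0, Tendsto (fun n => vn n t) atTop (𝓝 (v t)) := by
  have hBρ : ∀ τ > 0, ∀ f, ‖f‖ ≤ M → ‖B τ f‖ ≤ b * M / √τ := fun τ hτ f hf =>
    norm_le_of_lipschitz_zero hM hb hLip hB0 hτ hf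
  have hsq : ∀ t, IntegrableOn (fun τ => b * M / √τ) (Ioc 0 t) := fun t => by
    have h := (integrableOn_inv_sqrt t).const_mul (b * M)
    simp only [mul_one_div] at h
    exact h
  have hBnρ : ∀ n, ∀ τ > 0, ∀ f, ‖f‖ ≤ M → ‖Bn n τ f‖ ≤ b * M / √τ + e n * ρ τ := by
    intro n τ hτ f hf
    have h1 := norm_add_le (B τ f) (Bn n τ f - B τ f)
    rw [add_sub_cancel] at h1
    exact h1.trans (add_le_add (hBρ τ hτ f hf) (happ n τ hτ f hf))
  have hsn : ∀ n t, IntegrableOn (fun τ => b * M / √τ + e n * ρ τ) (Ioc 0 t) := fun n t =>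
    (hsq t).add ((hρ t).const_mul _)
  obtain ⟨lam, hl0, hlam⟩ := exists_exp_weight hb
  -- Both approximate nonlinearities are compared with the limit B. The two consistency errors play
  -- the role of the free term in Grönwall's lemma, and the Lipschitz bound of B supplies its
  -- kernel.
  have hcau : ∀ T > 0, ∀ n m, ‖vn n T - vn m T‖
      ≤ 2 * ((e n + e m) * ∫ s in Ioc 0 T, ρ s) * Real.exp (lam * T) := by
    intro T hT n m
    refine gronwall_singular hb hl0 hlam (D := fun t => ‖vn n t - vn m t‖) (B := 2 * M)
      (mul_nonneg (add_nonneg (he0 n) (he0 m)) (integral_nonneg fun s => hρ0 s))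
      (fun t => norm_nonneg _)
      (fun t => (norm_sub_le _ _).trans (by linarith [hvM n t, hvM m t])) (fun t ht => ?_) T
      ⟨hT, le_rfl⟩
    have i1 := integrableOn_volterra (hBn n) (hsn n t) (hBnρ n) (hvm n) (hvM n)
    have i2 := integrableOn_volterra (hBn m) (hsn m t) (hBnρ m) (hvm m) (hvM m)
    have e1 : vn n t - vn m t
        = ∫ s in Ioc 0 t, (Bn n (t - s) (vn n s) - Bn m (t - s) (vn m s)) := by
      rw [integral_sub i1 i2, heq n t ht.1, heq m t ht.1]
      abel
    have i3 : IntegrableOn (fun s => (e n + e m) * ρ (t - s)) (Ioc 0 t) :=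
      (integrableOn_reflect (hρ t)).const_mul _
    have i4 : IntegrableOn (fun s => b / √(t - s) * ‖vn n s - vn m s‖) (Ioc 0 t) := by
      refine ((integrableOn_inv_sqrt_sub b t).mul_bdd (c := 2 * M) ?_ ?_)
      · exact ((hvm _).sub (hvm _)).norm.aestronglyMeasurable
      · refine Eventually.of_forall fun s => ?_
        rw [norm_norm]
        exact (norm_sub_le _ _).trans (by linarith [hvM n s, hvM m s])
    rw [e1]
    refine (norm_integral_le_of_norm_le (i3.add i4) ?_).trans ?_
    · filter_upwards [ae_Ioc_sub_pos t] with s hs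
      have h1 := happ n _ hs _ (hvM n s)
      have h2 := happ m _ hs _ (hvM m s)
      have h3 := hLip _ hs _ _ (hvM n s) (hvM m s)
      have e2 : Bn n (t - s) (vn n s) - Bn m (t - s) (vn m s)
          = (Bn n (t - s) (vn n s) - B (t - s) (vn n s))
            - (Bn m (t - s) (vn m s) - B (t - s) (vn m s))
            + (B (t - s) (vn n s) - B (t - s) (vn m s)) := by abel
      rw [e2, Pi.add_apply]
      have h4 := norm_add_le ((Bn n (t - s) (vn n s) - B (t - s) (vn n s))
            - (Bn m (t - s) (vn m s) - B (t - s) (vn m s)))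
            (B (t - s) (vn n s) - B (t - s) (vn m s))
      have h5 := norm_sub_le (Bn n (t - s) (vn n s) - B (t - s) (vn n s))
            (Bn m (t - s) (vn m s) - B (t - s) (vn m s))
      linarith
    · simp only [Pi.add_apply]
      rw [integral_add i3 i4, integral_const_mul, setIntegral_reflect]
      gcongr
      · exact add_nonneg (he0 n) (he0 m)
      · exact Eventually.of_forall hρ0
      · exact hρ T
      · exact ht.2
  have hlim : ∀ t, ∃ x, 0 < t → Tendsto (fun n => vn n t) atTop (𝓝 x) := by
    intro t
    by_cases ht : 0 < t
    · have hc : CauchySeq fun n => vn n t := by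
        set c := 2 * (∫ s in Ioc 0 t, ρ s) * Real.exp (lam * t) with hc
        have hce : Tendsto (fun n => c * e n) atTop (𝓝 0) := by simpa using he.const_mul c
        refine Metric.cauchySeq_iff.2 fun ε hε => ?_
        obtain ⟨n₀, hn₀⟩ := eventually_atTop.1 (hce.eventually_lt_const (half_pos hε))
        refine ⟨n₀, fun n hn m hm => ?_⟩
        rw [dist_eq_norm]
        have h1 := hcau t ht n m
        have e1 : 2 * ((e n + e m) * ∫ s in Ioc 0 t, ρ s) * Real.exp (lam * t)
            = c * e n + c * e m := by rw [hc]; ring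
        linarith [hn₀ n hn, hn₀ m hm]
      obtain ⟨x, hx⟩ := cauchySeq_tendsto_of_complete hc
      exact ⟨x, fun _ => hx⟩
    · exact ⟨0, fun h => absurd h ht⟩
  choose w hw using hlim
  -- Convergence is known for t > 0 only; the value 0 elsewhere keeps v measurable and bounded by M.
  set v : ℝ → E := (Ioi (0 : ℝ)).indicator w with hvdef
  have hvw : ∀ t > 0, v t = w t := fun t ht => indicator_of_mem (show t ∈ Ioi (0 : ℝ) from ht) w
  have hv : ∀ t > 0, Tendsto (fun n => vn n t) atTop (𝓝 (v t)) := fun t ht => by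
    rw [hvw t ht]; exact hw t ht
  have hvmeas : Measurable v := by
    refine measurable_of_tendsto_metrizable
      (f := fun n => (Ioi (0 : ℝ)).indicator (vn n)) (fun n => (hvm n).indicator measurableSet_Ioi)
      (tendsto_pi_nhds.2 fun t => ?_)
    by_cases ht : 0 < t
    · simpa [indicator, ht, hvw t ht] using hw t ht
    · simp [hvdef, indicator, ht]
  have hvbd : ∀ t, ‖v t‖ ≤ M := by
    intro t
    by_cases ht : 0 < t
    · exact le_of_tendsto' (hv t ht).norm fun n => hvM n t
    · simpa [hvdef, indicator, ht] using hM
  refine ⟨v, hvmeas, hvbd, fun t ht => ?_, hv⟩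
  refine tendsto_nhds_unique (hv t ht) ?_
  simp_rw [fun n => heq n t ht]
  refine tendsto_const_nhds.add ?_
  obtain ⟨C, hC⟩ := he.bddAbove_range
  have hC' : ∀ n, e n ≤ C := fun n => hC ⟨n, rfl⟩
  refine tendsto_integral_of_dominated_convergence (fun s => b * M / √(t - s) + C * ρ (t - s))
    (fun n => ?_)
    (integrableOn_reflect ((hsq t).add ((hρ t).const_mul C))) (fun n => ?_) ?_
  · exact (integrableOn_volterra (hBn n) (hsn n t) (hBnρ n) (hvm n) (hvM n)).aestronglyMeasurable
  · filter_upwards [ae_Ioc_sub_pos t] with s hs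
    exact (hBnρ n _ hs _ (hvM n s)).trans
      (add_le_add le_rfl (mul_le_mul_of_nonneg_right (hC' n) (hρ0 _)))
  · filter_upwards [ae_Ioc_sub_pos t, ae_restrict_mem measurableSet_Ioc] with s hs hs0
    rw [tendsto_iff_norm_sub_tendsto_zero]
    have h0 : Tendsto (fun n => e n * ρ (t - s) + b / √(t - s) * ‖vn n s - v s‖) atTop
        (𝓝 (0 * ρ (t - s) + b / √(t - s) * 0)) :=
      (he.mul_const _).add ((tendsto_iff_norm_sub_tendsto_zero.1 (hv s hs0.1)).const_mul _)
    rw [mul_zero, zero_mul, add_zero] at h0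
    refine squeeze_zero (fun j => norm_nonneg _) (fun n => ?_) h0
    have h1 := norm_add_le (Bn n (t - s) (vn n s) - B (t - s) (vn n s))
      (B (t - s) (vn n s) - B (t - s) (v s))
    rw [sub_add_sub_cancel] at h1
    exact h1.trans (add_le_add (happ n _ hs _ (hvM n s)) (hLip _ hs _ _ (hvM n s) (hvbd s)))

end Volterra

end VCHE
end

/-! ### The jump equation: convexity and its Duhamel form. -/

noncomputable section

namespace VCHE

section Jumps

open Filter Topology

/-- With jumps at rate c, the integrand is the density at s of the last jump time before t. The
missing mass e^{-c(t-r)} is the probability of no jump in (r, t]. -/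
lemma setIntegral_exp_weight (c : ℝ) {r t : ℝ} (h : r ≤ t) :
    ∫ s in Ioc r t, c * Real.exp (-(c * (t - s))) = 1 - Real.exp (-(c * (t - r))) := by
  rw [← intervalIntegral.integral_of_le h]
  have hd : ∀ s ∈ uIcc r t, HasDerivAt (fun s => Real.exp (-(c * (t - s))))
      (c * Real.exp (-(c * (t - s)))) s := by
    intro s _
    have h1 : HasDerivAt (fun s => -(c * (t - s))) c s := by
      have := (((hasDerivAt_id s).const_sub t).const_mul c).neg
      simp only [mul_neg, mul_one, neg_neg] at this
      exact this
    exact h1.exp.congr_deriv (by ring)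
  rw [intervalIntegral.integral_eq_sub_of_hasDerivAt hd
    (Continuous.intervalIntegrable (by fun_prop) _ _)]
  simp

lemma setIntegral_exp_weight' (c : ℝ) {r t : ℝ} (h : r ≤ t) :
    ∫ s in Ioc r t, c * Real.exp (-(c * (s - r))) = 1 - Real.exp (-(c * (t - r))) := by
  rw [← intervalIntegral.integral_of_le h]
  have hd : ∀ s ∈ uIcc r t, HasDerivAt (fun s => -Real.exp (-(c * (s - r))))
      (c * Real.exp (-(c * (s - r)))) s := by
    intro s _
    have h1 : HasDerivAt (fun s => -(c * (s - r))) (-c) s := by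
      have := (((hasDerivAt_id s).sub_const r).const_mul c).neg
      simp only [mul_one] at this
      exact this
    exact h1.exp.neg.congr_deriv (by ring)
  rw [intervalIntegral.integral_eq_sub_of_hasDerivAt hd
    (Continuous.intervalIntegrable (by fun_prop) _ _)]
  simp
  ring

variable {E : Type*} [NormedAddCommGroup E] [NormedSpace ℝ E]

lemma integrableOn_continuous_smul {w : ℝ → ℝ} (hw : Continuous w) {γ : ℝ → E} {t : ℝ}
    (hγ : IntegrableOn γ (Ioc 0 t)) : IntegrableOn (fun s => w s • γ s) (Ioc 0 t) := by
  rw [← integrableOn_Icc_iff_integrableOn_Ioc] at hγ ⊢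
  exact hγ.continuousOn_smul hw.continuousOn isCompact_Icc

variable [CompleteSpace E]

/-- Averages with respect to the law of the last jump time remain in closed convex sets. -/
lemma jump_average_mem {W : Set E} (hW : Convex ℝ W) (hWc : IsClosed W) {c t : ℝ} (hc : 0 < c)
    {z : E} (hz : z ∈ W) {γ : ℝ → E} (hγ : IntegrableOn γ (Ioc 0 t))
    (hγW : ∀ᵐ s ∂volume.restrict (Ioc 0 t), γ s ∈ W) (ht : 0 < t) :
    Real.exp (-(c * t)) • z + ∫ s in Ioc 0 t, (c * Real.exp (-(c * (t - s)))) • γ s ∈ W := by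
  set θ := 1 - Real.exp (-(c * t)) with hθ
  have hθ0 : 0 < θ := by
    rw [hθ, sub_pos, Real.exp_lt_one_iff]
    have : 0 < c * t := by positivity
    linarith
  have hexp : 0 < Real.exp (-(c * t)) := Real.exp_pos _
  set w : ℝ → NNReal := fun s => Real.toNNReal (c * Real.exp (-(c * (t - s)))) with hw
  have hwc : ∀ s, ((w s : NNReal) : ℝ) = c * Real.exp (-(c * (t - s))) := fun s =>
    Real.coe_toNNReal _ (by positivity)
  have hwm : Measurable w := by fun_prop
  -- The law of the last jump on (0, t] has mass θ. Its normalised average lies in W, and z is mixed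
  -- in with the remaining weight 1 - θ.
  set ν := (volume.restrict (Ioc 0 t)).withDensity (fun s => (w s : ℝ≥0∞)) with hν
  have hνu : ν univ = ENNReal.ofReal θ := by
    rw [hν, withDensity_apply _ MeasurableSet.univ, Measure.restrict_univ]
    have e : ∀ s, (w s : ℝ≥0∞) = ENNReal.ofReal (c * Real.exp (-(c * (t - s)))) := fun s => rfl
    simp_rw [e]
    rw [← ofReal_integral_eq_lintegral_ofReal, setIntegral_exp_weight c ht.le, sub_zero]
    · exact (Continuous.integrableOn_Icc (by fun_prop)).mono_set Ioc_subset_Icc_self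
    · exact Eventually.of_forall fun s => by positivity
  have : IsFiniteMeasure ν := ⟨by rw [hνu]; exact ENNReal.ofReal_lt_top⟩
  have : NeZero ν := ⟨fun h => by
    rw [h] at hνu
    simp only [Measure.coe_zero, Pi.zero_apply] at hνu
    have := (ENNReal.ofReal_pos.2 hθ0).ne
    exact this hνu⟩
  have hInt : Integrable γ ν := by
    rw [hν, integrable_withDensity_iff_integrable_smul hwm]
    have : (fun s => w s • γ s) = fun s => (c * Real.exp (-(c * (t - s)))) • γ s := by
      ext s; rw [NNReal.smul_def, hwc]
    rw [this]
    exact integrableOn_continuous_smul (by fun_prop) (hγ)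
  have hav := hW.average_mem hWc (μ := ν) ((withDensity_absolutelyContinuous _ _).ae_le hγW) hInt
  have hI : ∫ s, γ s ∂ν = ∫ s in Ioc 0 t, (c * Real.exp (-(c * (t - s)))) • γ s := by
    rw [hν, integral_withDensity_eq_integral_smul hwm]
    simp_rw [NNReal.smul_def, hwc]
  have hav2 : ∫ s in Ioc 0 t, (c * Real.exp (-(c * (t - s)))) • γ s = θ • (⨍ s, γ s ∂ν) := by
    rw [average_eq, hI, measureReal_def, hνu, ENNReal.toReal_ofReal hθ0.le, smul_smul,
      mul_inv_cancel₀ hθ0.ne', one_smul]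
  rw [hav2]
  exact hW hz hav hexp.le hθ0.le (by rw [hθ]; ring)

/-- Fubini on the triangle 0 < r ≤ s ≤ t: for fixed r the weight in s is a probability density
truncated at t. -/
lemma setIntegral_setIntegral_exp {c t : ℝ} {γ : ℝ → E} (hγ : IntegrableOn γ (Ioc 0 t)) :
    ∫ s in Ioc 0 t, ∫ r in Ioc 0 s, (c * Real.exp (-(c * (s - r)))) • γ r
      = ∫ r in Ioc 0 t, (1 - Real.exp (-(c * (t - r)))) • γ r := by
  have e1 : ∀ s ∈ Ioc 0 t, ∫ r in Ioc 0 s, (c * Real.exp (-(c * (s - r)))) • γ r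
      = ∫ r in Ioc 0 t, (Ici r).indicator (fun s => c * Real.exp (-(c * (s - r)))) s • γ r := by
    intro s hs
    rw [← integral_indicator measurableSet_Ioc, ← integral_indicator measurableSet_Ioc]
    refine integral_congr_ae (Eventually.of_forall fun r => ?_)
    by_cases h1 : r ∈ Ioc 0 s
    · have h2 : r ∈ Ioc 0 t := ⟨h1.1, h1.2.trans hs.2⟩
      have h3 : s ∈ Ici r := h1.2
      simp only [indicator_of_mem h1, indicator_of_mem h2, indicator_of_mem h3]
    · by_cases h2 : r ∈ Ioc 0 t
      · have h3 : s ∉ Ici r := fun h => h1 ⟨h2.1, h⟩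
        simp only [indicator_of_notMem h1, indicator_of_mem h2, indicator_of_notMem h3, zero_smul]
      · simp only [indicator_of_notMem h1, indicator_of_notMem h2]
  rw [setIntegral_congr_fun measurableSet_Ioc e1, integral_integral_swap]
  · refine setIntegral_congr_fun measurableSet_Ioc fun r hr => ?_
    rw [integral_smul_const]
    congr 1
    rw [← setIntegral_exp_weight' c hr.2, setIntegral_indicator measurableSet_Ici,
      ← integral_Icc_eq_integral_Ioc]
    congr 2
    ext s
    simp only [mem_inter_iff, mem_Ioc, mem_Ici, mem_Icc]
    constructor
    · rintro ⟨⟨h1, h2⟩, h3⟩; exact ⟨h3, h2⟩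
    · rintro ⟨h1, h2⟩; exact ⟨⟨hr.1.trans_le h1, h2⟩, h1⟩
  · have hk : Measurable fun p : ℝ × ℝ =>
        (Ici p.2).indicator (fun s => c * Real.exp (-(c * (s - p.2)))) p.1 := by
      have : (fun p : ℝ × ℝ => (Ici p.2).indicator (fun s => c * Real.exp (-(c * (s - p.2)))) p.1)
          = {p : ℝ × ℝ | p.2 ≤ p.1}.indicator fun p => c * Real.exp (-(c * (p.1 - p.2))) := by
        ext p; simp [indicator]
      rw [this]
      exact Measurable.indicator (by fun_prop) (measurableSet_le measurable_snd measurable_fst)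
    have hg2 : Integrable (fun p : ℝ × ℝ => γ p.2)
        ((volume.restrict (Ioc 0 t)).prod (volume.restrict (Ioc 0 t))) := hγ.comp_snd _
    refine (hg2.norm.const_mul (|c| * Real.exp (|c| * t))).mono' ?_ ?_
    · exact hk.aestronglyMeasurable.smul hg2.aestronglyMeasurable
    · have hmem : ∀ᵐ p : ℝ × ℝ ∂(volume.restrict (Ioc 0 t)).prod (volume.restrict (Ioc 0 t)),
          p ∈ Ioc 0 t ×ˢ Ioc 0 t := by
        rw [Measure.prod_restrict]
        exact ae_restrict_mem (measurableSet_Ioc.prod measurableSet_Ioc)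
      filter_upwards [hmem] with p hp
      simp only [Function.uncurry_def]
      rw [norm_smul]
      gcongr
      by_cases h : p.2 ≤ p.1
      · rw [indicator_of_mem (show p.1 ∈ Ici p.2 from h), norm_mul, Real.norm_eq_abs,
          Real.norm_of_nonneg (Real.exp_pos _).le]
        gcongr
        have h1 : |c * (p.1 - p.2)| ≤ |c| * t := by
          rw [abs_mul, abs_of_nonneg (sub_nonneg.2 h)]
          gcongr
          linarith [hp.1.2, hp.2.1]
        linarith [neg_abs_le (c * (p.1 - p.2))]
      · rw [indicator_of_notMem (show p.1 ∉ Ici p.2 from h), norm_zero]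
        positivity

/-- A solution of the jump equation solves the Duhamel equation of the bounded perturbation. -/
lemma duhamel_of_jump {c t : ℝ} (ht : 0 < t) {v z : ℝ → E} {g : ℝ → ℝ → E}
    {T : ℝ → E →L[ℝ] E}
    (hv : ∀ s, 0 < s → v s = Real.exp (-(c * s)) • z s
      + ∫ r in Ioc 0 s, (c * Real.exp (-(c * (s - r)))) • g s r)
    (hgi : ∀ s, 0 < s → IntegrableOn (g s) (Ioc 0 s))
    (hz : ∀ s ∈ Ioo 0 t, T s (z s) = z t)
    (hg : ∀ s ∈ Ioo 0 t, ∀ r ∈ Ioo 0 s, T s (g s r) = g t r)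
    (hTv : IntegrableOn (fun s => T s (v s)) (Ioc 0 t)) :
    v t = z t + ∫ s in Ioc 0 t, c • (g t s - T s (v s)) := by
  -- The operator T s carries the free term and the jump terms at time s to those at time t, so only
  -- the exponential weights still depend on s.
  have hTs : ∀ s ∈ Ioo 0 t, T s (v s) = Real.exp (-(c * s)) • z t
      + ∫ r in Ioc 0 s, (c * Real.exp (-(c * (s - r)))) • g t r := by
    intro s hs
    have hi : IntegrableOn (fun r => (c * Real.exp (-(c * (s - r)))) • g s r) (Ioc 0 s) := by
      exact integrableOn_continuous_smul (by fun_prop) (hgi s hs.1)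
    rw [hv s hs.1, map_add, map_smul, hz s hs, ← (T s).integral_comp_comm hi]
    congr 1
    rw [integral_Ioc_eq_integral_Ioo, integral_Ioc_eq_integral_Ioo]
    refine setIntegral_congr_fun measurableSet_Ioo fun r hr => ?_
    rw [map_smul, hg s hs r hr]
  have hwi : IntegrableOn (fun r => (c * Real.exp (-(c * (t - r)))) • g t r) (Ioc 0 t) := by
    exact integrableOn_continuous_smul (by fun_prop) (hgi t ht)
  have hei : IntegrableOn (fun s => Real.exp (-(c * s)) • z t) (Ioc 0 t) :=
    (Continuous.integrableOn_Icc (by fun_prop)).mono_set Ioc_subset_Icc_self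
  have hae : (fun s => T s (v s)) =ᵐ[volume.restrict (Ioc 0 t)] fun s =>
      Real.exp (-(c * s)) • z t + ∫ r in Ioc 0 s, (c * Real.exp (-(c * (s - r)))) • g t r := by
    rw [← restrict_Ioo_eq_restrict_Ioc]
    filter_upwards [ae_restrict_mem measurableSet_Ioo] with s hs
    exact hTs s hs
  have hsi : IntegrableOn (fun s => ∫ r in Ioc 0 s, (c * Real.exp (-(c * (s - r)))) • g t r)
      (Ioc 0 t) := by
    have := (hTv.congr hae).sub hei
    refine this.congr (Eventually.of_forall fun s => ?_)
    simp
  -- Multiplied by c, this equals (1 - e^{-ct}) z t + c∫(1 - e^{-c(t-r)}) g t r dr. Subtracted from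
  -- z t + c∫ g t r dr, it leaves the right side of the jump equation at time t.
  have e1 : ∫ s in Ioc 0 t, T s (v s) = (∫ s in Ioc 0 t, Real.exp (-(c * s))) • z t
      + ∫ r in Ioc 0 t, (1 - Real.exp (-(c * (t - r)))) • g t r := by
    rw [integral_congr_ae hae, integral_add hei hsi, integral_smul_const,
      setIntegral_setIntegral_exp (hgi t ht)]
  have e2 : c * ∫ s in Ioc 0 t, Real.exp (-(c * s)) = 1 - Real.exp (-(c * t)) := by
    have := setIntegral_exp_weight' c ht.le
    simp only [sub_zero] at this
    rw [← integral_const_mul, this]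
  have e3 : ∫ r in Ioc 0 t, (1 - Real.exp (-(c * (t - r)))) • g t r
      = (∫ r in Ioc 0 t, g t r) - ∫ r in Ioc 0 t, Real.exp (-(c * (t - r))) • g t r := by
    have hi2 : IntegrableOn (fun r => Real.exp (-(c * (t - r))) • g t r) (Ioc 0 t) := by
      exact integrableOn_continuous_smul (by fun_prop) (hgi t ht)
    rw [← integral_sub (hgi t ht) hi2]
    simp_rw [sub_smul, one_smul]
  have e4 : ∫ r in Ioc 0 t, (c * Real.exp (-(c * (t - r)))) • g t r
      = c • ∫ r in Ioc 0 t, Real.exp (-(c * (t - r))) • g t r := by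
    rw [← integral_smul]
    simp_rw [smul_smul]
  rw [integral_smul, integral_sub (hgi t ht) hTv, e1, e3, hv t ht, e4, smul_sub, smul_add,
    smul_smul, e2, smul_sub, sub_smul, one_smul]
  abel

end Jumps

end VCHE
end

/-! ### Nash's inequality for a push-forward followed by diffusion. -/

noncomputable section

namespace VCHE

section Nash

/-- The discrete form of the differential inequality in Nash's argument. -/
lemma nash_real {y : ℕ → ℝ} {a b τ : ℝ} (hy : ∀ k, 0 ≤ y k) (ha : 0 ≤ a) (hτ : 0 < τ)
    (h1 : ∀ k, y k ^ 2 ≤ a * y (k + 1)) (h2 : ∀ k, y k ≤ b ^ 2 / (2 ^ k * τ)) :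
    y 0 * (b ^ 2 + a * τ / 8) ≤ a * b ^ 2 := by
  rcases ha.eq_or_lt with rfl | ha
  · have h := h1 0
    have : y 0 = 0 := by nlinarith [hy 0, sq_nonneg (y 0)]
    simp [this]
  by_cases hb : b = 0
  · have h := h2 0
    simp only [hb, ne_eq, OfNat.ofNat_ne_zero, not_false_eq_true, zero_pow, zero_div] at h
    have : y 0 = 0 := le_antisymm h (hy 0)
    simp [this, hb]
  have hb2 : 0 < b ^ 2 := by positivity
  -- The claim in scale-free form is y₀(1 + θ/8) ≤ a.
  set θ := a * τ / b ^ 2 with hθ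
  have hθ0 : 0 < θ := by positivity
  have haθ : a * τ = θ * b ^ 2 := by rw [hθ]; field_simp
  suffices hs : y 0 * (1 + θ / 8) ≤ a by
    have := mul_le_mul_of_nonneg_right hs hb2.le
    nlinarith
  -- Iterating the first hypothesis: (y₀/a)^{2^k} ≤ y_k/a.
  have hpow : ∀ k : ℕ, y 0 ^ 2 ^ k * a ≤ a ^ 2 ^ k * y k := by
    intro k
    induction k with
    | zero => simp [mul_comm]
    | succ k ih =>
      have h3 : (y 0 ^ 2 ^ k * a) ^ 2 ≤ (a ^ 2 ^ k * y k) ^ 2 :=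
        pow_le_pow_left₀ (mul_nonneg (pow_nonneg (hy 0) _) ha.le) ih 2
      have h4 : (a ^ 2 ^ k * y k) ^ 2 ≤ (a ^ 2 ^ k) ^ 2 * (a * y (k + 1)) := by
        rw [mul_pow]
        exact mul_le_mul_of_nonneg_left (h1 k) (by positivity)
      have h5 : (y 0 ^ 2 ^ (k + 1) * a) * a ≤ (a ^ 2 ^ (k + 1) * y (k + 1)) * a := by
        calc _ = (y 0 ^ 2 ^ k * a) ^ 2 := by rw [pow_succ 2 k, pow_mul]; ring
          _ ≤ _ := h3.trans h4
          _ = _ := by rw [pow_succ 2 k, pow_mul]; ring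
      exact le_of_mul_le_mul_right h5 ha
  -- With the second hypothesis this becomes (y₀/a)^{2^k} · 2^k θ ≤ 1.
  have hpow2 : ∀ k : ℕ, y 0 ^ 2 ^ k * (2 ^ k * θ) ≤ a ^ 2 ^ k := by
    intro k
    have h3 := (hpow k).trans (mul_le_mul_of_nonneg_left (h2 k) (by positivity))
    rw [mul_div_assoc', le_div_iff₀ (by positivity)] at h3
    have h4 : y 0 ^ 2 ^ k * (2 ^ k * θ) * b ^ 2 ≤ a ^ 2 ^ k * b ^ 2 := by
      calc _ = y 0 ^ 2 ^ k * a * (2 ^ k * τ) := by linear_combination -y 0 ^ 2 ^ k * 2 ^ k * haθ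
        _ ≤ _ := h3
    exact le_of_mul_le_mul_right h4 hb2
  -- Take the least such k. If k = 0, then θ ≥ 2 and 1 + θ/8 ≤ θ. Otherwise 2^k θ < 4, so (1 +
  -- θ/8)^{2^k} ≤ e^{1/2} ≤ 2 ≤ 2^k θ, and taking a root of order 2^k gives the claim.
  have hex : ∃ k : ℕ, 2 ≤ 2 ^ k * θ := by
    obtain ⟨k, hk⟩ := pow_unbounded_of_one_lt (2 / θ) (one_lt_two (α := ℝ))
    exact ⟨k, by rw [div_lt_iff₀ hθ0] at hk; exact hk.le⟩
  classical
  have hk := Nat.find_spec hex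
  rcases Nat.eq_zero_or_pos (Nat.find hex) with h0 | h0
  · rw [h0] at hk
    have h3 := hpow2 0
    simp only [pow_zero, one_mul, pow_one] at hk h3
    nlinarith [hy 0]
  · obtain ⟨j, hj⟩ := Nat.exists_eq_succ_of_ne_zero h0.ne'
    have hmin : ¬ 2 ≤ 2 ^ j * θ := Nat.find_min hex (by omega)
    push Not at hmin
    have hlt : 2 ^ Nat.find hex * θ < 4 := by
      rw [hj, Nat.succ_eq_add_one, pow_succ]; linarith
    set k := Nat.find hex
    set n : ℕ := 2 ^ k with hn
    have hnR : ((n : ℕ) : ℝ) = 2 ^ k := by rw [hn]; push_cast; rfl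
    have hn0 : n ≠ 0 := by rw [hn]; positivity
    have hθn : (n : ℝ) * (θ / 8) ≤ 1 / 2 := by rw [hnR]; linarith
    have hexp : (1 + θ / 8) ^ n ≤ 2 := by
      calc (1 + θ / 8) ^ n ≤ Real.exp (θ / 8) ^ n := by
            refine pow_le_pow_left₀ (by positivity) ?_ n
            linarith [Real.add_one_le_exp (θ / 8)]
        _ = Real.exp (n * (θ / 8)) := by rw [← Real.exp_nat_mul]
        _ ≤ Real.exp (1 / 2) := Real.exp_le_exp.2 hθn
        _ ≤ 2 := by
            have h3 : Real.exp (1 / 2) * Real.exp (1 / 2) = Real.exp 1 := by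
              rw [← Real.exp_add]; norm_num
            have h4 := Real.exp_one_lt_d9
            nlinarith [Real.exp_pos (1 / 2)]
    have h6 := hpow2 k
    rw [← hn] at h6
    have h7 : (y 0 * (1 + θ / 8)) ^ n ≤ a ^ n := by
      rw [mul_pow]
      have h8 : 0 ≤ y 0 ^ n := pow_nonneg (hy 0) n
      nlinarith
    exact le_of_pow_le_pow_left₀ hn0 ha.le h7

variable {Ω : Type*} [MeasurableSpace Ω]

lemma lintegral_mul_sq_le (μ : Measure Ω) {f g : Ω → ℝ≥0∞} (hf : Measurable f)
    (hg : Measurable g) :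
    (∫⁻ x, f x * g x ∂μ) ^ 2 ≤ (∫⁻ x, f x ^ 2 ∂μ) * ∫⁻ x, g x ^ 2 ∂μ := by
  have h := ENNReal.lintegral_mul_le_Lp_mul_Lq μ Real.HolderConjugate.two_two
    hf.aemeasurable hg.aemeasurable
  have h2 := pow_le_pow_left' h 2
  simp only [Pi.mul_apply, ENNReal.rpow_two] at h2
  refine h2.trans (le_of_eq ?_)
  rw [mul_pow, ← ENNReal.rpow_two, ← ENNReal.rpow_two, ← ENNReal.rpow_mul, ← ENNReal.rpow_mul]
  norm_num

lemma lintegral_mul_weight_sq_le (μ : Measure Ω) {w g : Ω → ℝ≥0∞} (hw : Measurable w)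
    (hg : Measurable g) :
    (∫⁻ x, w x * g x ∂μ) ^ 2 ≤ (∫⁻ x, w x ∂μ) * ∫⁻ x, w x * g x ^ 2 ∂μ := by
  have h := lintegral_mul_sq_le (μ.withDensity w) (f := fun _ => 1) (g := g) measurable_const hg
  simp only [one_mul, one_pow] at h
  rw [lintegral_withDensity_eq_lintegral_mul _ hw hg,
    lintegral_withDensity_eq_lintegral_mul _ hw (hg.pow_const 2),
    lintegral_withDensity_eq_lintegral_mul _ hw measurable_const] at h
  simpa using h

variable {X : Plane → Plane} {κ : ℝ}

/-- The operator of pushing forward under `X` and then applying the heat flow, on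
nonnegative functions. -/
def pushHeat (X : Plane → Plane) (τ : ℝ) (g : Plane → ℝ≥0∞) (x : Plane) : ℝ≥0∞ :=
  ∫⁻ y, ENNReal.ofReal (hk τ (x - X y)) * g y

/-- `X` compresses areas at most by the factor `κ`. -/
structure AreaBound (X : Plane → Plane) (κ : ℝ) : Prop where
  meas : Measurable X
  one_le : 1 ≤ κ
  lintegral_comp_le : ∀ ψ : Plane → ℝ≥0∞, Measurable ψ →
    ∫⁻ y, ψ (X y) ≤ ENNReal.ofReal κ * ∫⁻ y, ψ y

lemma areaBound_id : AreaBound id 1 := ⟨measurable_id, le_rfl, fun ψ _ => by simp⟩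

lemma measurable_pushHeat_kernel (hX : Measurable X) (τ : ℝ) {g : Plane → ℝ≥0∞}
    (hg : Measurable g) :
    Measurable fun p : Plane × Plane => ENNReal.ofReal (hk τ (p.1 - X p.2)) * g p.2 := by
  have : Measurable fun p : Plane × Plane => hk τ (p.1 - X p.2) := by fun_prop
  fun_prop

lemma measurable_pushHeat (hX : Measurable X) (τ : ℝ) {g : Plane → ℝ≥0∞} (hg : Measurable g) :
    Measurable (pushHeat X τ g) :=
  (measurable_pushHeat_kernel hX τ hg).lintegral_prod_right'

lemma lintegral_pushHeat (hX : Measurable X) {τ : ℝ} (hτ : 0 < τ) {g : Plane → ℝ≥0∞}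
    (hg : Measurable g) : ∫⁻ x, pushHeat X τ g x = ∫⁻ y, g y := by
  unfold pushHeat
  rw [lintegral_lintegral_swap (measurable_pushHeat_kernel hX τ hg).aemeasurable]
  refine lintegral_congr fun y => ?_
  rw [lintegral_mul_const _ (by fun_prop), lintegral_hk_sub hτ, one_mul]

lemma pushHeat_le {τ : ℝ} (hτ : 0 < τ) {g : Plane → ℝ≥0∞}
    (hg : Measurable g) (x : Plane) :
    pushHeat X τ g x ≤ ENNReal.ofReal (1 / τ) * ∫⁻ y, g y := by
  unfold pushHeat
  rw [← lintegral_const_mul _ hg]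
  refine lintegral_mono fun y => ?_
  gcongr
  refine (hk_le hτ _).trans ?_
  gcongr
  nlinarith [Real.pi_gt_three]

/-- One factor is bounded by its supremum, the other is integrated with conserved mass. The bound
holds for every measurable X, without control of areas. -/
lemma lintegral_pushHeat_sq_le (hX : Measurable X) {τ : ℝ} (hτ : 0 < τ) {g : Plane → ℝ≥0∞}
    (hg : Measurable g) :
    ∫⁻ x, pushHeat X τ g x ^ 2 ≤ ENNReal.ofReal (1 / τ) * (∫⁻ y, g y) ^ 2 := by
  calc ∫⁻ x, pushHeat X τ g x ^ 2
      ≤ ∫⁻ x, (ENNReal.ofReal (1 / τ) * ∫⁻ y, g y) * pushHeat X τ g x := by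
        refine lintegral_mono fun x => ?_
        rw [sq]
        gcongr
        exact pushHeat_le hτ hg x
    _ = _ := by
        rw [lintegral_const_mul _ (measurable_pushHeat hX τ hg), lintegral_pushHeat hX hτ hg]
        ring

/-- The adjoint of the operator diffuses and then composes with X. Diffusing twice over τ is
diffusing once over 2τ, so P*P is the operator at the doubled time followed by composition with X.
-/
lemma lintegral_pushHeat_sq_eq (hX : Measurable X) {τ : ℝ} (hτ : 0 < τ) {g : Plane → ℝ≥0∞}
    (hg : Measurable g) :
    ∫⁻ x, pushHeat X τ g x ^ 2 = ∫⁻ y, g y * pushHeat X (2 * τ) g (X y) := by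
  have hm := measurable_pushHeat hX τ hg
  have hmk : ∀ x, Measurable fun y => ENNReal.ofReal (hk τ (x - X y)) * g y := by
    intro x
    have : Measurable fun y => hk τ (x - X y) := by fun_prop
    fun_prop
  have h1 : ∀ x, pushHeat X τ g x ^ 2
      = ∫⁻ y, ENNReal.ofReal (hk τ (x - X y)) * g y * pushHeat X τ g x := fun x =>
    (sq _).trans (lintegral_mul_const _ (hmk x)).symm
  simp_rw [h1]
  rw [lintegral_lintegral_swap]
  swap
  · exact ((measurable_pushHeat_kernel hX τ hg).mul (hm.comp measurable_fst)).aemeasurable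
  refine lintegral_congr fun y => ?_
  have h2 : ∀ x, ENNReal.ofReal (hk τ (x - X y)) * g y * pushHeat X τ g x
      = g y * (ENNReal.ofReal (hk τ (X y - x)) * pushHeat X τ g x) := by
    intro x; rw [hk_sub_comm]; ring
  simp_rw [h2]
  rw [lintegral_const_mul _ (by fun_prop)]
  congr 1
  have h3 : ∀ x, ENNReal.ofReal (hk τ (X y - x)) * pushHeat X τ g x
      = ∫⁻ y', ENNReal.ofReal (hk τ (X y - x)) * (ENNReal.ofReal (hk τ (x - X y')) * g y') :=
    fun x =>
    (lintegral_const_mul _ (hmk x)).symm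
  simp_rw [h3]
  rw [lintegral_lintegral_swap]
  swap
  · have : Measurable fun p : Plane × Plane => ENNReal.ofReal (hk τ (X y - p.1)) := by fun_prop
    exact (this.mul (measurable_pushHeat_kernel hX τ hg)).aemeasurable
  refine lintegral_congr fun y' => ?_
  simp_rw [← mul_assoc]
  rw [lintegral_mul_const _ (by fun_prop), lintegral_hk_mul_hk hτ hτ, two_mul]

/-- Cauchy–Schwarz in the preceding identity, after which the area bound removes the composition
with X. This doubling inequality replaces the gradient term of Nash's argument. -/
lemma lintegral_pushHeat_sq_sq_le (hX : AreaBound X κ) {τ : ℝ} (hτ : 0 < τ)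
    {g : Plane → ℝ≥0∞} (hg : Measurable g) :
    (∫⁻ x, pushHeat X τ g x ^ 2) ^ 2
      ≤ ENNReal.ofReal κ * (∫⁻ y, g y ^ 2) * ∫⁻ x, pushHeat X (2 * τ) g x ^ 2 := by
  have hm := measurable_pushHeat hX.meas (2 * τ) hg
  rw [lintegral_pushHeat_sq_eq hX.meas hτ hg]
  refine (lintegral_mul_sq_le _ hg (hm.comp hX.meas)).trans ?_
  have := hX.lintegral_comp_le (fun x => pushHeat X (2 * τ) g x ^ 2) (hm.pow_const 2)
  calc _ ≤ (∫⁻ y, g y ^ 2) * (ENNReal.ofReal κ * ∫⁻ x, pushHeat X (2 * τ) g x ^ 2) := by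
        gcongr
        exact this
    _ = _ := by ring

/-- Nash's smoothing estimate. -/
lemma lintegral_pushHeat_sq_nash (hX : AreaBound X κ) {τ a b : ℝ} (hτ : 0 < τ) (ha : 0 ≤ a)
    (hb : 0 ≤ b) {g : Plane → ℝ≥0∞} (hg : Measurable g)
    (hga : ENNReal.ofReal κ * ∫⁻ y, g y ^ 2 ≤ ENNReal.ofReal a)
    (hgb : ∫⁻ y, g y ≤ ENNReal.ofReal b) :
    (∫⁻ x, pushHeat X τ g x ^ 2).toReal * (b ^ 2 + a * τ / 8) ≤ a * b ^ 2 := by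
  have hbd : ∀ τ > 0, ∫⁻ x, pushHeat X τ g x ^ 2 ≤ ENNReal.ofReal (b ^ 2 / τ) := by
    intro τ hτ
    refine (lintegral_pushHeat_sq_le hX.meas hτ hg).trans ?_
    calc _ ≤ ENNReal.ofReal (1 / τ) * ENNReal.ofReal b ^ 2 := by gcongr
      _ = _ := by
        rw [← ENNReal.ofReal_pow hb, ← ENNReal.ofReal_mul (by positivity)]
        congr 1; ring
  have h := nash_real (y := fun k => (∫⁻ x, pushHeat X (2 ^ k * τ) g x ^ 2).toReal) (a := a)
    (b := b) (τ := τ) (fun k => ENNReal.toReal_nonneg) ha hτ (fun k => ?_) (fun k => ?_)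
  · simpa using h
  · have hk : (0 : ℝ) < 2 ^ k * τ := by positivity
    have h1 := (lintegral_pushHeat_sq_sq_le hX hk hg).trans (mul_le_mul_left hga _)
    rw [← ENNReal.toReal_pow, ← ENNReal.toReal_ofReal ha,
      show (2 : ℝ) ^ (k + 1) * τ = 2 * (2 ^ k * τ) by ring, ← ENNReal.toReal_mul]
    refine ENNReal.toReal_mono ?_ h1
    exact ENNReal.mul_ne_top ENNReal.ofReal_ne_top
      (((hbd _ (by positivity)).trans_lt ENNReal.ofReal_lt_top).ne)
  · refine ENNReal.toReal_le_of_le_ofReal (by positivity) (hbd _ (by positivity))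

/-- Jensen's inequality for powers of two. -/
lemma pushHeat_pow_le (hX : AreaBound X κ) {τ : ℝ} (hτ : 0 < τ) {g : Plane → ℝ≥0∞}
    (hg : Measurable g) (k : ℕ) (x : Plane) :
    ENNReal.ofReal κ * pushHeat X τ g x ^ 2 ^ k
      ≤ ENNReal.ofReal κ ^ 2 ^ k * pushHeat X τ (fun y => g y ^ 2 ^ k) x := by
  have hm : Measurable fun y => hk τ (x - X y) := by have := hX.meas; fun_prop
  induction k with
  | zero => simp
  | succ k ih =>
    have hκ0 : ENNReal.ofReal κ ≠ 0 := by
      have := hX.one_le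
      simpa using (by linarith : 0 < κ)
    -- For fixed x the weight in y has mass at most κ rather than 1, so each squaring by
    -- Cauchy–Schwarz costs a factor κ.
    have h1 : ∫⁻ y, ENNReal.ofReal (hk τ (x - X y)) ≤ ENNReal.ofReal κ := by
      refine (hX.lintegral_comp_le (fun z => ENNReal.ofReal (hk τ (x - z))) (by fun_prop)).trans ?_
      rw [lintegral_hk_sub_left hτ, mul_one]
    have h2 := lintegral_mul_weight_sq_le volume
      (w := fun y => ENNReal.ofReal (hk τ (x - X y))) (g := fun y => g y ^ 2 ^ k)
      (by fun_prop) (hg.pow_const _)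
    have h3 : pushHeat X τ (fun y => g y ^ 2 ^ k) x ^ 2
        ≤ ENNReal.ofReal κ * pushHeat X τ (fun y => g y ^ 2 ^ (k + 1)) x := by
      refine h2.trans ?_
      simp_rw [← pow_mul, ← pow_succ]
      gcongr
      exact le_rfl
    have h4 := pow_le_pow_left' ih 2
    have h5 : ENNReal.ofReal κ * (ENNReal.ofReal κ * pushHeat X τ g x ^ 2 ^ (k + 1))
        ≤ ENNReal.ofReal κ *
          (ENNReal.ofReal κ ^ 2 ^ (k + 1) * pushHeat X τ (fun y => g y ^ 2 ^ (k + 1)) x) := by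
      calc _ = (ENNReal.ofReal κ * pushHeat X τ g x ^ 2 ^ k) ^ 2 := by
            rw [pow_succ 2 k, pow_mul]; ring
        _ ≤ _ := h4
        _ = (ENNReal.ofReal κ ^ 2 ^ k) ^ 2 * pushHeat X τ (fun y => g y ^ 2 ^ k) x ^ 2 := by
            rw [mul_pow]
        _ ≤ (ENNReal.ofReal κ ^ 2 ^ k) ^ 2 *
            (ENNReal.ofReal κ * pushHeat X τ (fun y => g y ^ 2 ^ (k + 1)) x) := by gcongr
        _ = _ := by rw [pow_succ 2 k, pow_mul]; ring
    exact (ENNReal.mul_le_mul_iff_right hκ0 ENNReal.ofReal_ne_top).1 h5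

/-- The kernel of pushing forward under `X` and then applying the heat flow. -/
def pushKer (X : Plane → Plane) (τ : ℝ) (x y : Plane) : ℝ := hk τ (x - X y)

lemma isKer_pushKer (hX : Measurable X) (τ : ℝ) : IsKer (pushKer X τ) 1 := by
  refine ⟨?_, zero_le_one, fun y => ?_⟩
  · unfold pushKer Function.uncurry; fun_prop
  · simp only [pushKer, ENNReal.ofReal_one]
    simp_rw [Real.enorm_eq_ofReal (hk_nonneg _ _)]
    exact lintegral_hk_sub_le τ (X y)

/-- The `2^k`-th power of the `L^{2^k}` norm. -/
def powInt (k : ℕ) (f : L1) : ℝ≥0∞ := ∫⁻ x, ‖f x‖ₑ ^ 2 ^ k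

/-- The normalisation by κ⁻¹ absorbs the constants of Jensen's inequality: with q = κ⁻¹|S(τ)X_# f|
one has κ q^{2^k} ≤ P_τ(|f|^{2^k}), and this is squared and integrated. -/
lemma powInt_succ_smul_kerOp_le (hX : AreaBound X κ) {τ : ℝ} (hτ : 0 < τ) (f : L1) (k : ℕ) :
    ENNReal.ofReal κ ^ 2 * powInt (k + 1) (κ⁻¹ • kerOp (pushKer X τ) f)
      ≤ ∫⁻ x, pushHeat X τ (fun y => ‖f y‖ₑ ^ 2 ^ k) x ^ 2 := by
  have hκ : 0 < κ := by linarith [hX.one_le]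
  have hκ0 : ENNReal.ofReal κ ≠ 0 := by simpa using hκ
  have hf : Measurable fun y => ‖f y‖ₑ := (Lp.stronglyMeasurable f).measurable.enorm
  rw [powInt, ← lintegral_const_mul]
  swap
  · exact ((Lp.stronglyMeasurable _).measurable.enorm.pow_const _)
  refine lintegral_mono_ae ?_
  filter_upwards [(isKer_pushKer hX.meas τ).coeFn f, Lp.coeFn_smul κ⁻¹ (kerOp (pushKer X τ) f)]
    with x h1 h2
  have h3 : ‖kerOp (pushKer X τ) f x‖ₑ ≤ pushHeat X τ (fun y => ‖f y‖ₑ) x := by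
    rw [h1]
    refine (enorm_integral_le_lintegral_enorm _).trans (le_of_eq ?_)
    refine lintegral_congr fun y => ?_
    rw [enorm_mul, pushKer, Real.enorm_eq_ofReal (hk_nonneg _ _)]
  have h4 : ENNReal.ofReal κ * ‖(κ⁻¹ • kerOp (pushKer X τ) f) x‖ₑ
      = ‖kerOp (pushKer X τ) f x‖ₑ := by
    rw [h2, Pi.smul_apply, smul_eq_mul, enorm_mul, Real.enorm_eq_ofReal (inv_nonneg.2 hκ.le),
      ← mul_assoc, ← ENNReal.ofReal_mul hκ.le, mul_inv_cancel₀ hκ.ne', ENNReal.ofReal_one, one_mul]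
  set q := ‖(κ⁻¹ • kerOp (pushKer X τ) f) x‖ₑ
  have h5 : ENNReal.ofReal κ ^ 2 ^ k * (ENNReal.ofReal κ * q ^ 2 ^ k)
      ≤ ENNReal.ofReal κ ^ 2 ^ k * pushHeat X τ (fun y => ‖f y‖ₑ ^ 2 ^ k) x := by
    calc _ = ENNReal.ofReal κ * (ENNReal.ofReal κ * q) ^ 2 ^ k := by rw [mul_pow]; ring
      _ ≤ ENNReal.ofReal κ * pushHeat X τ (fun y => ‖f y‖ₑ) x ^ 2 ^ k := by
          rw [h4]; gcongr
      _ ≤ _ := pushHeat_pow_le hX hτ hf k x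
  have h6 := (ENNReal.mul_le_mul_iff_right (pow_ne_zero _ hκ0)
    (ENNReal.pow_ne_top ENNReal.ofReal_ne_top)).1 h5
  have h7 := pow_le_pow_left' h6 2
  refine le_trans (le_of_eq ?_) h7
  rw [mul_pow, ← pow_mul, ← pow_succ]

lemma powInt_succ_le (hX : AreaBound X κ) {τ : ℝ} (hτ : 0 < τ) (f : L1) (k : ℕ) :
    powInt (k + 1) (κ⁻¹ • kerOp (pushKer X τ) f)
      ≤ ENNReal.ofReal ((κ ^ 2)⁻¹) * ∫⁻ x, pushHeat X τ (fun y => ‖f y‖ₑ ^ 2 ^ k) x ^ 2 := by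
  have hκ : 0 < κ := by linarith [hX.one_le]
  have h := mul_le_mul_right (powInt_succ_smul_kerOp_le hX hτ f k) (ENNReal.ofReal ((κ ^ 2)⁻¹))
  rwa [← mul_assoc, ← ENNReal.ofReal_pow hκ.le, ← ENNReal.ofReal_mul (by positivity),
    inv_mul_cancel₀ (by positivity), ENNReal.ofReal_one, one_mul] at h

/-- `L^{2^k} → L^{2^{k+1}}` smoothing. -/
lemma powInt_succ_le_of_powInt (hX : AreaBound X κ) {τ N : ℝ} (hτ : 0 < τ) (hN : 0 ≤ N) {f : L1}
    {k : ℕ} (h : powInt k f ≤ ENNReal.ofReal N) :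
    powInt (k + 1) (κ⁻¹ • kerOp (pushKer X τ) f) ≤ ENNReal.ofReal (8 * N ^ 2 / τ) := by
  have hκ := hX.one_le
  have hf : Measurable fun y => ‖f y‖ₑ := (Lp.stronglyMeasurable f).measurable.enorm
  refine (powInt_succ_le hX hτ f k).trans ?_
  calc _ ≤ 1 * (ENNReal.ofReal (1 / τ) * ENNReal.ofReal N ^ 2) := by
        gcongr
        · rw [ENNReal.ofReal_le_one]
          exact inv_le_one_of_one_le₀ (one_le_pow₀ hκ)
        · refine (lintegral_pushHeat_sq_le hX.meas hτ (hf.pow_const _)).trans ?_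
          gcongr
          exact h
    _ = ENNReal.ofReal (N ^ 2 / τ) := by
        rw [one_mul, ← ENNReal.ofReal_pow hN, ← ENNReal.ofReal_mul (by positivity)]
        congr 1; ring
    -- The factor 8 is wasted here; it is the constant for which Nash's inequality propagates the
    -- bound.
    _ ≤ _ := by
        refine ENNReal.ofReal_le_ofReal ?_
        gcongr
        nlinarith [sq_nonneg N]

/-- Nash's estimate for the evolution of the `L^{2^{k+1}}` norm under a bounded
`L^{2^k}` norm. -/
lemma powInt_succ_le_of_powInt_succ (hX : AreaBound X κ) {τ σ N : ℝ} (hτ : 0 < τ) (hσ : 0 < σ)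
    (hN : 0 < N) {f : L1} {k : ℕ} (h : powInt k f ≤ ENNReal.ofReal N)
    (h' : powInt (k + 1) f ≤ ENNReal.ofReal (8 * N ^ 2 / σ)) :
    powInt (k + 1) (κ⁻¹ • kerOp (pushKer X τ) f) ≤ ENNReal.ofReal (8 * N ^ 2 / (σ + τ)) := by
  have hκ := hX.one_le
  have hκ0 : 0 < κ := by linarith
  have hf : Measurable fun y => ‖f y‖ₑ := (Lp.stronglyMeasurable f).measurable.enorm
  refine (powInt_succ_le hX hτ f k).trans ?_
  have h1 := lintegral_pushHeat_sq_nash hX hτ (a := κ * (8 * N ^ 2 / σ)) (b := N)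
    (by positivity) hN.le (g := fun y => ‖f y‖ₑ ^ 2 ^ k) (hf.pow_const _) (by
      rw [ENNReal.ofReal_mul hκ0.le]
      gcongr
      simpa only [powInt, pow_succ, pow_mul] using h') h
  have hfin : ∫⁻ x, pushHeat X τ (fun y => ‖f y‖ₑ ^ 2 ^ k) x ^ 2 ≠ ⊤ := by
    refine ((lintegral_pushHeat_sq_le hX.meas hτ (hf.pow_const _)).trans_lt ?_).ne
    exact ENNReal.mul_lt_top ENNReal.ofReal_lt_top
      (ENNReal.pow_lt_top (h.trans_lt ENNReal.ofReal_lt_top))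
  set Y := ∫⁻ x, pushHeat X τ (fun y => ‖f y‖ₑ ^ 2 ^ k) x ^ 2
  rw [← ENNReal.ofReal_toReal hfin, ← ENNReal.ofReal_mul (by positivity)]
  refine ENNReal.ofReal_le_ofReal ?_
  -- Nash's inequality with a = 8κN²/σ and b = N. Then κ⁻²Y ≤ 8N²/(κ(σ + κτ)) ≤ 8N²/(σ + τ), since κ
  -- ≥ 1: the normalisation outweighs the compression.
  have h2 : Y.toReal * (σ + κ * τ) ≤ κ * (8 * N ^ 2) := by
    have e : Y.toReal * (N ^ 2 + κ * (8 * N ^ 2 / σ) * τ / 8)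
        = Y.toReal * (σ + κ * τ) * (N ^ 2 / σ) := by field_simp
    have e2 : κ * (8 * N ^ 2 / σ) * N ^ 2 = κ * (8 * N ^ 2) * (N ^ 2 / σ) := by field_simp
    rw [e, e2] at h1
    exact le_of_mul_le_mul_right h1 (by positivity)
  rw [inv_mul_le_iff₀ (by positivity), mul_div_assoc', le_div_iff₀ (by positivity)]
  have h3 : 0 ≤ Y.toReal := ENNReal.toReal_nonneg
  have h4 : Y.toReal * (σ + τ) ≤ Y.toReal * (σ + κ * τ) := by
    gcongr
    nlinarith
  nlinarith [sq_nonneg N, mul_nonneg (sub_nonneg.2 hκ) (mul_nonneg hκ0.le (sq_nonneg N))]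

end Nash

end VCHE
end

/-! ### Heat, drift and jump operators on L¹; consistency of the jumps. -/

noncomputable section

namespace VCHE

section Operators

open Filter Topology

lemma IsKer.map_add {k : Plane → Plane → ℝ} {A : ℝ} (hk : IsKer k A) (f g : L1) :
    kerOp k (f + g) = kerOp k f + kerOp k g := by
  have h := hk.map_sub (f + g) g
  rw [add_sub_cancel_right] at h
  rw [h, sub_add_cancel]

lemma IsKer.map_smul {k : Plane → Plane → ℝ} {A : ℝ} (hk : IsKer k A) (c : ℝ) (f : L1) :
    kerOp k (c • f) = c • kerOp k f := by
  refine Lp.ext ?_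
  filter_upwards [hk.coeFn f, hk.coeFn (c • f), Lp.coeFn_smul c (kerOp k f)] with x h1 h2 h3
  rw [h2, h3, Pi.smul_apply, h1, smul_eq_mul, ← integral_const_mul]
  refine integral_congr_ae ?_
  filter_upwards [Lp.coeFn_smul c f] with y hy
  rw [hy, Pi.smul_apply, smul_eq_mul]
  ring

/-- The heat semigroup on `L¹` (zero at nonpositive times). -/
def heatCLM (t : ℝ) : L1 →L[ℝ] L1 :=
  LinearMap.mkContinuous
    { toFun := kerOp (pushKer id t)
      map_add' := (isKer_pushKer measurable_id t).map_add
      map_smul' := (isKer_pushKer measurable_id t).map_smul }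
    1 (isKer_pushKer measurable_id t).norm_le

lemma heatCLM_apply (t : ℝ) (f : L1) : heatCLM t f = kerOp (pushKer id t) f := rfl

lemma norm_heatCLM_le (t : ℝ) (f : L1) : ‖heatCLM t f‖ ≤ ‖f‖ := by
  have h := (isKer_pushKer measurable_id t).norm_le f
  rwa [one_mul] at h

lemma heatCLM_kerOp_pushKer {X : Plane → Plane} (hX : Measurable X) {σ τ : ℝ} (hσ : 0 < σ)
    (hτ : 0 < τ) (f : L1) :
    heatCLM σ (kerOp (pushKer X τ) f) = kerOp (pushKer X (σ + τ)) f :=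
  kerOp_kerOp (isKer_pushKer measurable_id σ) (isKer_pushKer hX τ) (isKer_pushKer hX (σ + τ))
    (fun x y => integral_hk_mul_hk hσ hτ x (X y)) f

lemma heatCLM_heatCLM {σ τ : ℝ} (hσ : 0 < σ) (hτ : 0 < τ) (f : L1) :
    heatCLM σ (heatCLM τ f) = heatCLM (σ + τ) f :=
  heatCLM_kerOp_pushKer measurable_id hσ hτ f

lemma measurable_kerOp {Ω : Type*} [MeasurableSpace Ω] {k : Ω → Plane → Plane → ℝ} {A : Ω → ℝ}
    (hm : Measurable fun q : (Ω × Plane) × Plane => k q.1.1 q.1.2 q.2)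
    (hk : ∀ ω, IsKer (k ω) (A ω)) (f : L1) : Measurable fun ω => kerOp (k ω) f := by
  refine measurable_L1_of_uncurry (φ := fun ω x => ∫ y, k ω x y * f y) ?_
    fun ω => (hk ω).coeFn f
  have h : StronglyMeasurable fun q : (Ω × Plane) × Plane => k q.1.1 q.1.2 q.2 * f q.2 :=
    hm.stronglyMeasurable.mul ((Lp.stronglyMeasurable f).comp_measurable measurable_snd)
  exact h.integral_prod_right'

lemma measurable_heatCLM (f : L1) : Measurable fun t => heatCLM t f := by
  refine measurable_kerOp (k := fun t => pushKer id t) (A := fun _ => 1) ?_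
    (fun t => isKer_pushKer measurable_id t) f
  unfold pushKer
  simp only [id]
  fun_prop

lemma continuous_of_lipschitz_on_balls {E : Type*} [NormedAddCommGroup E] {F : L1 → E}
    (h : ∀ M, 0 ≤ M → ∃ C, ∀ f g, ‖f‖ ≤ M → ‖g‖ ≤ M → ‖F f - F g‖ ≤ C * ‖f - g‖) :
    Continuous F := by
  refine continuous_iff_continuousAt.2 fun g => ?_
  obtain ⟨C, hC⟩ := h (‖g‖ + 1) (by positivity)
  rw [ContinuousAt, tendsto_iff_norm_sub_tendsto_zero]
  have h1 : Tendsto (fun f : L1 => C * ‖f - g‖) (𝓝 g) (𝓝 0) := by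
    have : Continuous fun f : L1 => C * ‖f - g‖ := by fun_prop
    simpa using this.tendsto g
  refine squeeze_zero' (Eventually.of_forall fun f => norm_nonneg _) ?_ h1
  filter_upwards [Metric.ball_mem_nhds g one_pos] with f hf
  refine hC f g ?_ (by linarith)
  rw [mem_ball_iff_norm] at hf
  have := norm_add_le (f - g) g
  rw [sub_add_cancel] at this
  linarith

/-- A Carathéodory function, continuous in f and measurable in τ, is jointly measurable because L¹
is separable. -/
lemma measurable_uncurry_of_continuous_L1 {N : ℝ → L1 → L1} (hc : ∀ τ, Continuous (N τ))
    (hm : ∀ f, Measurable fun τ => N τ f) : Measurable (Function.uncurry N) := by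
  have h := measurable_uncurry_of_continuous_of_measurable (u := fun (f : L1) (τ : ℝ) => N τ f)
    hc hm
  exact h.comp measurable_swap

/-- A bounded linear assignment of a velocity field to a vorticity. -/
structure IsDrift (u : L1 → Plane → Plane) (U : ℝ) : Prop where
  meas : ∀ f, Measurable (u f)
  nonneg : 0 ≤ U
  map_sub : ∀ f g x, u (f - g) x = u f x - u g x
  norm_le : ∀ f x, ‖u f x‖ ≤ U * ‖f‖

/-- The kernel of `f ↦ -∇Φ(τ) ∗ (f u)`. -/
def driftKer (u : Plane → Plane) (τ : ℝ) (x y : Plane) : ℝ := -inner ℝ (hkGrad τ (x - y)) (u y)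

/-- The nonlinearity `-∇Φ(τ) ∗ (f u_f)`. -/
def driftOp (u : L1 → Plane → Plane) (τ : ℝ) (f : L1) : L1 := kerOp (driftKer (u f) τ) f

lemma lintegral_inner_hkGrad_le {τ : ℝ} {w y : Plane} {V : ℝ} (hw : ‖w‖ ≤ V) :
    ∫⁻ x, ‖inner ℝ (hkGrad τ (x - y)) w‖ₑ ≤ ENNReal.ofReal (2 / √τ * V) := by
  have hV : 0 ≤ V := (norm_nonneg _).trans hw
  by_cases hτ : 0 < τ
  · calc ∫⁻ x, ‖inner ℝ (hkGrad τ (x - y)) w‖ₑ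
        ≤ ∫⁻ x, ‖hkGrad τ (x - y)‖ₑ * ENNReal.ofReal V := by
          refine lintegral_mono fun x => ?_
          rw [← ofReal_norm, ← ofReal_norm, ← ENNReal.ofReal_mul (norm_nonneg _)]
          refine ENNReal.ofReal_le_ofReal ((norm_inner_le_norm _ _).trans ?_)
          gcongr
      _ = (∫⁻ x, ‖hkGrad τ (x - y)‖ₑ) * ENNReal.ofReal V :=
          lintegral_mul_const _ (by fun_prop)
      _ ≤ ENNReal.ofReal (2 / √τ) * ENNReal.ofReal V := by
          gcongr; exact lintegral_hkGrad_sub_le hτ y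
      _ = _ := by rw [← ENNReal.ofReal_mul (by positivity)]
  · simp [hkGrad_of_nonpos (not_lt.1 hτ)]

lemma isKer_driftKer {u : Plane → Plane} (hu : Measurable u) {V : ℝ} (hV : ∀ y, ‖u y‖ ≤ V)
    (τ : ℝ) : IsKer (driftKer u τ) (2 / √τ * V) := by
  have hV0 : 0 ≤ V := (norm_nonneg _).trans (hV 0)
  refine ⟨?_, by positivity, fun y => ?_⟩
  · unfold driftKer Function.uncurry
    fun_prop
  · simp only [driftKer, enorm_neg]
    exact lintegral_inner_hkGrad_le (hV y)

lemma norm_kerOp_driftKer_sub_le {u w : Plane → Plane} (hu : Measurable u) (hw : Measurable w)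
    {V V' η : ℝ} (hV : ∀ y, ‖u y‖ ≤ V) (hV' : ∀ y, ‖w y‖ ≤ V') (hη : ∀ y, ‖u y - w y‖ ≤ η)
    (τ : ℝ) (f : L1) :
    ‖kerOp (driftKer u τ) f - kerOp (driftKer w τ) f‖ ≤ 2 / √τ * η * ‖f‖ := by
  have hη0 : 0 ≤ η := (norm_nonneg _).trans (hη 0)
  refine (isKer_driftKer hu hV τ).norm_sub_le (isKer_driftKer hw hV' τ) (by positivity)
    (fun y => ?_) f
  have e : ∀ x, driftKer u τ x y - driftKer w τ x y
      = -inner ℝ (hkGrad τ (x - y)) (u y - w y) := by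
    intro x; rw [driftKer, driftKer, inner_sub_right]; ring
  simp_rw [e, enorm_neg]
  exact lintegral_inner_hkGrad_le (hη y)

lemma driftOp_zero {u : L1 → Plane → Plane} {U : ℝ} (hu : IsDrift u U) (τ : ℝ) :
    driftOp u τ 0 = 0 :=
  (isKer_driftKer (hu.meas 0) (hu.norm_le 0) τ).map_zero

/-- The operator is quadratic in f: the difference is the drift u_f acting on f - g plus the drift
u_{f-g} acting on g, each bounded by (2UM/√τ)‖f - g‖. -/
lemma norm_driftOp_sub_le {u : L1 → Plane → Plane} {U : ℝ} (hu : IsDrift u U) {M : ℝ} (τ : ℝ)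
    {f g : L1} (hf : ‖f‖ ≤ M) (hg : ‖g‖ ≤ M) :
    ‖driftOp u τ f - driftOp u τ g‖ ≤ 4 * U * M / √τ * ‖f - g‖ := by
  have hU := hu.nonneg
  have e : driftOp u τ f - driftOp u τ g = kerOp (driftKer (u f) τ) (f - g)
      + (kerOp (driftKer (u f) τ) g - kerOp (driftKer (u g) τ) g) := by
    rw [(isKer_driftKer (hu.meas f) (hu.norm_le f) τ).map_sub]
    simp only [driftOp]
    abel
  have h1 := (isKer_driftKer (hu.meas f) (hu.norm_le f) τ).norm_le (f - g)
  have h2 := norm_kerOp_driftKer_sub_le (hu.meas f) (hu.meas g) (hu.norm_le f) (hu.norm_le g)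
    (η := U * ‖f - g‖) (fun y => by rw [← hu.map_sub]; exact hu.norm_le _ _) τ g
  rw [e]
  refine (norm_add_le _ _).trans ((add_le_add h1 h2).trans ?_)
  calc 2 / √τ * (U * ‖f‖) * ‖f - g‖ + 2 / √τ * (U * ‖f - g‖) * ‖g‖
      ≤ 2 / √τ * (U * M) * ‖f - g‖ + 2 / √τ * (U * ‖f - g‖) * M := by gcongr
    _ = _ := by ring

lemma measurable_driftOp {u : L1 → Plane → Plane} {U : ℝ} (hu : IsDrift u U) :
    Measurable (Function.uncurry (driftOp u)) := by
  refine measurable_uncurry_of_continuous_L1 (fun τ => ?_) fun f => ?_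
  · exact continuous_of_lipschitz_on_balls fun M _ => ⟨4 * U * M / √τ, fun f g hf hg =>
      norm_driftOp_sub_le hu τ hf hg⟩
  · refine measurable_kerOp (A := fun τ => 2 / √τ * (U * ‖f‖)) ?_
      (fun τ => isKer_driftKer (hu.meas f) (hu.norm_le f) τ) f
    unfold driftKer
    have := hu.meas f
    fun_prop

/-- The jump map `y ↦ y + h u(y)`. -/
def jumpMap (h : ℝ) (u : Plane → Plane) (y : Plane) : Plane := y + h • u y

lemma measurable_jumpMap (h : ℝ) {u : Plane → Plane} (hu : Measurable u) :
    Measurable (jumpMap h u) := by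
  unfold jumpMap; fun_prop

/-- Transport by the jump map, normalized by `κ`, followed by the heat flow. -/
def jumpOp (h κ : ℝ) (u : L1 → Plane → Plane) (τ : ℝ) (f : L1) : L1 :=
  κ⁻¹ • kerOp (pushKer (jumpMap h (u f)) τ) f

lemma jumpOp_zero {u : L1 → Plane → Plane} {U : ℝ} (hu : IsDrift u U) (h κ τ : ℝ) :
    jumpOp h κ u τ 0 = 0 := by
  rw [jumpOp, (isKer_pushKer (measurable_jumpMap h (hu.meas 0)) τ).map_zero, smul_zero]

lemma norm_jumpOp_le {u : L1 → Plane → Plane} {U : ℝ} (hu : IsDrift u U) (h : ℝ) {κ : ℝ}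
    (hκ : 1 ≤ κ) (τ : ℝ) (f : L1) : ‖jumpOp h κ u τ f‖ ≤ ‖f‖ := by
  have h1 := (isKer_pushKer (measurable_jumpMap h (hu.meas f)) τ).norm_le f
  rw [jumpOp, norm_smul, Real.norm_of_nonneg (by positivity)]
  have h2 : κ⁻¹ ≤ 1 := inv_le_one_of_one_le₀ hκ
  have h3 : 0 ≤ κ⁻¹ := by positivity
  nlinarith [norm_nonneg f, norm_nonneg (kerOp (pushKer (jumpMap h (u f)) τ) f)]

lemma heatCLM_jumpOp {u : L1 → Plane → Plane} {U : ℝ} (hu : IsDrift u U) (h κ : ℝ) {σ τ : ℝ}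
    (hσ : 0 < σ) (hτ : 0 < τ) (f : L1) :
    heatCLM σ (jumpOp h κ u τ f) = jumpOp h κ u (σ + τ) f := by
  rw [jumpOp, _root_.map_smul,
    heatCLM_kerOp_pushKer (measurable_jumpMap h (hu.meas f)) hσ hτ, jumpOp]

/-- Moving different masses by the same map is a contraction. Moving the same mass by different maps
is controlled by the L¹ modulus of the heat kernel, with displacement h u_{f-g}. -/
lemma norm_jumpOp_sub_le {u : L1 → Plane → Plane} {U : ℝ} (hu : IsDrift u U) {h κ M : ℝ}
    (hh : 0 ≤ h) (hκ : 1 ≤ κ) {τ : ℝ} (hτ : 0 < τ) {f g : L1} (hg : ‖g‖ ≤ M) :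
    ‖jumpOp h κ u τ f - jumpOp h κ u τ g‖ ≤ (1 + 2 * h * U * M / √τ) * ‖f - g‖ := by
  have hU := hu.nonneg
  have hf' := isKer_pushKer (measurable_jumpMap h (hu.meas f)) τ
  have hg' := isKer_pushKer (measurable_jumpMap h (hu.meas g)) τ
  have e : jumpOp h κ u τ f - jumpOp h κ u τ g
      = κ⁻¹ • (kerOp (pushKer (jumpMap h (u f)) τ) (f - g)
        + (kerOp (pushKer (jumpMap h (u f)) τ) g - kerOp (pushKer (jumpMap h (u g)) τ) g)) := by
    rw [hf'.map_sub]
    simp only [jumpOp, ← smul_sub]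
    congr 1
    abel
  have h1 := hf'.norm_le (f - g)
  have h2 := hf'.norm_sub_le hg' (B := 2 / √τ * (h * (U * ‖f - g‖))) (by positivity)
    (fun y => by
      refine (lintegral_hk_sub_sub_hk_sub hτ _ _).trans (ENNReal.ofReal_le_ofReal ?_)
      have e2 : jumpMap h (u f) y - jumpMap h (u g) y = h • u (f - g) y := by
        rw [hu.map_sub, jumpMap, jumpMap, smul_sub]; abel
      rw [e2, norm_smul, Real.norm_of_nonneg hh]
      gcongr
      exact hu.norm_le _ _) g
  rw [e, norm_smul, Real.norm_of_nonneg (by positivity)]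
  have h3 : κ⁻¹ ≤ 1 := inv_le_one_of_one_le₀ hκ
  refine (mul_le_of_le_one_left (norm_nonneg _) h3).trans ?_
  refine (norm_add_le _ _).trans ((add_le_add h1 h2).trans ?_)
  calc 1 * ‖f - g‖ + 2 / √τ * (h * (U * ‖f - g‖)) * ‖g‖
      ≤ 1 * ‖f - g‖ + 2 / √τ * (h * (U * ‖f - g‖)) * M := by gcongr
    _ = _ := by ring

lemma jumpOp_of_nonpos {u : L1 → Plane → Plane} {U : ℝ} (hu : IsDrift u U) (h κ : ℝ)
    {τ : ℝ} (hτ : τ ≤ 0) (f : L1) : jumpOp h κ u τ f = 0 := by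
  have hK := isKer_pushKer (measurable_jumpMap h (hu.meas f)) τ
  have h0 : IsKer (pushKer (jumpMap h (u f)) τ) 0 := by
    refine ⟨hK.meas, le_rfl, fun y => ?_⟩
    simp [pushKer, hk_of_nonpos hτ]
  have := h0.norm_le f
  rw [zero_mul, norm_le_zero_iff] at this
  rw [jumpOp, this, smul_zero]

lemma measurable_jumpOp {u : L1 → Plane → Plane} {U : ℝ} (hu : IsDrift u U) {h κ : ℝ}
    (hh : 0 ≤ h) (hκ : 1 ≤ κ) : Measurable (Function.uncurry (jumpOp h κ u)) := by
  refine measurable_uncurry_of_continuous_L1 (fun τ => ?_) fun f => ?_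
  · by_cases hτ : 0 < τ
    · exact continuous_of_lipschitz_on_balls fun M _ => ⟨1 + 2 * h * U * M / √τ,
        fun f g _ hg => norm_jumpOp_sub_le hu hh hκ hτ hg⟩
    · rw [show jumpOp h κ u τ = fun _ => 0 from
        funext fun f => jumpOp_of_nonpos hu h κ (not_lt.1 hτ) f]
      exact continuous_const
  · refine (measurable_kerOp (k := fun τ => pushKer (jumpMap h (u f)) τ) (A := fun _ => 1) ?_
      (fun τ => isKer_pushKer (measurable_jumpMap h (hu.meas f)) τ) f).const_smul κ⁻¹
    unfold pushKer
    have := measurable_jumpMap h (hu.meas f)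
    fun_prop

/-- The time singularity of the consistency error. -/
def errorWeight (τ : ℝ) : ℝ := 1 + 1 / √τ + 1 / √(τ * √τ)

lemma errorWeight_nonneg (τ : ℝ) : 0 ≤ errorWeight τ := by unfold errorWeight; positivity

lemma integrableOn_errorWeight (t : ℝ) : IntegrableOn errorWeight (Ioc 0 t) := by
  unfold errorWeight
  refine ((integrableOn_const (by simp)).add (integrableOn_inv_sqrt t)).add ?_
  rcases le_or_gt t 0 with ht | ht
  · simp [Ioc_eq_empty ht.not_gt]
  · have h := intervalIntegral.intervalIntegrable_rpow' (a := 0) (b := t)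
      (r := -(3 / 4)) (by norm_num)
    rw [intervalIntegrable_iff_integrableOn_Ioc_of_le ht.le] at h
    refine h.congr_fun (fun s hs => ?_) measurableSet_Ioc
    have hs0 : 0 < s := hs.1
    change s ^ (-(3 / 4) : ℝ) = 1 / √(s * √s)
    rw [Real.rpow_neg hs0.le, one_div, Real.sqrt_eq_rpow, Real.sqrt_eq_rpow]
    nth_rewrite 2 [← Real.rpow_one s]
    rw [← Real.rpow_add hs0, ← Real.rpow_mul hs0.le]
    norm_num

/-- Consistency of the jump approximation. -/
lemma norm_jump_sub_drift_le {u w : L1 → Plane → Plane} {U η M h κ : ℝ} (hu : IsDrift u U)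
    (hw : IsDrift w U) (hη : ∀ f x, ‖w f x - u f x‖ ≤ η * ‖f‖) (hη0 : 0 ≤ η)
    (hh : 0 < h) (hκ : 1 ≤ κ) (hM : 0 ≤ M)
    {τ : ℝ} (hτ : 0 < τ) {f : L1} (hf : ‖f‖ ≤ M) :
    ‖h⁻¹ • (jumpOp h κ w τ f - heatCLM τ f) - driftOp u τ f‖
      ≤ (h⁻¹ * (1 - κ⁻¹) + √(10 * h * (U * M) ^ 3) + 2 * η * M) * M * errorWeight τ := by
  have hU := hu.nonneg
  have hsq : 0 < √τ := Real.sqrt_pos.2 hτ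
  have hwM : ∀ y, ‖w f y‖ ≤ U * M := fun y => (hw.norm_le f y).trans (by gcongr)
  have huM : ∀ y, ‖u f y‖ ≤ U * M := fun y => (hu.norm_le f y).trans (by gcongr)
  have hP := isKer_pushKer (measurable_jumpMap h (hw.meas f)) τ
  have hS := isKer_pushKer measurable_id τ
  have hB := isKer_driftKer (hw.meas f) hwM τ
  set P := kerOp (pushKer (jumpMap h (w f)) τ) f with hPdef
  set S := heatCLM τ f with hSdef
  set D := kerOp (driftKer (w f) τ) f with hDdef
  -- Three errors: the normalisation by κ, the Taylor remainder of the jump, and the replacement of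
  -- u by w.
  have e : h⁻¹ • (jumpOp h κ w τ f - S) - driftOp u τ f
      = (h⁻¹ * (κ⁻¹ - 1)) • P + h⁻¹ • (P - S - h • D) + (D - driftOp u τ f) := by
    have : jumpOp h κ w τ f = κ⁻¹ • P := rfl
    rw [this, mul_smul, sub_smul, one_smul, smul_sub h⁻¹ (P - S), inv_smul_smul₀ hh.ne']
    module
  have h1 : ‖(h⁻¹ * (κ⁻¹ - 1)) • P‖ ≤ h⁻¹ * (1 - κ⁻¹) * M := by
    have h2 : κ⁻¹ ≤ 1 := inv_le_one_of_one_le₀ hκ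
    rw [norm_smul, norm_mul, Real.norm_of_nonneg (by positivity), Real.norm_eq_abs,
      abs_sub_comm, abs_of_nonneg (by linarith)]
    have h3 := hP.norm_le f
    rw [one_mul] at h3
    exact mul_le_mul_of_nonneg_left (h3.trans hf) (mul_nonneg (by positivity) (by linarith))
  have h3 : ‖D - driftOp u τ f‖ ≤ 2 / √τ * (η * M) * M := by
    have h4 := norm_kerOp_driftKer_sub_le (hw.meas f) (hu.meas f) hwM huM
      (η := η * M) (fun y => (hη f y).trans (by gcongr)) τ f
    exact h4.trans (by gcongr)
  have h4 : ‖P - S - h • D‖ ≤ h * √(10 * h * (U * M) ^ 3) * (1 / √(τ * √τ)) * M := by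
    have hPS : P - S = kerOp (fun x y => pushKer (jumpMap h (w f)) τ x y - pushKer id τ x y) f :=
      hP.sub_ker hS f
    have hhD : h • D = kerOp (fun x y => h * driftKer (w f) τ x y) f := (hB.smul_ker h f).symm
    have hk1 : IsKer (fun x y => pushKer (jumpMap h (w f)) τ x y - pushKer id τ x y)
        (2 / √τ * (h * (U * M))) := by
      refine ⟨hP.meas.sub hS.meas, by positivity, fun y => ?_⟩
      refine (lintegral_hk_sub_sub_hk_sub hτ _ _).trans (ENNReal.ofReal_le_ofReal ?_)
      have e2 : jumpMap h (w f) y - id y = h • w f y := by rw [jumpMap, id, add_sub_cancel_left]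
      rw [e2, norm_smul, Real.norm_of_nonneg hh.le]
      gcongr
      exact hwM y
    have hk2 := hB.const_mul h
    rw [abs_of_pos hh] at hk2
    have eT : ∀ x y, pushKer (jumpMap h (w f)) τ x y - pushKer id τ x y
        - h * driftKer (w f) τ x y = hk τ (x - y - h • w f y) - hk τ (x - y)
          + inner ℝ (hkGrad τ (x - y)) (h • w f y) := by
      intro x y
      rw [pushKer, pushKer, jumpMap, driftKer, inner_smul_right, id, sub_add_eq_sub_sub]
      ring
    have hA : ‖P - S - h • D‖ ≤ 5 / (2 * τ) * (h * (U * M)) ^ 2 * ‖f‖ := by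
      rw [hPS, hhD]
      refine hk1.norm_sub_le hk2 (by positivity) (fun y => ?_) f
      simp_rw [eT]
      refine (lintegral_hk_taylor hτ y (h • w f y)).trans (ENNReal.ofReal_le_ofReal ?_)
      gcongr
      rw [norm_smul, Real.norm_of_nonneg hh.le]
      gcongr
      exact hwM y
    have hC : ‖P - S - h • D‖ ≤ 4 / √τ * (h * (U * M)) * ‖f‖ := by
      have h5 := norm_sub_le (P - S) (h • D)
      have h6 := hk1.norm_le f
      have h7 := hk2.norm_le f
      rw [← hPS] at h6
      rw [← hhD] at h7
      refine h5.trans ((add_le_add h6 h7).trans (le_of_eq ?_))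
      ring
    -- The second-order bound h²/τ is not integrable in τ, and the first-order bound h/√τ does not
    -- vanish after division by h. Their geometric mean, of order h^{3/2} τ^{-3/4}, has neither
    -- defect.
    have hsq : ‖P - S - h • D‖ ^ 2 ≤ (5 / (2 * τ) * (h * (U * M)) ^ 2 * ‖f‖)
        * (4 / √τ * (h * (U * M)) * ‖f‖) := by
      rw [sq]
      exact mul_le_mul hA hC (norm_nonneg _) (by positivity)
    have hV : 0 ≤ U * M := by positivity
    refine abs_le_of_sq_le_sq' ?_ (by positivity) |>.2
    refine hsq.trans ?_
    calc (5 / (2 * τ) * (h * (U * M)) ^ 2 * ‖f‖) * (4 / √τ * (h * (U * M)) * ‖f‖)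
        = h ^ 2 * (10 * h * (U * M) ^ 3) * (1 / (τ * √τ)) * ‖f‖ ^ 2 := by field_simp; ring
      _ ≤ h ^ 2 * (10 * h * (U * M) ^ 3) * (1 / (τ * √τ)) * M ^ 2 := by gcongr
      _ = _ := by
        have q1 := Real.sq_sqrt (show 0 ≤ 10 * h * (U * M) ^ 3 by positivity)
        have q2 := Real.sq_sqrt (show 0 ≤ τ * √τ by positivity)
        rw [show ∀ a b : ℝ, (h * √a * (1 / √b) * M) ^ 2 = h ^ 2 * √a ^ 2 * (1 / √b ^ 2) * M ^ 2
          from fun a b => by ring, q1, q2]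
  have h5 : ‖h⁻¹ • (P - S - h • D)‖ ≤ √(10 * h * (U * M) ^ 3) * (1 / √(τ * √τ)) * M := by
    rw [norm_smul, Real.norm_of_nonneg (by positivity), inv_mul_le_iff₀ hh]
    refine h4.trans (le_of_eq (by ring))
  rw [e]
  refine (norm_add_le _ _).trans ((add_le_add ((norm_add_le _ _).trans (add_le_add h1 h5)) h3).trans
    ?_)
  have hκ1 : 0 ≤ h⁻¹ * (1 - κ⁻¹) := mul_nonneg (by positivity)
    (by have := inv_le_one_of_one_le₀ hκ; linarith)
  set A := h⁻¹ * (1 - κ⁻¹)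
  set R := √(10 * h * (U * M) ^ 3) with hR
  have hR0 : 0 ≤ R := Real.sqrt_nonneg _
  have p1 : 0 ≤ 1 / √τ := by positivity
  have p2 : 0 ≤ 1 / √(τ * √τ) := by positivity
  have hηM : 0 ≤ 2 * η * M := by positivity
  unfold errorWeight
  have e5 : 2 / √τ * (η * M) * M = (2 * η * M) * M * (1 / √τ) := by ring
  rw [e5]
  set a := 1 / √τ
  set b := 1 / √(τ * √τ)
  have q1 := mul_nonneg (mul_nonneg hκ1 hM) p1
  have q2 := mul_nonneg (mul_nonneg hκ1 hM) p2
  have q3 := mul_nonneg (mul_nonneg hR0 hM) p1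
  have q4 := mul_nonneg hR0 hM
  have q5 := mul_nonneg (mul_nonneg hηM hM) p2
  have q6 := mul_nonneg hηM hM
  linarith

end Operators

end VCHE
end

/-! ### The jump scheme: Moser iteration and solvability. -/

noncomputable section

namespace VCHE

section Scheme

open Filter Topology

lemma powInt_eq (k : ℕ) (f : L1) : powInt k f = eLpNorm f (2 ^ k : ℕ) volume ^ (2 ^ k) := by
  have h0 : ((2 ^ k : ℕ) : ℝ≥0∞) ≠ 0 := by simp
  have hr : (((2 ^ k : ℕ) : ℝ≥0∞)).toReal = (2 ^ k : ℕ) := ENNReal.toReal_natCast _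
  rw [powInt, eLpNorm_eq_lintegral_rpow_enorm_toReal h0 (ENNReal.natCast_ne_top _), hr,
    ← ENNReal.rpow_natCast, ← ENNReal.rpow_mul, one_div,
    inv_mul_cancel₀ (by positivity), ENNReal.rpow_one]
  simp_rw [ENNReal.rpow_natCast]

lemma powInt_le_iff (k : ℕ) (f : L1) (R : ℝ≥0∞) :
    powInt k f ≤ R ↔ eLpNorm f (2 ^ k : ℕ) volume ≤ R ^ ((2 ^ k : ℕ) : ℝ)⁻¹ := by
  rw [powInt_eq, ENNReal.le_rpow_inv_iff (by positivity), ENNReal.rpow_natCast]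

lemma convex_powInt_le (k : ℕ) (R : ℝ≥0∞) : Convex ℝ {f : L1 | powInt k f ≤ R} := by
  simp_rw [powInt_le_iff]
  set R' := R ^ ((2 ^ k : ℕ) : ℝ)⁻¹
  intro f hf g hg a b ha hb hab
  simp only [mem_ofPred_eq] at hf hg ⊢
  have h1 : (1 : ℝ≥0∞) ≤ (2 ^ k : ℕ) := by exact_mod_cast Nat.one_le_two_pow
  have e : ⇑(a • f + b • g) =ᵐ[volume] a • ⇑f + b • ⇑g := by
    filter_upwards [Lp.coeFn_add (a • f) (b • g), Lp.coeFn_smul a f, Lp.coeFn_smul b g]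
      with x h1 h2 h3
    rw [h1, Pi.add_apply, Pi.add_apply, h2, h3]
  rw [eLpNorm_congr_ae e]
  refine (eLpNorm_add_le ((Lp.aestronglyMeasurable f).const_smul a)
    ((Lp.aestronglyMeasurable g).const_smul b) h1).trans ?_
  rw [eLpNorm_const_smul, eLpNorm_const_smul, Real.enorm_eq_ofReal ha, Real.enorm_eq_ofReal hb]
  calc _ ≤ ENNReal.ofReal a * R' + ENNReal.ofReal b * R' := by gcongr
    _ = R' := by rw [← add_mul, ← ENNReal.ofReal_add ha hb, hab, ENNReal.ofReal_one, one_mul]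

/-- Fatou's lemma along an almost everywhere convergent subsequence. -/
lemma eLpNorm_le_of_tendsto_L1 {p R : ℝ≥0∞} {F : ℕ → L1} {f : L1}
    (hF : Tendsto F atTop (𝓝 f)) (h : ∀ n, eLpNorm (F n) p volume ≤ R) :
    eLpNorm f p volume ≤ R := by
  have hm : TendstoInMeasure volume (fun n => ⇑(F n)) atTop ⇑f :=
    tendstoInMeasure_of_tendsto_Lp hF
  obtain ⟨ns, -, hns⟩ := hm.exists_seq_tendsto_ae
  exact Lp.eLpNorm_le_of_ae_tendsto (u := atTop) (f := fun i => ⇑(F (ns i)))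
    (Eventually.of_forall fun i => h _) (fun i => Lp.aestronglyMeasurable _) hns

lemma powInt_le_of_tendsto {k : ℕ} {R : ℝ≥0∞} {F : ℕ → L1} {f : L1}
    (hF : Tendsto F atTop (𝓝 f)) (h : ∀ n, powInt k (F n) ≤ R) : powInt k f ≤ R := by
  simp_rw [powInt_le_iff] at h ⊢
  exact eLpNorm_le_of_tendsto_L1 hF h

lemma isClosed_powInt_le (k : ℕ) (R : ℝ≥0∞) : IsClosed {f : L1 | powInt k f ≤ R} :=
  IsSeqClosed.isClosed fun _ _ hF hf => powInt_le_of_tendsto hf hF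

lemma powInt_zero_right (k : ℕ) : powInt k 0 = 0 := by
  rw [powInt_eq, eLpNorm_congr_ae (Lp.coeFn_zero ℝ 1 volume)]
  simp

lemma powInt_zero_left (f : L1) : powInt 0 f = ENNReal.ofReal ‖f‖ := by
  simp [powInt, L1.lintegral_enorm]

/-- The bound for `powInt k` of solutions with initial `L¹` norm `M`. -/
def decayBound (M : ℝ) (k : ℕ) (t : ℝ) : ℝ :=
  2 ^ (7 * 2 ^ k) / 2 ^ (k + 7) * M ^ 2 ^ k / t ^ (2 ^ k - 1)

lemma decayBound_nonneg {M : ℝ} (hM : 0 ≤ M) (k : ℕ) {t : ℝ} (ht : 0 < t) :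
    0 ≤ decayBound M k t := by
  unfold decayBound; positivity

lemma decayBound_anti {M : ℝ} (hM : 0 ≤ M) (k : ℕ) {s t : ℝ} (hs : 0 < s) (hst : s ≤ t) :
    decayBound M k t ≤ decayBound M k s := by
  unfold decayBound
  gcongr

/-- One Moser step, smoothing over the last fraction 2^{-k-1} of the time; `decayBound` is designed
to satisfy this recursion. The only loss is (1 - 2^{-k-1})^{-2(2^k-1)} ≤ 4, by Bernoulli's
inequality. -/
lemma decayBound_succ (M : ℝ) (k : ℕ) {t : ℝ} (ht : 0 < t) :
    8 * decayBound M k (t * (1 - 1 / 2 ^ (k + 1))) ^ 2 / (t - t * (1 - 1 / 2 ^ (k + 1)))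
      ≤ decayBound M (k + 1) t := by
  set m : ℕ := 2 ^ k with hm
  have hm1 : 1 ≤ m := Nat.one_le_two_pow
  have hmR : ((m : ℕ) : ℝ) = 2 ^ k := by rw [hm]; push_cast; rfl
  have hn : (2 : ℝ) ^ (k + 1) = 2 * m := by rw [hmR, pow_succ]; ring
  set q : ℝ := 1 - 1 / 2 ^ (k + 1) with hq
  have hm1R : (1 : ℝ) ≤ m := by exact_mod_cast hm1
  have hq0 : 0 < q := by
    rw [hq, hn, sub_pos, div_lt_one (by positivity)]
    linarith
  have hq1 : q ≤ 1 := by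
    rw [hq]
    have : (0 : ℝ) ≤ 1 / 2 ^ (k + 1) := by positivity
    linarith
  have hqm : (1 : ℝ) / 2 ≤ q ^ m := by
    have h1 := one_add_mul_le_pow (a := -(1 / (2 * (m : ℝ)))) (by
      have : 1 / (2 * (m : ℝ)) ≤ 1 := by rw [div_le_one (by positivity)]; linarith
      linarith) m
    have e : 1 + -(1 / (2 * (m : ℝ))) = q := by rw [hq, hn]; ring
    rw [e] at h1
    refine le_trans (le_of_eq ?_) h1
    field_simp
    norm_num
  have hq4 : (1 : ℝ) / 4 ≤ (q ^ (m - 1)) ^ 2 := by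
    have h1 : q ^ m ≤ q ^ (m - 1) := pow_le_pow_of_le_one hq0.le hq1 (Nat.sub_le _ _)
    have h2 : 1 / 2 ≤ q ^ (m - 1) := hqm.trans h1
    nlinarith
  have e1 : t - t * q = t / (2 * m) := by rw [hq, hn]; ring
  have hexp : 2 ^ (k + 1) - 1 = 2 * (m - 1) + 1 := by rw [pow_succ, ← hm]; omega
  unfold decayBound
  rw [hexp, e1, pow_succ 2 k, ← hm]
  rw [show k + 1 + 7 = k + 8 by ring, show 7 * (m * 2) = (7 * m) * 2 by ring,
    pow_mul (2 : ℝ) (7 * m) 2, pow_mul M m 2]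
  set A : ℝ := 2 ^ (7 * m)
  have e2 : (2 : ℝ) ^ (k + 8) = m * 256 := by rw [pow_add, ← hmR]; norm_num
  have e3 : (2 : ℝ) ^ (k + 7) = m * 128 := by rw [pow_add, ← hmR]; norm_num
  rw [e2, e3]
  have e4 : (t * q) ^ (m - 1) = t ^ (m - 1) * q ^ (m - 1) := mul_pow _ _ _
  have e5 : t ^ (2 * (m - 1) + 1) = (t ^ (m - 1)) ^ 2 * t := by rw [pow_succ, mul_comm 2, pow_mul]
  rw [e4, e5]
  set T := t ^ (m - 1) with hT
  have hT0 : 0 < T := by positivity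
  set Q := q ^ (m - 1) with hQ
  have hQ0 : 0 < Q := by positivity
  have hA : 0 < A := by positivity
  have e6 : 8 * (A / (m * 128) * M ^ m / (T * Q)) ^ 2 / (t / (2 * m))
      = (A ^ 2 * (M ^ m) ^ 2 / (m * 256 * (T ^ 2 * t))) * (1 / 4 / Q ^ 2) := by
    field_simp
    ring
  have e7 : A ^ 2 / (m * 256) * (M ^ m) ^ 2 / (T ^ 2 * t)
      = (A ^ 2 * (M ^ m) ^ 2 / (m * 256 * (T ^ 2 * t))) * 1 := by
    field_simp
  rw [e6, e7]
  gcongr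
  rw [div_le_one (by positivity)]
  exact hq4

variable {u : L1 → Plane → Plane} {U h κ M : ℝ} {v₀ : L1}

/-- The kernel of the jump equation. -/
def jumpKernel (h κ : ℝ) (u : L1 → Plane → Plane) (τ : ℝ) (f : L1) : L1 :=
  (h⁻¹ * Real.exp (-(h⁻¹ * τ))) • jumpOp h κ u τ f

/-- The free term of the jump equation. -/
def jumpFree (h : ℝ) (v₀ : L1) (t : ℝ) : L1 := Real.exp (-(h⁻¹ * t)) • heatCLM t v₀

lemma heatCLM_of_nonpos {t : ℝ} (ht : t ≤ 0) (f : L1) : heatCLM t f = 0 := by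
  have h0 : IsKer (pushKer id t) 0 := by
    refine ⟨(isKer_pushKer measurable_id t).meas, le_rfl, fun y => ?_⟩
    simp [pushKer, hk_of_nonpos ht]
  have := h0.norm_le f
  rwa [zero_mul, norm_le_zero_iff] at this

lemma jumpFree_of_nonpos {t : ℝ} (ht : t ≤ 0) : jumpFree h v₀ t = 0 := by
  rw [jumpFree, heatCLM_of_nonpos ht, smul_zero]

lemma integrableOn_jumpOp (hu : IsDrift u U) (hh : 0 < h) (hκ : 1 ≤ κ) {v : ℝ → L1}
    (hv : Measurable v) (hvM : ∀ s, ‖v s‖ ≤ M) (t : ℝ) :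
    IntegrableOn (fun s => jumpOp h κ u (t - s) (v s)) (Ioc 0 t) :=
  integrableOn_volterra (measurable_jumpOp hu hh.le hκ) (ρ := fun _ => M)
    (integrableOn_const (by simp))
    (fun τ _ f hf => (norm_jumpOp_le hu h hκ τ f).trans hf) hv hvM

/-- A Picard step at t > 0 is an average of S(t)v₀ and the jump terms with weights of total mass
one, so it inherits any closed convex constraint common to them. -/
lemma picard_jump_mem (hu : IsDrift u U) (hh : 0 < h) (hκ : 1 ≤ κ) {W : Set L1}
    (hW : Convex ℝ W) (hWc : IsClosed W) {v : ℝ → L1} (hv : Measurable v)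
    (hvM : ∀ s, ‖v s‖ ≤ M) {t : ℝ} (ht : 0 < t) (h0 : heatCLM t v₀ ∈ W)
    (h1 : ∀ s ∈ Ioo 0 t, jumpOp h κ u (t - s) (v s) ∈ W) :
    picard (jumpKernel h κ u) (jumpFree h v₀) v t ∈ W := by
  refine jump_average_mem hW hWc (inv_pos.2 hh) h0 (integrableOn_jumpOp hu hh hκ hv hvM t) ?_ ht
  rw [← restrict_Ioo_eq_restrict_Ioc]
  filter_upwards [ae_restrict_mem measurableSet_Ioo] with s hs
  exact h1 s hs

lemma measurable_jumpKernel (hu : IsDrift u U) (hh : 0 < h) (hκ : 1 ≤ κ) :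
    Measurable (Function.uncurry (jumpKernel h κ u)) := by
  have h1 := measurable_jumpOp hu hh.le hκ
  have h2 : Measurable fun p : ℝ × L1 => h⁻¹ * Real.exp (-(h⁻¹ * p.1)) := by fun_prop
  exact h2.smul h1

/-- From √q e^{-q} ≤ 1 with q = τ/h one gets h⁻¹ e^{-τ/h} ≤ h^{-1/2} τ^{-1/2}, so the jump kernel
fits the singular Volterra theory. The constant blows up as h tends to 0; it serves only for fixed
h. -/
lemma norm_jumpKernel_sub_le (hu : IsDrift u U) (hh : 0 < h) (hκ : 1 ≤ κ) (hM : 0 ≤ M)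
    {τ : ℝ} (hτ : 0 < τ) {f g : L1} (hg : ‖g‖ ≤ M) :
    ‖jumpKernel h κ u τ f - jumpKernel h κ u τ g‖
      ≤ (√h⁻¹ + 2 * U * M) / √τ * ‖f - g‖ := by
  have hU := hu.nonneg
  have hs : 0 < √τ := Real.sqrt_pos.2 hτ
  set c := h⁻¹ with hc
  have hc0 : 0 < c := by positivity
  rw [jumpKernel, jumpKernel, ← smul_sub, norm_smul, Real.norm_of_nonneg (by positivity)]
  have h1 := norm_jumpOp_sub_le hu hh.le hκ hτ hg (f := f)
  refine (mul_le_mul_of_nonneg_left h1 (by positivity)).trans ?_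
  rw [← mul_assoc]
  gcongr
  have e1 : Real.exp (-(c * τ)) ≤ 1 := Real.exp_le_one_iff.2 (by
    have : 0 < c * τ := by positivity
    linarith)
  have e2 : √c * √τ * Real.exp (-(c * τ)) ≤ 1 := by
    rw [← Real.sqrt_mul hc0.le, Real.exp_neg, ← div_eq_mul_inv, div_le_one (Real.exp_pos _)]
    have h3 := Real.add_one_le_exp (c * τ)
    have h4 := Real.sq_sqrt (show 0 ≤ c * τ by positivity)
    nlinarith [sq_nonneg (√(c * τ) - 1)]
  have e3 : √c * √c = c := Real.mul_self_sqrt hc0.le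
  rw [le_div_iff₀ hs]
  have e4 : c * h = 1 := by rw [hc]; exact inv_mul_cancel₀ hh.ne'
  calc c * Real.exp (-(c * τ)) * (1 + 2 * h * U * M / √τ) * √τ
      = √c * (√c * √τ * Real.exp (-(c * τ))) + 2 * (c * h) * U * M * Real.exp (-(c * τ)) := by
        field_simp
        linear_combination (-√τ) * e3
    _ ≤ √c * 1 + 2 * (c * h) * U * M * 1 := by
        rw [e4]
        gcongr
    _ = _ := by rw [e4]; ring

/-- The Picard iterates of the jump equation. -/
def jumpIter (h κ : ℝ) (u : L1 → Plane → Plane) (v₀ : L1) (j : ℕ) : ℝ → L1 :=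
  (picard (jumpKernel h κ u) (jumpFree h v₀))^[j] 0

lemma jumpIter_succ (j : ℕ) : jumpIter h κ u v₀ (j + 1)
    = picard (jumpKernel h κ u) (jumpFree h v₀) (jumpIter h κ u v₀ j) :=
  Function.iterate_succ_apply' _ _ _

lemma picard_jump_norm_le (hu : IsDrift u U) (hh : 0 < h) (hκ : 1 ≤ κ) (hv₀ : ‖v₀‖ ≤ M)
    {v : ℝ → L1} (hv : Measurable v) (hvM : ∀ s, ‖v s‖ ≤ M) (t : ℝ) :
    ‖picard (jumpKernel h κ u) (jumpFree h v₀) v t‖ ≤ M := by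
  have hM : 0 ≤ M := (norm_nonneg _).trans hv₀
  rcases le_or_gt t 0 with ht | ht
  · simpa [picard, Ioc_eq_empty ht.not_gt, jumpFree_of_nonpos ht] using hM
  · have := picard_jump_mem hu hh hκ (convex_closedBall (0 : L1) M) Metric.isClosed_closedBall hv
      hvM ht (v₀ := v₀) (by simpa using (norm_heatCLM_le t v₀).trans hv₀) (fun s _ => by
        simpa using (norm_jumpOp_le hu h hκ (t - s) (v s)).trans (hvM s))
    simpa using this

lemma measurable_jumpFree : Measurable (jumpFree h v₀) := by
  have h1 := measurable_heatCLM v₀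
  have h2 : Measurable fun t : ℝ => Real.exp (-(h⁻¹ * t)) := by fun_prop
  exact h2.smul h1

lemma measurable_jumpIter (hu : IsDrift u U) (hh : 0 < h) (hκ : 1 ≤ κ) (j : ℕ) :
    Measurable (jumpIter h κ u v₀ j) := by
  induction j with
  | zero => exact measurable_const
  | succ j ih =>
    rw [jumpIter_succ]
    exact measurable_picard (measurable_jumpKernel hu hh hκ) measurable_jumpFree ih

lemma norm_jumpIter_le (hu : IsDrift u U) (hh : 0 < h) (hκ : 1 ≤ κ) (hv₀ : ‖v₀‖ ≤ M) (j : ℕ)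
    (t : ℝ) : ‖jumpIter h κ u v₀ j t‖ ≤ M := by
  induction j generalizing t with
  | zero => simpa [jumpIter] using (norm_nonneg _).trans hv₀
  | succ j ih =>
    rw [jumpIter_succ]
    exact picard_jump_norm_le hu hh hκ hv₀ (measurable_jumpIter hu hh hκ j) ih t

lemma powInt_heatCLM_succ_le {τ N : ℝ} (hτ : 0 < τ) (hN : 0 ≤ N) {f : L1} {k : ℕ}
    (h : powInt k f ≤ ENNReal.ofReal N) :
    powInt (k + 1) (heatCLM τ f) ≤ ENNReal.ofReal (8 * N ^ 2 / τ) := by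
  have := powInt_succ_le_of_powInt areaBound_id hτ hN h
  rwa [inv_one, one_smul] at this

/-- Moser iteration along the Picard iterates. -/
lemma powInt_jumpIter_le (hu : IsDrift u U) (hh : 0 < h) (hκ : 1 ≤ κ) (hv₀ : ‖v₀‖ ≤ M)
    (harea : ∀ f, ‖f‖ ≤ M → AreaBound (jumpMap h (u f)) κ) (k : ℕ) :
    ∀ t > 0, powInt k (heatCLM t v₀) ≤ ENNReal.ofReal (decayBound M k t) ∧
      ∀ j, powInt k (jumpIter h κ u v₀ j t) ≤ ENNReal.ofReal (decayBound M k t) ∧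
        ∀ s ∈ Ioo 0 t, powInt k (jumpOp h κ u (t - s) (jumpIter h κ u v₀ j s))
          ≤ ENNReal.ofReal (decayBound M k t) := by
  have hM : 0 ≤ M := (norm_nonneg _).trans hv₀
  have hVm : ∀ j, Measurable (jumpIter h κ u v₀ j) := measurable_jumpIter hu hh hκ
  have hVM : ∀ j t, ‖jumpIter h κ u v₀ j t‖ ≤ M := norm_jumpIter_le hu hh hκ hv₀
  -- The induction carries the free term and the single jump terms along with the iterates: for
  -- jumps before t₀ it is the diffused jump term, not the iterate, that is known to be bounded at
  -- t₀.
  induction k with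
  | zero =>
    intro t _
    have e : decayBound M 0 t = M := by simp [decayBound]
    simp_rw [powInt_zero_left, e]
    refine ⟨ENNReal.ofReal_le_ofReal ((norm_heatCLM_le t v₀).trans hv₀), fun j =>
      ⟨ENNReal.ofReal_le_ofReal (hVM j t), fun s _ => ENNReal.ofReal_le_ofReal ?_⟩⟩
    exact (norm_jumpOp_le hu h hκ _ _).trans (hVM j s)
  | succ k ih =>
    intro t ht
    -- The exponent-2^k bound at t₀ is used as N, and the remaining time t/2^{k+1} gives the gain
    -- for the next exponent.
    set t₀ := t * (1 - 1 / 2 ^ (k + 1)) with ht₀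
    have h2k : (1 : ℝ) < 2 ^ (k + 1) := one_lt_pow₀ one_lt_two (Nat.succ_ne_zero k)
    have hlt1 : (1 : ℝ) / 2 ^ (k + 1) < 1 := by rw [div_lt_one (by positivity)]; exact h2k
    have hpos1 : (0 : ℝ) < 1 / 2 ^ (k + 1) := by positivity
    have ht₀0 : 0 < t₀ := mul_pos ht (by linarith)
    have ht₀t : t₀ < t := by rw [ht₀]; nlinarith
    set N := decayBound M k t₀ with hN
    have hN0 : 0 ≤ N := decayBound_nonneg hM k ht₀0
    have hV : ∀ j, ∀ s, t₀ ≤ s → powInt k (jumpIter h κ u v₀ j s) ≤ ENNReal.ofReal N :=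
      fun j s hs => ((ih s (ht₀0.trans_le hs)).2 j).1.trans
        (ENNReal.ofReal_le_ofReal (decayBound_anti hM k ht₀0 hs))
    have hi : ∀ T > t₀, powInt (k + 1) (heatCLM T v₀) ≤ ENNReal.ofReal (8 * N ^ 2 / (T - t₀)) := by
      intro T hT
      have h1 := powInt_heatCLM_succ_le (sub_pos.2 hT) hN0 (ih t₀ ht₀0).1
      rwa [heatCLM_heatCLM (sub_pos.2 hT) ht₀0, sub_add_cancel] at h1
    -- The jump time s is compared with t₀. For s < t₀ the jump term already diffused up to t₀ is
    -- smoothed further by the heat flow; for s = t₀ the plain smoothing applies; for s > t₀ Nash's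
    -- estimate propagates the bound of the iterate at s.
    have hiii : ∀ j, (∀ T > t₀, powInt (k + 1) (jumpIter h κ u v₀ j T)
          ≤ ENNReal.ofReal (8 * N ^ 2 / (T - t₀))) → ∀ T > t₀, ∀ s ∈ Ioo 0 T,
        powInt (k + 1) (jumpOp h κ u (T - s) (jumpIter h κ u v₀ j s))
          ≤ ENNReal.ofReal (8 * N ^ 2 / (T - t₀)) := by
      intro j hj T hT s hs
      have ha := harea _ (hVM j s)
      rcases lt_trichotomy s t₀ with hst | hst | hst
      · have h1 := powInt_heatCLM_succ_le (sub_pos.2 hT) hN0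
          (((ih t₀ ht₀0).2 j).2 s ⟨hs.1, hst⟩)
        rwa [heatCLM_jumpOp hu h κ (sub_pos.2 hT) (sub_pos.2 hst), sub_add_sub_cancel] at h1
      · subst hst
        exact powInt_succ_le_of_powInt ha (sub_pos.2 hT) hN0 (hV j _ le_rfl)
      -- Propagation divides by N; when N = 0, plain smoothing already gives zero.
      · rcases hN0.eq_or_lt with hN' | hN'
        · have h1 : powInt (k + 1) (jumpOp h κ u (T - s) (jumpIter h κ u v₀ j s)) ≤ _ :=
            powInt_succ_le_of_powInt ha (sub_pos.2 hs.2) hN0 (hV j s hst.le)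
          rw [← hN'] at h1 ⊢
          simpa using h1
        · have h1 := powInt_succ_le_of_powInt_succ ha (sub_pos.2 hs.2) (sub_pos.2 hst) hN'
            (hV j s hst.le) (hj s hst)
          have e : s - t₀ + (T - s) = T - t₀ := by ring
          rwa [e] at h1
    have hii : ∀ j, ∀ T > t₀, powInt (k + 1) (jumpIter h κ u v₀ j T)
        ≤ ENNReal.ofReal (8 * N ^ 2 / (T - t₀)) := by
      intro j
      induction j with
      | zero =>
        intro T _
        simp [jumpIter, powInt_zero_right]
      | succ j ihj =>
        intro T hT
        rw [jumpIter_succ]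
        exact picard_jump_mem hu hh hκ (convex_powInt_le (k + 1) _) (isClosed_powInt_le (k + 1) _)
          (hVm j) (hVM j) (ht₀0.trans hT) (hi T hT) (hiii j ihj T hT)
    have hfin := ENNReal.ofReal_le_ofReal (decayBound_succ M k ht)
    rw [← ht₀, ← hN] at hfin
    exact ⟨(hi t ht₀t).trans hfin, fun j => ⟨(hii j t ht₀t).trans hfin, fun s hs =>
      (hiii j (hii j) t ht₀t s hs).trans hfin⟩⟩

/-- Solvability of the jump equation, in Duhamel form, with decay estimates. -/
theorem exists_jump_solution (hu : IsDrift u U) (hh : 0 < h) (hκ : 1 ≤ κ) (hv₀ : ‖v₀‖ ≤ M)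
    (harea : ∀ f, ‖f‖ ≤ M → AreaBound (jumpMap h (u f)) κ) :
    ∃ v : ℝ → L1, Measurable v ∧ (∀ t, ‖v t‖ ≤ M) ∧
      (∀ t > 0, v t = heatCLM t v₀ + ∫ s in Ioc 0 t,
        h⁻¹ • (jumpOp h κ u (t - s) (v s) - heatCLM (t - s) (v s))) ∧
      ∀ k, ∀ t > 0, powInt k (v t) ≤ ENNReal.ofReal (decayBound M k t) := by
  have hM : 0 ≤ M := (norm_nonneg _).trans hv₀
  have hU := hu.nonneg
  obtain ⟨v, hvm, hvM, hveq, hvt⟩ := exists_volterra_solution (N := jumpKernel h κ u)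
    (a := jumpFree h v₀) (M := M) (b := √h⁻¹ + 2 * U * M)
    (measurable_jumpKernel hu hh hκ) measurable_jumpFree hM (by positivity)
    (fun τ hτ f g _ hg => norm_jumpKernel_sub_le hu hh hκ hM hτ hg)
    (fun τ => by rw [jumpKernel, jumpOp_zero hu, smul_zero])
    (fun v hv hvM t => picard_jump_norm_le hu hh hκ hv₀ hv hvM t)
  refine ⟨v, hvm, hvM, fun t ht => ?_, fun k t ht => ?_⟩
  · refine duhamel_of_jump ht (v := v) (z := fun s => heatCLM s v₀)
      (g := fun s r => jumpOp h κ u (s - r) (v r)) (T := fun s => heatCLM (t - s)) (c := h⁻¹)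
      (fun s _ => hveq s) (fun s _ => integrableOn_jumpOp hu hh hκ hvm hvM s)
      (fun s hs => ?_) (fun s hs r hr => ?_) ?_
    · rw [heatCLM_heatCLM (sub_pos.2 hs.2) hs.1, sub_add_cancel]
    · rw [heatCLM_jumpOp hu h κ (sub_pos.2 hs.2) (sub_pos.2 hr.2), sub_add_sub_cancel]
    · have hm : Measurable (Function.uncurry fun τ (f : L1) => heatCLM τ f) :=
        measurable_uncurry_of_continuous_L1 (fun τ => (heatCLM τ).continuous) measurable_heatCLM
      exact integrableOn_volterra hm (ρ := fun _ => M) (integrableOn_const (by simp))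
        (fun τ _ f hf => (norm_heatCLM_le τ f).trans hf) hvm hvM
  · exact powInt_le_of_tendsto (hvt t) fun j =>
      ((powInt_jumpIter_le hu hh hκ hv₀ harea k t ht).2 j).1

end Scheme

end VCHE
end

/-! ### The resolvent kernel of 1 - α²Δ and its Riesz potential. -/

noncomputable section

namespace VCHE

/-- Twice the area of the unit disc. -/
def discConst : ℝ := 2 * volume.real (Metric.ball (0 : Plane) 1)

lemma discConst_nonneg : 0 ≤ discConst := by unfold discConst; positivity

lemma lintegral_ball_inv_norm {R : ℝ} (hR : 0 < R) :
    ∫⁻ w in Metric.ball (0 : Plane) R, ‖w‖ₑ⁻¹ = ENNReal.ofReal (discConst * R) := by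
  have hd : Module.finrank ℝ Plane = 2 := by simp
  have e0 : EqOn (fun y : ℝ => y ^ (2 - 1) • (Iio R).indicator (fun y => y⁻¹) y)
      ((Iio R).indicator fun _ => 1) (Ioi 0) := by
    intro y hy
    by_cases h : y < R
    · simp [h, (show 0 < y from hy).ne']
    · simp [h]
  have e1 : ∫ w : Plane, (Iio R).indicator (fun y => y⁻¹) ‖w‖ = discConst * R := by
    rw [integral_fun_norm_addHaar volume ((Iio R).indicator fun y => y⁻¹), hd,
      setIntegral_congr_fun measurableSet_Ioi e0, setIntegral_indicator measurableSet_Iio,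
      Ioi_inter_Iio]
    simp [discConst, hR.le]
    ring
  have i1 : Integrable fun w : Plane => (Iio R).indicator (fun y => y⁻¹) ‖w‖ := by
    rw [integrable_fun_norm_addHaar volume (f := (Iio R).indicator fun y => y⁻¹), hd,
      integrableOn_congr_fun e0 measurableSet_Ioi, integrableOn_indicator_iff measurableSet_Iio]
    rw [show Iio R ∩ Ioi 0 = Ioo 0 R by ext; simp [and_comm]]
    exact integrableOn_const (by simp)
  rw [← e1, ofReal_integral_eq_lintegral_ofReal i1, ← lintegral_indicator measurableSet_ball]
  · refine lintegral_congr_ae ?_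
    filter_upwards [compl_mem_ae_iff.2 (measure_singleton (0 : Plane))] with w hw
    have hw0 : 0 < ‖w‖ := norm_pos_iff.2 hw
    by_cases h : ‖w‖ < R
    · rw [indicator_of_mem (by simpa using h), indicator_of_mem (show ‖w‖ ∈ Iio R from h),
        ENNReal.ofReal_inv_of_pos hw0, ofReal_norm]
    · rw [indicator_of_notMem (by simpa using h), indicator_of_notMem (show ‖w‖ ∉ Iio R from h),
        ENNReal.ofReal_zero]
  · refine Filter.Eventually.of_forall fun w => ?_
    exact indicator_apply_nonneg fun _ => inv_nonneg.2 (norm_nonneg w)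

/-- Split at |x - z| = √τ. Inside, the heat kernel is at most 1/τ and the singularity has integral
of order √τ; outside, 1/|x - z| ≤ 1/√τ and the kernel has unit mass. -/
lemma lintegral_inv_norm_mul_hk_le {τ : ℝ} (hτ : 0 < τ) (x y : Plane) :
    ∫⁻ z, ‖x - z‖ₑ⁻¹ * ENNReal.ofReal (hk τ (z - y)) ≤
      ENNReal.ofReal ((discConst + 1) / √τ) := by
  have hs : 0 < √τ := Real.sqrt_pos.2 hτ
  have h1 : ∀ z, ‖x - z‖ₑ⁻¹ * ENNReal.ofReal (hk τ (z - y)) ≤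
      (Metric.ball (0 : Plane) (√τ)).indicator (fun w => ‖w‖ₑ⁻¹) (x - z) * ENNReal.ofReal (1 / τ) +
      ENNReal.ofReal (1 / √τ) * ENNReal.ofReal (hk τ (z - y)) := by
    intro z
    by_cases h : ‖x - z‖ < √τ
    · rw [indicator_of_mem (by simpa using h)]
      refine le_add_right ?_
      gcongr
      refine (hk_le hτ _).trans ?_
      gcongr
      nlinarith [Real.pi_gt_three]
    · refine le_add_left ?_
      gcongr
      rw [one_div, ENNReal.ofReal_inv_of_pos hs, ENNReal.inv_le_inv, ← ofReal_norm]
      exact ENNReal.ofReal_le_ofReal (not_lt.1 h)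
  refine (lintegral_mono h1).trans ?_
  rw [lintegral_add_right _ (by fun_prop), lintegral_const_mul _ (by fun_prop),
    lintegral_hk_sub hτ, lintegral_mul_const _ (by
      refine Measurable.comp (g := (Metric.ball (0 : Plane) (√τ)).indicator fun w => ‖w‖ₑ⁻¹) ?_
        (by fun_prop)
      exact Measurable.indicator (by fun_prop) measurableSet_ball),
    lintegral_sub_left_eq_self (fun w => (Metric.ball (0 : Plane) (√τ)).indicator
      (fun w => ‖w‖ₑ⁻¹) w) x, lintegral_indicator measurableSet_ball, lintegral_ball_inv_norm hs,
    mul_one, ← ENNReal.ofReal_mul (mul_nonneg discConst_nonneg hs.le), ← ENNReal.ofReal_add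
      (mul_nonneg (mul_nonneg discConst_nonneg hs.le) (by positivity)) (by positivity)]
  refine ENNReal.ofReal_le_ofReal (le_of_eq ?_)
  field_simp
  rw [Real.sq_sqrt hτ.le]; ring

/-- The part over the times `s ∈ I` of the fundamental solution of `1 - α² Δ`, written as a
superposition of heat kernels. -/
def resolvent (α : ℝ) (I : Set ℝ) (x : Plane) : ℝ := ∫ s in I, Real.exp (-s) * hk (α ^ 2 * s) x

/-- The convolution kernel of `resolvent α I`. -/
def resolventKer (α : ℝ) (I : Set ℝ) (x y : Plane) : ℝ := resolvent α I (x - y)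

lemma measurable_resolvent (α : ℝ) (I : Set ℝ) : Measurable (resolvent α I) := by
  have : Measurable fun p : Plane × ℝ => Real.exp (-p.2) * hk (α ^ 2 * p.2) p.1 := by fun_prop
  exact this.stronglyMeasurable.integral_prod_right'.measurable

lemma enorm_resolvent_le (α : ℝ) (I : Set ℝ) (x : Plane) :
    ‖resolvent α I x‖ₑ ≤
      ∫⁻ s in I, ENNReal.ofReal (Real.exp (-s)) * ENNReal.ofReal (hk (α ^ 2 * s) x) := by
  refine (enorm_integral_le_lintegral_enorm _).trans (le_of_eq (lintegral_congr fun s => ?_))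
  rw [enorm_mul, Real.enorm_of_nonneg (Real.exp_nonneg _), Real.enorm_of_nonneg (hk_nonneg _ _)]

lemma lintegral_exp_neg_Ioi : ∫⁻ s in Ioi (0 : ℝ), ENNReal.ofReal (Real.exp (-s)) = 1 := by
  have h : IntegrableOn (fun s : ℝ => Real.exp (-s)) (Ioi 0) := integrableOn_exp_neg_Ioi 0
  rw [← ofReal_integral_eq_lintegral_ofReal h (Filter.Eventually.of_forall fun _ =>
    Real.exp_nonneg _), integral_exp_neg_Ioi_zero, ENNReal.ofReal_one]

lemma isKer_resolventKer (α : ℝ) {I : Set ℝ} (hI : I ⊆ Ioi 0) : IsKer (resolventKer α I) 1 := by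
  refine ⟨(measurable_resolvent α I).comp (by fun_prop), zero_le_one, fun y => ?_⟩
  calc ∫⁻ x, ‖resolventKer α I x y‖ₑ
      ≤ ∫⁻ x, ∫⁻ s in I, ENNReal.ofReal (Real.exp (-s)) * ENNReal.ofReal (hk (α ^ 2 * s) (x - y)) :=
        lintegral_mono fun x => enorm_resolvent_le α I _
    _ = ∫⁻ s in I, ∫⁻ x,
          ENNReal.ofReal (Real.exp (-s)) * ENNReal.ofReal (hk (α ^ 2 * s) (x - y)) := by
        refine lintegral_lintegral_swap (Measurable.aemeasurable ?_)
        simp only [Function.uncurry_def]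
        fun_prop
    _ ≤ ∫⁻ s in I, ENNReal.ofReal (Real.exp (-s)) := by
        refine lintegral_mono fun s => ?_
        rw [lintegral_const_mul _ (by fun_prop)]
        exact mul_le_of_le_one_right' (lintegral_hk_sub_le _ _)
    _ ≤ ∫⁻ s in Ioi 0, ENNReal.ofReal (Real.exp (-s)) := lintegral_mono_set hI
    _ = ENNReal.ofReal 1 := by rw [lintegral_exp_neg_Ioi, ENNReal.ofReal_one]

/-- The potential `∫ |g(z)| / |x - z| dz`. -/
def rieszPot (g : Plane → ℝ) (x : Plane) : ℝ≥0∞ := ∫⁻ z, ‖g z‖ₑ * ‖x - z‖ₑ⁻¹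

/-- Tonelli reduces the potential to that of a heat kernel at time α²s, which is of order 1/(α√s).
The set I is left free: (0, ∞) bounds the velocity, and (0, r] bounds the error of its
regularisation. -/
lemma rieszPot_resolvent_le {α : ℝ} (hα : 0 < α) {I : Set ℝ} (hI : I ⊆ Ioi 0)
    (hI' : MeasurableSet I) {K : ℝ} (hK : 0 ≤ K)
    (hIK : ∫⁻ s in I, ENNReal.ofReal (Real.exp (-s)) * ENNReal.ofReal (1 / √s) ≤ ENNReal.ofReal K)
    (f : L1) (x : Plane) :
    rieszPot (kerOp (resolventKer α I) f) x ≤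
      ENNReal.ofReal ((discConst + 1) / α * K * ‖f‖) := by
  have hfm : Measurable f := (Lp.stronglyMeasurable f).measurable
  have hD : 0 ≤ discConst + 1 := by linarith [discConst_nonneg]
  calc rieszPot (kerOp (resolventKer α I) f) x
      ≤ ∫⁻ z, (∫⁻ y, ∫⁻ s in I, ENNReal.ofReal (Real.exp (-s)) *
          ENNReal.ofReal (hk (α ^ 2 * s) (z - y)) * ‖f y‖ₑ) * ‖x - z‖ₑ⁻¹ := by
        refine lintegral_mono_ae ?_
        filter_upwards [(isKer_resolventKer α hI).coeFn f] with z hz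
        rw [hz]
        gcongr
        refine (enorm_integral_le_lintegral_enorm _).trans (lintegral_mono fun y => ?_)
        rw [enorm_mul, lintegral_mul_const _ (by fun_prop)]
        gcongr
        exact enorm_resolvent_le α I _
    _ = ∫⁻ z, ∫⁻ y, ∫⁻ s in I, ENNReal.ofReal (Real.exp (-s)) *
          ENNReal.ofReal (hk (α ^ 2 * s) (z - y)) * ‖f y‖ₑ * ‖x - z‖ₑ⁻¹ := by
        refine lintegral_congr fun z => ?_
        rw [← lintegral_mul_const]
        · refine lintegral_congr fun y => ?_
          rw [← lintegral_mul_const _ (by fun_prop)]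
        · exact Measurable.lintegral_prod_right' (ν := volume.restrict I) (f := fun p : Plane × ℝ =>
            ENNReal.ofReal (Real.exp (-p.2)) * ENNReal.ofReal (hk (α ^ 2 * p.2) (z - p.1)) *
              ‖f p.1‖ₑ) (by fun_prop)
    _ = ∫⁻ y, ∫⁻ z, ∫⁻ s in I, ENNReal.ofReal (Real.exp (-s)) *
          ENNReal.ofReal (hk (α ^ 2 * s) (z - y)) * ‖f y‖ₑ * ‖x - z‖ₑ⁻¹ := by
        refine lintegral_lintegral_swap (Measurable.aemeasurable ?_)
        exact Measurable.lintegral_prod_right' (ν := volume.restrict I)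
          (f := fun p : (Plane × Plane) × ℝ =>
            ENNReal.ofReal (Real.exp (-p.2)) * ENNReal.ofReal (hk (α ^ 2 * p.2) (p.1.1 - p.1.2)) *
              ‖f p.1.2‖ₑ * ‖x - p.1.1‖ₑ⁻¹) (by fun_prop)
    _ = ∫⁻ y, ∫⁻ s in I, ∫⁻ z, ENNReal.ofReal (Real.exp (-s)) *
          ENNReal.ofReal (hk (α ^ 2 * s) (z - y)) * ‖f y‖ₑ * ‖x - z‖ₑ⁻¹ := by
        refine lintegral_congr fun y => lintegral_lintegral_swap (Measurable.aemeasurable ?_)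
        simp only [Function.uncurry_def]
        fun_prop
    _ ≤ ∫⁻ y, ∫⁻ s in I, (ENNReal.ofReal (Real.exp (-s)) * ENNReal.ofReal (1 / √s)) *
          (ENNReal.ofReal ((discConst + 1) / α) * ‖f y‖ₑ) := by
        refine lintegral_mono fun y => setLIntegral_mono' hI' fun s hs => ?_
        have hs0 : 0 < s := hI hs
        calc ∫⁻ z, ENNReal.ofReal (Real.exp (-s)) *
              ENNReal.ofReal (hk (α ^ 2 * s) (z - y)) * ‖f y‖ₑ * ‖x - z‖ₑ⁻¹
            = ENNReal.ofReal (Real.exp (-s)) * ‖f y‖ₑ *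
              ∫⁻ z, ‖x - z‖ₑ⁻¹ * ENNReal.ofReal (hk (α ^ 2 * s) (z - y)) := by
              rw [← lintegral_const_mul _ (by fun_prop)]
              exact lintegral_congr fun z => by ring
          _ ≤ ENNReal.ofReal (Real.exp (-s)) * ‖f y‖ₑ *
              ENNReal.ofReal ((discConst + 1) / √(α ^ 2 * s)) := by
              gcongr; exact lintegral_inv_norm_mul_hk_le (by positivity) x y
          _ = _ := by
              rw [Real.sqrt_mul (by positivity), Real.sqrt_sq hα.le,
                show (discConst + 1) / (α * √s) = (1 / √s) * ((discConst + 1) / α) by field_simp,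
                ENNReal.ofReal_mul (by positivity)]
              ring
    _ = (∫⁻ s in I, ENNReal.ofReal (Real.exp (-s)) * ENNReal.ofReal (1 / √s)) *
          (ENNReal.ofReal ((discConst + 1) / α) * ENNReal.ofReal ‖f‖) := by
        rw [← L1.lintegral_enorm, ← lintegral_const_mul _ (by fun_prop),
          ← lintegral_const_mul _ (by fun_prop)]
        exact lintegral_congr fun y => lintegral_mul_const _ (by fun_prop)
    _ ≤ ENNReal.ofReal K * (ENNReal.ofReal ((discConst + 1) / α) * ENNReal.ofReal ‖f‖) := by gcongr
    _ = _ := by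
        rw [← ENNReal.ofReal_mul (by positivity), ← ENNReal.ofReal_mul hK]
        congr 1; ring

lemma lintegral_exp_mul_inv_sqrt_Ioc_le {r : ℝ} (hr : 0 ≤ r) :
    ∫⁻ s in Ioc 0 r, ENNReal.ofReal (Real.exp (-s)) * ENNReal.ofReal (1 / √s) ≤
      ENNReal.ofReal (2 * √r) := by
  have h1 : ∫ s in Ioc 0 r, 1 / √s = 2 * √r := by
    rw [← intervalIntegral.integral_of_le hr]
    have e : ∀ s : ℝ, 1 / √s = s ^ (-(1 / 2) : ℝ) ∨ s < 0 := by
      intro s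
      rcases le_or_gt 0 s with hs | hs
      · left; rw [Real.rpow_neg hs, Real.sqrt_eq_rpow, one_div]
      · right; exact hs
    rw [intervalIntegral.integral_congr (g := fun s => s ^ (-(1 / 2) : ℝ)),
      integral_rpow (Or.inl (by norm_num)), Real.sqrt_eq_rpow]
    · norm_num
      ring
    · intro s hs
      rw [uIcc_of_le hr] at hs
      exact (e s).resolve_right hs.1.not_gt
  rw [← h1, ofReal_integral_eq_lintegral_ofReal (integrableOn_inv_sqrt r)
    (Filter.Eventually.of_forall fun s => by positivity)]
  refine setLIntegral_mono' measurableSet_Ioc fun s hs => mul_le_of_le_one_left' ?_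
  rw [← ENNReal.ofReal_one]
  exact ENNReal.ofReal_le_ofReal (Real.exp_le_one_iff.2 (by linarith [hs.1]))

lemma lintegral_exp_mul_inv_sqrt_Ioi_le :
    ∫⁻ s in Ioi 0, ENNReal.ofReal (Real.exp (-s)) * ENNReal.ofReal (1 / √s) ≤
      ENNReal.ofReal 3 := by
  have h2 : ∫⁻ s in Ioi (1 : ℝ), ENNReal.ofReal (Real.exp (-s)) * ENNReal.ofReal (1 / √s) ≤ 1 := by
    refine le_trans ?_ lintegral_exp_neg_Ioi.le
    refine (setLIntegral_mono' measurableSet_Ioi fun s hs => ?_).trans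
      (lintegral_mono_set (Ioi_subset_Ioi zero_le_one))
    refine mul_le_of_le_one_right' ?_
    rw [← ENNReal.ofReal_one]
    refine ENNReal.ofReal_le_ofReal ?_
    have : 1 ≤ √s := by rw [Real.one_le_sqrt]; exact (show 1 < s from hs).le
    rw [div_le_one (by positivity)]; exact this
  rw [← Ioc_union_Ioi_eq_Ioi zero_le_one]
  refine (lintegral_union_le _ _ _).trans ?_
  refine (add_le_add (lintegral_exp_mul_inv_sqrt_Ioc_le zero_le_one) h2).trans ?_
  rw [← ENNReal.ofReal_one, ← ENNReal.ofReal_add (by positivity) (by positivity)]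
  refine ENNReal.ofReal_le_ofReal (by norm_num)

end VCHE
end

/-! ### The inverse Helmholtz operator on Schwartz functions. -/

noncomputable section

namespace VCHE

open FourierTransform SchwartzMap Complex in
/-- The Fourier transform of a modulated Gaussian is a translated heat kernel. -/
lemma fourier_modulated_gaussian {τ : ℝ} (hτ : 0 < τ) (x y : Plane) :
    𝓕 (fun v : Plane => cexp (-(4 * Real.pi ^ 2 * τ : ℝ) * ‖v‖ ^ 2
      + 2 * Real.pi * Complex.I * (inner ℝ x v : ℝ))) y = (hk τ (x - y) : ℂ) := by
  have hb : 0 < ((4 * Real.pi ^ 2 * τ : ℝ) : ℂ).re := by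
    rw [Complex.ofReal_re]; positivity
  rw [fourier_gaussian_innerProductSpace' hb, hk_of_pos hτ]
  simp only [finrank_euclideanSpace, Fintype.card_fin]
  push_cast
  have hp : (Real.pi : ℂ) ≠ 0 := by exact_mod_cast Real.pi_ne_zero
  have ht : (τ : ℂ) ≠ 0 := by exact_mod_cast hτ.ne'
  rw [show (2 : ℂ) / 2 = 1 by norm_num, Complex.cpow_one]
  congr 1
  · field_simp
  · congr 1; field_simp

/-- The symbol `(1 + 4π²α²|ξ|²)⁻¹` of the inverse Helmholtz operator. -/
def invSymbol (α : ℝ) (ξ : Plane) : ℝ := (1 + (2 * Real.pi * α) ^ 2 * ‖ξ‖ ^ 2)⁻¹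

lemma hasTemperateGrowth_invSymbol (α : ℝ) : (invSymbol α).HasTemperateGrowth := by
  have h1 := Function.hasTemperateGrowth_one_add_norm_sq_rpow Plane (-1)
  have h2 : (fun ξ : Plane => (2 * Real.pi * α) • ξ).HasTemperateGrowth := by fun_prop
  have h3 := h1.comp h2
  refine (congrArg Function.HasTemperateGrowth ?_).mp h3
  ext ξ
  simp only [Function.comp, invSymbol]
  rw [Real.rpow_neg_one, norm_smul, mul_pow, Real.norm_eq_abs, sq_abs]

/-- The identity 1/c = ∫₀^∞ e^{-cs} ds writes the symbol as a superposition of Gaussians. -/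
lemma invSymbol_eq_integral (α : ℝ) (ξ : Plane) :
    invSymbol α ξ = ∫ s in Ioi (0 : ℝ),
      Real.exp (-s) * Real.exp (-(4 * Real.pi ^ 2 * (α ^ 2 * s)) * ‖ξ‖ ^ 2) := by
  have hc : 0 < 1 + (2 * Real.pi * α) ^ 2 * ‖ξ‖ ^ 2 := by positivity
  have e : ∀ s : ℝ, Real.exp (-s) * Real.exp (-(4 * Real.pi ^ 2 * (α ^ 2 * s)) * ‖ξ‖ ^ 2)
      = Real.exp (-(1 + (2 * Real.pi * α) ^ 2 * ‖ξ‖ ^ 2) * s) := by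
    intro s; rw [← Real.exp_add]; congr 1; ring
  simp_rw [e]
  rw [integral_exp_mul_Ioi (by linarith)]
  rw [invSymbol, mul_zero, Real.exp_zero, neg_div_neg_eq, one_div]

section Schwartz

open FourierTransform SchwartzMap Complex

/-- The inverse Helmholtz operator on Schwartz functions. -/
def invHelmholtz (α : ℝ) (ψ : 𝓢(Plane, ℂ)) : 𝓢(Plane, ℂ) :=
  fourierMultiplierCLM ℂ (invSymbol α) ψ

lemma sub_laplacian_eq (α : ℝ) (φ : 𝓢(Plane, ℂ)) :
    φ - α ^ 2 • Δ φ =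
      fourierMultiplierCLM ℂ (fun ξ : Plane => 1 + (2 * Real.pi * α) ^ 2 * ‖ξ‖ ^ 2) φ := by
  have e : (fun ξ : Plane => 1 + (2 * Real.pi * α) ^ 2 * ‖ξ‖ ^ 2)
      = (fun _ => 1) + (2 * Real.pi * α) ^ 2 • fun ξ : Plane => ‖ξ‖ ^ 2 := rfl
  rw [laplacian_eq_fourierMultiplierCLM, e]
  simp only [fourierMultiplierCLM_apply]
  rw [smulLeftCLM_add (by fun_prop) (by fun_prop), smulLeftCLM_smul (by fun_prop)]
  simp only [smulLeftCLM_const]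
  simp only [one_smul, _root_.smul_apply, _root_.add_apply, ContinuousLinearMap.id_apply,
    FourierTransform.fourierInv_add, FourierTransform.fourierInv_smul, fourierInv_fourier_eq,
    neg_smul, smul_neg, sub_neg_eq_add, smul_smul]
  congr 2
  ring

/-- Both orders of composition are needed: this one produces solutions of the Helmholtz equation,
the reverse one proves their uniqueness. -/
lemma invHelmholtz_sub_laplacian (α : ℝ) (φ : 𝓢(Plane, ℂ)) :
    invHelmholtz α (φ - α ^ 2 • Δ φ) = φ := by
  rw [sub_laplacian_eq, invHelmholtz, fourierMultiplierCLM_fourierMultiplierCLM_apply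
    (hasTemperateGrowth_invSymbol α) (by fun_prop)]
  have e : (invSymbol α * fun ξ : Plane => 1 + (2 * Real.pi * α) ^ 2 * ‖ξ‖ ^ 2) = fun _ => 1 := by
    ext ξ
    have hc : 0 < 1 + (2 * Real.pi * α) ^ 2 * ‖ξ‖ ^ 2 := by positivity
    simp [invSymbol, hc.ne']
  rw [e, fourierMultiplierCLM_const]
  simp

lemma sub_laplacian_invHelmholtz (α : ℝ) (ψ : 𝓢(Plane, ℂ)) :
    invHelmholtz α ψ - α ^ 2 • Δ (invHelmholtz α ψ) = ψ := by
  rw [sub_laplacian_eq, invHelmholtz, fourierMultiplierCLM_fourierMultiplierCLM_apply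
    (by fun_prop) (hasTemperateGrowth_invSymbol α)]
  have e : ((fun ξ : Plane => 1 + (2 * Real.pi * α) ^ 2 * ‖ξ‖ ^ 2) * invSymbol α) = fun _ => 1 := by
    ext ξ
    have hc : 0 < 1 + (2 * Real.pi * α) ^ 2 * ‖ξ‖ ^ 2 := by positivity
    simp [invSymbol, hc.ne']
  rw [e, fourierMultiplierCLM_const]
  simp

/-- The Fourier transform is moved from ψ onto the modulated Gaussian, whose transform is a
translated heat kernel. -/
lemma integral_gaussian_mul_fourier {τ : ℝ} (hτ : 0 < τ) (ψ : 𝓢(Plane, ℂ)) (x : Plane) :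
    ∫ ξ, cexp (-(4 * Real.pi ^ 2 * τ : ℝ) * ‖ξ‖ ^ 2
      + 2 * Real.pi * Complex.I * (inner ℝ x ξ : ℝ)) • 𝓕 ψ ξ = ∫ y, (hk τ (x - y) : ℂ) • ψ y := by
  set g : Plane → ℂ := fun ξ => cexp (-(4 * Real.pi ^ 2 * τ : ℝ) * ‖ξ‖ ^ 2
      + 2 * Real.pi * Complex.I * (inner ℝ x ξ : ℝ)) with hg
  have hgi : Integrable g := by
    have := GaussianFourier.integrable_cexp_neg_mul_sq_norm_add (V := Plane)
      (b := (4 * Real.pi ^ 2 * τ : ℝ)) (by rw [Complex.ofReal_re]; positivity)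
      (2 * Real.pi * Complex.I) x
    exact this
  have h := VectorFourier.integral_fourierIntegral_smul_eq_flip (μ := volume) (ν := volume)
    (L := innerₗ Plane) (f := g) (g := (ψ : Plane → ℂ)) Real.continuous_fourierChar
    continuous_inner hgi ψ.integrable
  rw [flip_innerₗ] at h
  have e2 : ∀ y, VectorFourier.fourierIntegral Real.fourierChar volume (innerₗ Plane) g y
      = (hk τ (x - y) : ℂ) := fun y => fourier_modulated_gaussian hτ x y
  simp_rw [e2] at h
  exact h.symm

lemma invHelmholtz_apply {α : ℝ} (hα : 0 < α) (ψ : 𝓢(Plane, ℂ)) (x : Plane) :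
    invHelmholtz α ψ x =
      ∫ s in Ioi (0 : ℝ), (Real.exp (-s) : ℂ) • ∫ y, (hk (α ^ 2 * s) (x - y) : ℂ) • ψ y := by
  have e0 : ∀ ξ, (Real.fourierChar (inner ℝ ξ x) • ((invSymbol α ξ) • 𝓕 ψ ξ) : ℂ) =
      ∫ s in Ioi (0 : ℝ), (Real.exp (-s) : ℂ) •
        (cexp (-(4 * Real.pi ^ 2 * (α ^ 2 * s) : ℝ) * ‖ξ‖ ^ 2
          + 2 * Real.pi * Complex.I * (inner ℝ x ξ : ℝ)) • 𝓕 ψ ξ) := by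
    intro ξ
    have e1 : ∀ s : ℝ, (Real.exp (-s) : ℂ) •
        (cexp (-(4 * Real.pi ^ 2 * (α ^ 2 * s) : ℝ) * ‖ξ‖ ^ 2
          + 2 * Real.pi * Complex.I * (inner ℝ x ξ : ℝ)) • 𝓕 ψ ξ) =
        (Real.exp (-s) * Real.exp (-(4 * Real.pi ^ 2 * (α ^ 2 * s)) * ‖ξ‖ ^ 2)) •
          (Real.fourierChar (inner ℝ ξ x) • 𝓕 ψ ξ : ℂ) := by
      intro s
      rw [Complex.exp_add, Circle.smul_def, Real.fourierChar_apply, real_inner_comm]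
      simp only [Complex.real_smul, smul_eq_mul]
      push_cast
      ring_nf
    simp_rw [e1]
    rw [integral_smul_const, ← invSymbol_eq_integral, smul_comm]
  rw [invHelmholtz, fourierMultiplierCLM_apply, fourierInv_coe, Real.fourierInv_eq]
  simp_rw [smulLeftCLM_apply_apply (hasTemperateGrowth_invSymbol α), e0]
  rw [integral_integral_swap]
  · refine setIntegral_congr_fun measurableSet_Ioi fun s hs => ?_
    rw [integral_smul, integral_gaussian_mul_fourier (mul_pos (by positivity) hs)]
  · have h1 : Integrable (fun p : Plane × ℝ => ‖𝓕 ψ p.1‖ * Real.exp (-p.2))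
        (volume.prod (volume.restrict (Ioi 0))) :=
      (𝓕 ψ).integrable.norm.mul_prod (integrableOn_exp_neg_Ioi 0)
    refine h1.mono' ?_ ?_
    · have hc := (𝓕 ψ).continuous
      refine Continuous.aestronglyMeasurable ?_
      simp only [Function.uncurry_def]
      fun_prop
    · have h2 : ∀ᵐ p ∂((volume : Measure Plane).prod (volume.restrict (Ioi (0 : ℝ)))),
          p.2 ∈ Ioi (0 : ℝ) :=
        Measure.quasiMeasurePreserving_snd.ae (ae_restrict_mem measurableSet_Ioi)
      filter_upwards [h2] with p hp
      simp only [Function.uncurry_def, norm_smul, Complex.norm_exp, Complex.norm_real]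
      rw [Real.norm_of_nonneg (Real.exp_nonneg _), mul_comm (Real.exp _)]
      refine mul_le_mul_of_nonneg_right (mul_le_of_le_one_left (norm_nonneg _) ?_)
        (Real.exp_nonneg _)
      rw [Real.exp_le_one_iff]
      have hp0 : 0 < p.2 := hp
      have e3 : (-((4 * Real.pi ^ 2 * (α ^ 2 * p.2) : ℝ) : ℂ) * (‖p.1‖ : ℂ) ^ 2 +
          2 * Real.pi * Complex.I * ((inner ℝ x p.1 : ℝ) : ℂ)).re
          = -(4 * Real.pi ^ 2 * (α ^ 2 * p.2) * ‖p.1‖ ^ 2) := by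
        rw [show (2 * (Real.pi : ℂ) * Complex.I * ((inner ℝ x p.1 : ℝ) : ℂ))
            = ((2 * Real.pi * inner ℝ x p.1 : ℝ) : ℂ) * Complex.I by push_cast; ring,
          Complex.add_re, ← Complex.ofReal_neg, ← Complex.ofReal_pow, ← Complex.ofReal_mul,
          Complex.ofReal_re, Complex.re_ofReal_mul, Complex.I_re]
        ring
      rw [e3, neg_nonpos]
      positivity

end Schwartz

end VCHE
end

/-! ### The Helmholtz equation in L¹: existence. -/

noncomputable section

namespace VCHE

section Existence

open SchwartzMap

/-- A real test function as a complex Schwartz function. -/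
def toSchwartzC {φ : Plane → ℝ} (hφ : ContDiff ℝ (⊤ : ℕ∞) φ) (hc : HasCompactSupport φ) :
    𝓢(Plane, ℂ) :=
  HasCompactSupport.toSchwartzMap (f := Complex.ofRealCLM ∘ φ) (hc.comp_left (by simp))
    (Complex.ofRealCLM.contDiff.comp hφ)

lemma toSchwartzC_apply {φ : Plane → ℝ} (hφ : ContDiff ℝ (⊤ : ℕ∞) φ) (hc : HasCompactSupport φ)
    (x : Plane) : toSchwartzC hφ hc x = (φ x : ℂ) := rfl

lemma toSchwartzC_sub_laplacian {φ : Plane → ℝ} (hφ : ContDiff ℝ (⊤ : ℕ∞) φ)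
    (hc : HasCompactSupport φ) (α : ℝ) (x : Plane) :
    (toSchwartzC hφ hc - α ^ 2 • Δ (toSchwartzC hφ hc)) x = ((φ x - α ^ 2 * Δ φ x : ℝ) : ℂ) := by
  have h := ContDiffAt.laplacian_CLM_comp_left (l := Complex.ofRealCLM) (f := φ) (x := x)
    ((contDiff_infty.1 hφ 2).contDiffAt)
  rw [_root_.sub_apply, _root_.smul_apply, SchwartzMap.laplacian_apply,
    toSchwartzC_apply, show (⇑(toSchwartzC hφ hc)) = Complex.ofRealCLM ∘ φ from rfl, h]
  simp

lemma resolvent_neg (α : ℝ) (I : Set ℝ) (x : Plane) : resolvent α I (-x) = resolvent α I x := by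
  simp [resolvent, hk_neg]

lemma exists_bound_schwartz (ψ : 𝓢(Plane, ℂ)) : ∃ C, 0 ≤ C ∧ ∀ x, ‖ψ x‖ ≤ C := by
  obtain ⟨C, hC, h⟩ := ψ.decay 0 0
  exact ⟨C, hC.le, fun x => by simpa using h x⟩

lemma continuous_sub_laplacian {φ : Plane → ℝ} (hφ : ContDiff ℝ (⊤ : ℕ∞) φ)
    (hc : HasCompactSupport φ) (α : ℝ) : Continuous fun x => φ x - α ^ 2 * Δ φ x := by
  have h := Complex.continuous_re.comp
    (toSchwartzC hφ hc - α ^ 2 • Δ (toSchwartzC hφ hc)).continuous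
  refine h.congr fun x => ?_
  simp only [Function.comp, toSchwartzC_sub_laplacian, Complex.ofReal_re]

lemma exists_bound_sub_laplacian {φ : Plane → ℝ} (hφ : ContDiff ℝ (⊤ : ℕ∞) φ)
    (hc : HasCompactSupport φ) (α : ℝ) : ∃ C, 0 ≤ C ∧ ∀ x, ‖φ x - α ^ 2 * Δ φ x‖ ≤ C := by
  obtain ⟨C, hC, h⟩ := exists_bound_schwartz (toSchwartzC hφ hc - α ^ 2 • Δ (toSchwartzC hφ hc))
  refine ⟨C, hC, fun x => ?_⟩
  have := h x
  rwa [toSchwartzC_sub_laplacian, Complex.norm_real] at this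

/-- `resolvent α (Ioi 0)` is the fundamental solution of `1 - α² Δ`. -/
lemma integral_resolvent_mul {α : ℝ} (hα : 0 < α) {φ : Plane → ℝ}
    (hφ : ContDiff ℝ (⊤ : ℕ∞) φ) (hc : HasCompactSupport φ) (x : Plane) :
    ∫ y, resolvent α (Ioi 0) (x - y) * (φ y - α ^ 2 * Δ φ y) = φ x := by
  have h1 := invHelmholtz_apply hα (toSchwartzC hφ hc - α ^ 2 • Δ (toSchwartzC hφ hc)) x
  rw [invHelmholtz_sub_laplacian, toSchwartzC_apply] at h1
  simp_rw [toSchwartzC_sub_laplacian hφ hc α] at h1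
  obtain ⟨C, hC, hb⟩ := exists_bound_sub_laplacian hφ hc α
  have hcont := continuous_sub_laplacian hφ hc α
  set ψ : Plane → ℝ := fun y => φ y - α ^ 2 * Δ φ y with hψ
  change (φ x : ℂ) = ∫ s in Ioi (0 : ℝ), (Real.exp (-s) : ℂ) •
    ∫ y, (hk (α ^ 2 * s) (x - y) : ℂ) • ((ψ y : ℝ) : ℂ) at h1
  simp only [smul_eq_mul, ← Complex.ofReal_mul, integral_complex_ofReal] at h1
  rw [Complex.ofReal_inj] at h1
  rw [h1]
  change ∫ y, resolvent α (Ioi 0) (x - y) * ψ y = _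
  simp_rw [resolvent, ← integral_mul_const, ← integral_const_mul]
  rw [integral_integral_swap]
  · simp_rw [mul_assoc]
  · have hm : Measurable (Function.uncurry fun (y : Plane) (s : ℝ) =>
        Real.exp (-s) * hk (α ^ 2 * s) (x - y) * ψ y) := by
      have := hcont.measurable
      simp only [Function.uncurry_def]
      fun_prop
    refine ⟨hm.aestronglyMeasurable, ?_⟩
    rw [HasFiniteIntegral, lintegral_prod_symm _ hm.enorm.aemeasurable]
    refine lt_of_le_of_lt (b := ∫⁻ s in Ioi (0 : ℝ), ENNReal.ofReal (Real.exp (-s)) *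
      ENNReal.ofReal C) (setLIntegral_mono' measurableSet_Ioi fun s hs => ?_) ?_
    · have hs' : 0 < α ^ 2 * s := mul_pos (by positivity) hs
      calc ∫⁻ y, ‖Function.uncurry (fun (y : Plane) (s : ℝ) =>
              Real.exp (-s) * hk (α ^ 2 * s) (x - y) * ψ y) (y, s)‖ₑ
          ≤ ∫⁻ y, ENNReal.ofReal (Real.exp (-s)) * ENNReal.ofReal C *
              ENNReal.ofReal (hk (α ^ 2 * s) (x - y)) := by
            refine lintegral_mono fun y => ?_
            simp only [Function.uncurry_def, enorm_mul]
            rw [Real.enorm_of_nonneg (Real.exp_nonneg _), Real.enorm_of_nonneg (hk_nonneg _ _),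
              mul_right_comm]
            gcongr
            rw [← ofReal_norm]
            exact ENNReal.ofReal_le_ofReal (hb y)
        _ = _ := by rw [lintegral_const_mul _ (by fun_prop), lintegral_hk_sub_left hs', mul_one]
    · rw [lintegral_mul_const _ (by fun_prop), lintegral_exp_neg_Ioi, one_mul]
      exact ENNReal.ofReal_lt_top

/-- By Fubini and the evenness of the kernel, the convolution moves onto the test function, where it
inverts 1 - α²Δ. -/
theorem isHelmholtzSolution_kerOp {α : ℝ} (hα : 0 < α) (f : L1) :
    IsHelmholtzSolution α f (kerOp (resolventKer α (Ioi 0)) f) := by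
  intro φ hφ hc
  have hk := isKer_resolventKer α (subset_refl (Ioi (0 : ℝ)))
  obtain ⟨C, hC, hb⟩ := exists_bound_sub_laplacian hφ hc α
  have hcont := continuous_sub_laplacian hφ hc α
  calc ∫ x, kerOp (resolventKer α (Ioi 0)) f x * (φ x - α ^ 2 * Δ φ x)
      = ∫ x, ∫ y, resolventKer α (Ioi 0) x y * f y * (φ x - α ^ 2 * Δ φ x) := by
        refine integral_congr_ae ?_
        filter_upwards [hk.coeFn f] with x hx
        rw [hx, integral_mul_const]
    _ = ∫ y, ∫ x, resolventKer α (Ioi 0) x y * f y * (φ x - α ^ 2 * Δ φ x) := by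
        refine integral_integral_swap ?_
        refine (hk.integrable_prod f).mul_bdd (c := C) ?_ ?_
        · exact (hcont.comp continuous_fst).aestronglyMeasurable
        · exact Filter.Eventually.of_forall fun p => hb p.1
    _ = ∫ y, f y * φ y := by
        refine integral_congr_ae (Filter.Eventually.of_forall fun y => ?_)
        simp only
        rw [← integral_resolvent_mul hα hφ hc y, ← integral_const_mul]
        refine integral_congr_ae (Filter.Eventually.of_forall fun x => ?_)
        simp only [resolventKer]
        rw [← neg_sub, resolvent_neg]
        ring

end Existence

/-! ### The Helmholtz equation in L¹: uniqueness. -/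

section Uniqueness

open SchwartzMap

lemma norm_laplacian_le (f : Plane → ℝ) (x : Plane) : ‖Δ f x‖ ≤ 2 * ‖iteratedFDeriv ℝ 2 f x‖ := by
  rw [InnerProductSpace.laplacian_eq_iteratedFDeriv_stdOrthonormalBasis]
  refine (norm_sum_le _ _).trans ?_
  have h : ∀ i, ‖iteratedFDeriv ℝ 2 f x ![(stdOrthonormalBasis ℝ Plane) i,
      (stdOrthonormalBasis ℝ Plane) i]‖ ≤ ‖iteratedFDeriv ℝ 2 f x‖ := by
    intro i
    refine (ContinuousMultilinearMap.le_opNorm _ _).trans ?_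
    simp
  refine (Finset.sum_le_sum fun i _ => h i).trans ?_
  simp

lemma norm_iteratedFDeriv_comp_smul_le {f : Plane → ℝ} (hf : ContDiff ℝ (⊤ : ℕ∞) f) {C c : ℝ}
    (hc : |c| ≤ 1) {k : ℕ} (hC : ∀ x, ‖iteratedFDeriv ℝ k f x‖ ≤ C) (x : Plane) :
    ‖iteratedFDeriv ℝ k (fun y => f (c • y)) x‖ ≤ C := by
  have h := ContinuousLinearMap.iteratedFDeriv_comp_right
    (c • ContinuousLinearMap.id ℝ Plane) hf x (i := k) (by exact_mod_cast le_top)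
  have e : f ∘ (c • ContinuousLinearMap.id ℝ Plane) = fun y => f (c • y) := by ext; simp
  rw [e] at h
  rw [h]
  refine (ContinuousMultilinearMap.norm_compContinuousLinearMap_le _ _).trans ?_
  have h1 : ‖c • ContinuousLinearMap.id ℝ Plane‖ ≤ 1 := by
    rw [norm_smul, Real.norm_eq_abs]
    exact mul_le_one₀ hc (norm_nonneg _) ContinuousLinearMap.norm_id_le
  rw [Finset.prod_const]
  exact (mul_le_of_le_one_right (norm_nonneg _) (pow_le_one₀ (norm_nonneg _) h1)).trans (hC _)

/-- A smooth cutoff, equal to one on the unit disc. -/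
def cutoff : ContDiffBump (0 : Plane) := ⟨1, 2, one_pos, one_lt_two⟩

lemma exists_bound_cutoff (k : ℕ) : ∃ C, 0 ≤ C ∧ ∀ x, ‖iteratedFDeriv ℝ k cutoff x‖ ≤ C := by
  obtain ⟨C, hC, h⟩ := (cutoff.hasCompactSupport.toSchwartzMap cutoff.contDiff).decay 0 k
  refine ⟨C, hC.le, fun x => ?_⟩
  have := h x
  rwa [pow_zero, one_mul] at this

/-- The homogeneous Helmholtz equation can be tested with bounded smooth functions. -/
lemma integral_mul_sub_laplacian_eq_zero {α : ℝ} {g : L1} (hg : IsHelmholtzSolution α 0 g)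
    {φ : Plane → ℝ} (hφ : ContDiff ℝ (⊤ : ℕ∞) φ)
    (hb : ∀ k, ∃ C, 0 ≤ C ∧ ∀ x, ‖iteratedFDeriv ℝ k φ x‖ ≤ C) :
    ∫ x, g x * (φ x - α ^ 2 * Δ φ x) = 0 := by
  choose A hA0 hA using hb
  choose B hB0 hB using exists_bound_cutoff
  -- Widening cutoffs with derivatives bounded uniformly in n. Near a given point the product
  -- eventually equals φ, so dominated convergence against g ∈ L¹ needs no decay of the cutoff
  -- terms.
  set χ : ℕ → Plane → ℝ := fun n x => cutoff (((n : ℝ) + 1)⁻¹ • x) with hχ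
  have hcut : ContDiff ℝ (⊤ : ℕ∞) cutoff := cutoff.contDiff
  have hχs : ∀ n, ContDiff ℝ (⊤ : ℕ∞) (χ n) := fun n =>
    hcut.comp (contDiff_const_smul _)
  have hc1 : ∀ n : ℕ, |((n : ℝ) + 1)⁻¹| ≤ 1 := by
    intro n
    rw [abs_of_nonneg (by positivity)]
    exact inv_le_one_of_one_le₀ (by linarith [n.cast_nonneg (α := ℝ)])
  have hχB : ∀ n k x, ‖iteratedFDeriv ℝ k (χ n) x‖ ≤ B k := fun n k x =>
    norm_iteratedFDeriv_comp_smul_le hcut (hc1 n) (hB k) x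
  have hps : ∀ n, ContDiff ℝ (⊤ : ℕ∞) fun y => χ n y * φ y := fun n => (hχs n).mul hφ
  have hpc : ∀ n, HasCompactSupport fun y => χ n y * φ y := by
    intro n
    refine HasCompactSupport.mul_right ?_
    exact cutoff.hasCompactSupport.comp_smul (by positivity)
  have hpb : ∀ n k x, ‖iteratedFDeriv ℝ k (fun y => χ n y * φ y) x‖ ≤
      ∑ i ∈ Finset.range (k + 1), (k.choose i) * B i * A (k - i) := by
    intro n k x
    refine (norm_iteratedFDeriv_mul_le (hχs n) hφ x (by exact_mod_cast le_top)).trans ?_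
    refine Finset.sum_le_sum fun i _ => ?_
    have := hB0 i
    gcongr
    · exact hχB n i x
    · exact hA _ x
  have hz : ∀ n, ∫ x, g x * (χ n x * φ x - α ^ 2 * Δ (fun y => χ n y * φ y) x) = 0 := by
    intro n
    rw [hg _ (hps n) (hpc n)]
    refine integral_eq_zero_of_ae ?_
    filter_upwards [Lp.coeFn_zero ℝ 1 (volume : Measure Plane)] with x hx
    rw [hx]; simp
  set S : ℕ → ℝ := fun k => ∑ i ∈ Finset.range (k + 1), (k.choose i) * B i * A (k - i)
  have hlim := tendsto_integral_of_dominated_convergence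
    (F := fun n x => g x * (χ n x * φ x - α ^ 2 * Δ (fun y => χ n y * φ y) x))
    (f := fun x => g x * (φ x - α ^ 2 * Δ φ x)) (μ := volume)
    (fun x => ‖g x‖ * (S 0 + α ^ 2 * (2 * S 2))) (fun n => ?_)
    ((L1.integrable g).norm.mul_const _) (fun n => Filter.Eventually.of_forall fun x => ?_)
    (Filter.Eventually.of_forall fun x => ?_)
  · simp_rw [hz] at hlim
    exact (tendsto_nhds_unique hlim tendsto_const_nhds)
  · exact (Lp.aestronglyMeasurable g).mul
      (continuous_sub_laplacian (hps n) (hpc n) α).aestronglyMeasurable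
  · rw [norm_mul]
    gcongr
    refine (norm_sub_le _ _).trans (add_le_add ?_ ?_)
    · have := hpb n 0 x
      rwa [norm_iteratedFDeriv_zero] at this
    · rw [norm_mul, Real.norm_of_nonneg (by positivity : 0 ≤ α ^ 2)]
      gcongr
      refine (norm_laplacian_le _ x).trans ?_
      gcongr
      exact hpb n 2 x
  · refine tendsto_const_nhds.congr' ?_
    obtain ⟨N, hN⟩ := exists_nat_gt ‖x‖
    filter_upwards [Filter.eventually_ge_atTop N] with n hn
    have hnx : ‖x‖ < (n : ℝ) + 1 := by
      have : (N : ℝ) ≤ n := by exact_mod_cast hn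
      linarith
    have hev : (fun y => χ n y * φ y) =ᶠ[nhds x] φ := by
      filter_upwards [Metric.isOpen_ball.mem_nhds
        (show x ∈ Metric.ball (0 : Plane) ((n : ℝ) + 1) by simpa using hnx)] with y hy
      have : χ n y = 1 := by
        refine cutoff.one_of_mem_closedBall ?_
        rw [mem_closedBall_zero_iff, norm_smul, Real.norm_of_nonneg (by positivity)]
        change _ ≤ (1 : ℝ)
        rw [inv_mul_le_iff₀ (by positivity), mul_one]
        exact (mem_ball_zero_iff.1 hy).le
      rw [this, one_mul]
    rw [(InnerProductSpace.laplacian_congr_nhds hev).eq_of_nhds, hev.eq_of_nhds]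

/-- Duality: a test function ψ equals (1 - α²Δ)Φ for a Schwartz function Φ. Since Φ need not have
compact support, the equation must first be extended to bounded smooth functions. -/
lemma eq_zero_of_isHelmholtzSolution {α : ℝ} {g : L1}
    (hg : IsHelmholtzSolution α 0 g) : g = 0 := by
  have hz : ∀ᵐ x, g x = 0 := by
    refine ae_eq_zero_of_integral_contDiff_smul_eq_zero (L1.integrable g).locallyIntegrable
      fun ψ hψ hc => ?_
    set Φ := invHelmholtz α (toSchwartzC hψ hc) with hΦ
    have hs : ContDiff ℝ (⊤ : ℕ∞) (Complex.reCLM ∘ Φ) :=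
      Complex.reCLM.contDiff.comp (Φ.smooth _)
    have h := integral_mul_sub_laplacian_eq_zero hg hs fun k => by
      obtain ⟨C, hC, h⟩ := Φ.decay 0 k
      refine ⟨‖Complex.reCLM‖ * C, by positivity, fun x => ?_⟩
      refine (ContinuousLinearMap.norm_iteratedFDeriv_comp_left _ (Φ.smooth ⊤).contDiffAt
        (by exact_mod_cast le_top)).trans ?_
      gcongr
      simpa using h x
    rw [← h]
    refine integral_congr_ae (Filter.Eventually.of_forall fun x => ?_)
    have e := congrArg (fun F : 𝓢(Plane, ℂ) => (F x).re)
      (sub_laplacian_invHelmholtz α (toSchwartzC hψ hc))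
    have hl := ContDiffAt.laplacian_CLM_comp_left (l := Complex.reCLM) (f := Φ) (x := x)
      ((Φ.smooth 2).contDiffAt)
    simp only [_root_.sub_apply, _root_.smul_apply, SchwartzMap.laplacian_apply,
      toSchwartzC_apply, Complex.ofReal_re, Complex.sub_re, Complex.smul_re, ← hΦ] at e
    simp only [hl, ← e, smul_eq_mul, Function.comp, Complex.reCLM_apply]
    ring
  refine Lp.ext ?_
  filter_upwards [hz, Lp.coeFn_zero ℝ 1 (volume : Measure Plane)] with x h1 h2
  rw [h1, h2, Pi.zero_apply]

theorem IsHelmholtzSolution.unique {α : ℝ} {f g g' : L1} (hg : IsHelmholtzSolution α f g)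
    (hg' : IsHelmholtzSolution α f g') : g = g' := by
  rw [← sub_eq_zero]
  refine eq_zero_of_isHelmholtzSolution (α := α) fun φ hφ hc => ?_
  obtain ⟨C, hC, hb⟩ := exists_bound_sub_laplacian hφ hc α
  have hcont := continuous_sub_laplacian hφ hc α
  have hi : ∀ k : L1, Integrable fun x => k x * (φ x - α ^ 2 * Δ φ x) := fun k =>
    (L1.integrable k).mul_bdd (c := C) hcont.aestronglyMeasurable
      (Filter.Eventually.of_forall hb)
  have e1 : ∫ x, (g - g') x * (φ x - α ^ 2 * Δ φ x) = 0 := by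
    calc _ = ∫ x, (g x * (φ x - α ^ 2 * Δ φ x) - g' x * (φ x - α ^ 2 * Δ φ x)) := by
          refine integral_congr_ae ?_
          filter_upwards [Lp.coeFn_sub g g'] with x hx
          rw [hx, Pi.sub_apply, sub_mul]
      _ = 0 := by rw [integral_sub (hi g) (hi g'), hg φ hφ hc, hg' φ hφ hc, sub_self]
  rw [e1]
  refine (integral_eq_zero_of_ae ?_).symm
  filter_upwards [Lp.coeFn_zero ℝ 1 (volume : Measure Plane)] with x hx
  rw [hx]; simp

theorem helmholtz_eq {α : ℝ} (hα : 0 < α) (f : L1) :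
    helmholtz α f = kerOp (resolventKer α (Ioi 0)) f :=
  IsHelmholtzSolution.unique
    (Classical.epsilon_spec (p := IsHelmholtzSolution α f) ⟨_, isHelmholtzSolution_kerOp hα f⟩)
    (isHelmholtzSolution_kerOp hα f)

end Uniqueness

end VCHE
end

/-! ### The Biot–Savart operator and the velocity. -/

noncomputable section

namespace VCHE

lemma norm_perp (x : Plane) : ‖perp x‖ = ‖x‖ := by
  simp [EuclideanSpace.norm_eq, perp, add_comm]

lemma continuous_perp : Continuous perp := by
  unfold perp; fun_prop

/-- The Biot-Savart kernel, without its normalising factor. -/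
def bsKer (x : Plane) : Plane := (1 / ‖x‖ ^ 2) • perp x

lemma measurable_bsKer : Measurable bsKer := by
  have := continuous_perp.measurable
  unfold bsKer
  fun_prop

@[fun_prop]
lemma Measurable.bsKer {ι : Type*} [MeasurableSpace ι] {g : ι → Plane} (hg : Measurable g) :
    Measurable fun i => bsKer (g i) := measurable_bsKer.comp hg

lemma enorm_bsKer_le (x : Plane) : ‖bsKer x‖ₑ ≤ ‖x‖ₑ⁻¹ := by
  by_cases h : x = 0
  · simp [h]
  · have h0 : 0 < ‖x‖ := norm_pos_iff.2 h
    rw [← ofReal_norm, bsKer, norm_smul, norm_perp, ← ofReal_norm,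
      ← ENNReal.ofReal_inv_of_pos h0]
    refine ENNReal.ofReal_le_ofReal (le_of_eq ?_)
    rw [Real.norm_of_nonneg (by positivity)]
    field_simp

lemma biotSavart_eq (g : Plane → ℝ) (x : Plane) :
    biotSavart g x = (1 / (2 * Real.pi)) • ∫ y, g y • bsKer (x - y) := by
  unfold biotSavart bsKer
  congr 2
  ext1 y
  rw [smul_smul]
  congr 1
  ring

lemma biotSavart_congr {g g' : Plane → ℝ} (h : g =ᵐ[volume] g') : biotSavart g = biotSavart g' := by
  ext1 x
  rw [biotSavart_eq, biotSavart_eq]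
  congr 1
  refine integral_congr_ae ?_
  filter_upwards [h] with y hy
  rw [hy]

lemma enorm_smul_bsKer_le (g : Plane → ℝ) (x y : Plane) :
    ‖g y • bsKer (x - y)‖ₑ ≤ ‖g y‖ₑ * ‖x - y‖ₑ⁻¹ := by
  rw [enorm_smul]
  gcongr
  exact enorm_bsKer_le _

lemma integrable_smul_bsKer {g : Plane → ℝ} (hg : AEStronglyMeasurable g) {x : Plane}
    (hx : rieszPot g x ≠ ⊤) : Integrable fun y => g y • bsKer (x - y) := by
  have hm : Measurable fun y => bsKer (x - y) := by fun_prop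
  exact ⟨hg.smul hm.aestronglyMeasurable, lt_of_le_of_lt
    (lintegral_mono fun y => enorm_smul_bsKer_le g x y) hx.lt_top⟩

lemma norm_biotSavart_le {g : Plane → ℝ} {x : Plane} {K : ℝ} (hK : 0 ≤ K)
    (hx : rieszPot g x ≤ ENNReal.ofReal K) : ‖biotSavart g x‖ ≤ K := by
  have h1 : ‖∫ y, g y • bsKer (x - y)‖ₑ ≤ ENNReal.ofReal K :=
    (enorm_integral_le_lintegral_enorm _).trans
      ((lintegral_mono fun y => enorm_smul_bsKer_le g x y).trans hx)
  rw [← ofReal_norm, ENNReal.ofReal_le_ofReal_iff hK] at h1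
  rw [biotSavart_eq, norm_smul, Real.norm_of_nonneg (by positivity)]
  refine (mul_le_of_le_one_left (norm_nonneg _) ?_).trans h1
  rw [div_le_one (by positivity)]
  nlinarith [Real.pi_gt_three]

lemma biotSavart_sub {g g' : Plane → ℝ} (hg : AEStronglyMeasurable g)
    (hg' : AEStronglyMeasurable g') {x : Plane} (h : rieszPot g x ≠ ⊤) (h' : rieszPot g' x ≠ ⊤) :
    biotSavart (g - g') x = biotSavart g x - biotSavart g' x := by
  rw [biotSavart_eq, biotSavart_eq, biotSavart_eq, ← smul_sub,
    ← integral_sub (integrable_smul_bsKer hg h) (integrable_smul_bsKer hg' h')]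
  simp_rw [Pi.sub_apply, sub_smul]

lemma measurable_biotSavart (g : L1) : Measurable (biotSavart g) := by
  have hg : Measurable g := (Lp.stronglyMeasurable g).measurable
  have h : Measurable fun p : Plane × Plane => g p.2 • bsKer (p.1 - p.2) := by fun_prop
  have := (h.stronglyMeasurable.integral_prod_right' (ν := volume)).measurable.const_smul
    (1 / (2 * Real.pi))
  refine (congrArg Measurable ?_).mp this
  ext1 x
  rw [biotSavart_eq, Pi.smul_apply]

/-- The bound for the velocity field generated by a vorticity of unit mass. -/
def velocityBound (α : ℝ) : ℝ := 3 * ((discConst + 1) / α)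

lemma velocityBound_nonneg {α : ℝ} (hα : 0 < α) : 0 ≤ velocityBound α := by
  have := discConst_nonneg
  unfold velocityBound
  positivity

lemma rieszPot_helmholtz_le {α : ℝ} (hα : 0 < α) (f : L1) (x : Plane) :
    rieszPot (helmholtz α f) x ≤ ENNReal.ofReal (velocityBound α * ‖f‖) := by
  rw [helmholtz_eq hα, velocityBound]
  refine (rieszPot_resolvent_le hα (subset_refl _) measurableSet_Ioi zero_le_three
    lintegral_exp_mul_inv_sqrt_Ioi_le f x).trans (ENNReal.ofReal_le_ofReal (le_of_eq ?_))
  ring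

/-- The Riesz potential of the filtered vorticity is finite at every point, so the velocity is
linear and bounded everywhere, not merely almost everywhere. -/
lemma isDrift_velocity {α : ℝ} (hα : 0 < α) : IsDrift (velocity α) (velocityBound α) where
  meas f := measurable_biotSavart _
  nonneg := velocityBound_nonneg hα
  map_sub f g := by
    have h : helmholtz α (f - g) =ᵐ[volume] (helmholtz α f : Plane → ℝ) - helmholtz α g := by
      rw [helmholtz_eq hα, helmholtz_eq hα, helmholtz_eq hα,
        (isKer_resolventKer α (subset_refl _)).map_sub]
      exact Lp.coeFn_sub _ _
    intro x
    rw [velocity, biotSavart_congr h, biotSavart_sub (Lp.aestronglyMeasurable _)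
      (Lp.aestronglyMeasurable _)]
    · rfl
    · exact ne_top_of_le_ne_top ENNReal.ofReal_ne_top (rieszPot_helmholtz_le hα f x)
    · exact ne_top_of_le_ne_top ENNReal.ofReal_ne_top (rieszPot_helmholtz_le hα g x)
  norm_le f x := norm_biotSavart_le (mul_nonneg (velocityBound_nonneg hα) (norm_nonneg _))
    (rieszPot_helmholtz_le hα f x)

/-- Convolution with the heat kernel commutes with the Biot-Savart operator. -/
lemma integral_hk_smul_biotSavart {δ : ℝ} (hδ : 0 < δ) {g : L1} {K : ℝ}
    (hK : ∀ x, rieszPot g x ≤ ENNReal.ofReal K) (x : Plane) :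
    ∫ z, hk δ (x - z) • biotSavart g z = biotSavart (heatCLM δ g) x := by
  have hgm : Measurable g := (Lp.stronglyMeasurable g).measurable
  have hcoe : heatCLM δ g =ᵐ[volume] fun x => ∫ y, hk δ (x - y) * g y :=
    (isKer_pushKer measurable_id δ).coeFn g
  have hfin : ∫⁻ z, ∫⁻ y, ‖hk δ (x - z) • g y • bsKer (z - y)‖ₑ < ⊤ := by
    calc ∫⁻ z, ∫⁻ y, ‖hk δ (x - z) • g y • bsKer (z - y)‖ₑ
        ≤ ∫⁻ z, ENNReal.ofReal (hk δ (x - z)) * ENNReal.ofReal K := by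
          refine lintegral_mono fun z => ?_
          simp_rw [enorm_smul (hk δ (x - z)), Real.enorm_of_nonneg (hk_nonneg _ _)]
          rw [lintegral_const_mul _ (by fun_prop)]
          gcongr
          exact (lintegral_mono fun y => enorm_smul_bsKer_le g z y).trans (hK z)
      _ = ENNReal.ofReal K := by
          rw [lintegral_mul_const _ (by fun_prop), lintegral_hk_sub_left hδ, one_mul]
      _ < ⊤ := ENNReal.ofReal_lt_top
  have hi1 : Integrable (Function.uncurry fun z y => hk δ (x - z) • g y • bsKer (z - y))
      (volume.prod volume) := by
    have hm : Measurable (Function.uncurry fun z y => hk δ (x - z) • g y • bsKer (z - y)) := by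
      simp only [Function.uncurry_def]; fun_prop
    refine ⟨hm.aestronglyMeasurable, ?_⟩
    rw [HasFiniteIntegral, lintegral_prod _ hm.enorm.aemeasurable]
    exact hfin
  -- The substitution z ↦ x + y - z exchanges the arguments of the two kernels.
  have key : ∀ y, ∫ z, hk δ (x - z) • g y • bsKer (z - y)
      = ∫ z, (hk δ (z - y) * g y) • bsKer (x - z) := by
    intro y
    rw [← integral_sub_left_eq_self (fun z => hk δ (x - z) • g y • bsKer (z - y)) volume (x + y)]
    refine integral_congr_ae (Filter.Eventually.of_forall fun z => ?_)
    simp only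
    rw [show x - (x + y - z) = z - y by abel, show x + y - z - y = x - z by abel, smul_smul]
  have hi2 : Integrable (Function.uncurry fun y z => (hk δ (z - y) * g y) • bsKer (x - z))
      (volume.prod volume) := by
    have hm : Measurable
        (Function.uncurry fun y z => (hk δ (z - y) * g y) • bsKer (x - z)) := by
      simp only [Function.uncurry_def]; fun_prop
    refine ⟨hm.aestronglyMeasurable, ?_⟩
    rw [HasFiniteIntegral, lintegral_prod _ hm.enorm.aemeasurable]
    have hm1 : Measurable (Function.uncurry fun z y => hk δ (x - z) • g y • bsKer (z - y)) := by
      simp only [Function.uncurry_def]; fun_prop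
    rw [lintegral_lintegral_swap hm1.enorm.aemeasurable] at hfin
    refine lt_of_eq_of_lt (lintegral_congr fun y => ?_) hfin
    rw [← lintegral_sub_left_eq_self (fun z => ‖hk δ (x - z) • g y • bsKer (z - y)‖ₑ) (x + y)]
    refine lintegral_congr fun z => ?_
    simp only [Function.uncurry_def]
    rw [show x - (x + y - z) = z - y by abel, show x + y - z - y = x - z by abel, smul_smul]
  calc ∫ z, hk δ (x - z) • biotSavart g z
      = (1 / (2 * Real.pi)) • ∫ z, ∫ y, hk δ (x - z) • g y • bsKer (z - y) := by
        rw [← integral_smul]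
        refine integral_congr_ae (Filter.Eventually.of_forall fun z => ?_)
        simp only
        rw [biotSavart_eq, smul_comm, integral_smul]
    _ = (1 / (2 * Real.pi)) • ∫ y, ∫ z, (hk δ (z - y) * g y) • bsKer (x - z) := by
        rw [integral_integral_swap hi1]
        simp_rw [key]
    _ = (1 / (2 * Real.pi)) • ∫ z, ∫ y, (hk δ (z - y) * g y) • bsKer (x - z) := by
        rw [integral_integral_swap hi2]
    _ = biotSavart (heatCLM δ g) x := by
        rw [biotSavart_congr hcoe, biotSavart_eq]
        congr 1
        refine integral_congr_ae (Filter.Eventually.of_forall fun z => ?_)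
        simp only
        rw [integral_smul_const]

end VCHE
end

/-! ### The regularised velocity: error bound and vanishing divergence. -/

noncomputable section

namespace VCHE

/-- A bound uniform in τ, so that off the origin the superposition defining the resolvent kernel
converges absolutely. -/
lemma hk_le_inv_sq (τ : ℝ) {x : Plane} (hx : x ≠ 0) : hk τ x ≤ 1 / ‖x‖ ^ 2 := by
  have hx0 : 0 < ‖x‖ := norm_pos_iff.2 hx
  by_cases hτ : 0 < τ
  · have h1 := sq_mul_hk_le hτ x
    have h2 := hk_le (show 0 < 2 * τ by positivity) x
    have h3 : ‖x‖ ^ 2 / (4 * τ) * hk τ x ≤ 2 * (1 / (4 * Real.pi * (2 * τ))) := by linarith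
    have h4 : ‖x‖ ^ 2 * hk τ x ≤ 1 / Real.pi := by
      have := mul_le_mul_of_nonneg_left h3 (show 0 ≤ 4 * τ by positivity)
      calc ‖x‖ ^ 2 * hk τ x = 4 * τ * (‖x‖ ^ 2 / (4 * τ) * hk τ x) := by field_simp
        _ ≤ _ := this
        _ = 1 / Real.pi := by field_simp
    rw [le_div_iff₀ (by positivity), mul_comm]
    refine h4.trans ?_
    rw [div_le_one Real.pi_pos]
    linarith [Real.pi_gt_three]
  · rw [hk_of_nonpos (not_lt.1 hτ)]; positivity

lemma integrableOn_exp_mul_hk (α : ℝ) {x : Plane} (hx : x ≠ 0) :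
    IntegrableOn (fun s => Real.exp (-s) * hk (α ^ 2 * s) x) (Ioi 0) := by
  refine Integrable.mul_bdd (c := 1 / ‖x‖ ^ 2) (integrableOn_exp_neg_Ioi 0) ?_ ?_
  · have : Measurable fun s => hk (α ^ 2 * s) x := by fun_prop
    exact this.aestronglyMeasurable
  · refine Filter.Eventually.of_forall fun s => ?_
    rw [Real.norm_of_nonneg (hk_nonneg _ _)]
    exact hk_le_inv_sq _ hx

lemma resolvent_sub {α r : ℝ} (hr : 0 ≤ r) {x : Plane} (hx : x ≠ 0) :
    resolvent α (Ioi 0) x - resolvent α (Ioi r) x = resolvent α (Ioc 0 r) x := by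
  have hi := integrableOn_exp_mul_hk α hx
  unfold resolvent
  rw [← Ioc_union_Ioi_eq_Ioi hr, setIntegral_union Ioc_disjoint_Ioi_same measurableSet_Ioi
    (hi.mono_set Ioc_subset_Ioi_self) (hi.mono_set (Ioi_subset_Ioi hr)), add_sub_cancel_right]

lemma kerOp_congr {k k' : Plane → Plane → ℝ} (h : ∀ x, ∀ᵐ y, k x y = k' x y) (f : L1) :
    kerOp k f = kerOp k' f := by
  have e : (fun x => ∫ y, k x y * f y) = fun x => ∫ y, k' x y * f y := by
    ext1 x
    refine integral_congr_ae ?_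
    filter_upwards [h x] with y hy
    rw [hy]
  unfold kerOp
  rw [e]

/-- Diffusion over α²r shifts the superposition parameter s to s + r, and e^{-s} = e^{r} e^{-(s+r)}.
Regularising the velocity thus amounts to discarding the part of the resolvent with s ≤ r. -/
lemma integral_hk_mul_resolvent {α r : ℝ} (hα : 0 < α) (hr : 0 < r) (x y : Plane) :
    ∫ z, hk (α ^ 2 * r) (x - z) * resolventKer α (Ioi 0) z y
      = Real.exp r * resolventKer α (Ioi r) x y := by
  have hδ : 0 < α ^ 2 * r := by positivity
  have e1 : ∀ z, hk (α ^ 2 * r) (x - z) * resolventKer α (Ioi 0) z y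
      = ∫ s in Ioi (0 : ℝ), hk (α ^ 2 * r) (x - z) * (Real.exp (-s) * hk (α ^ 2 * s) (z - y)) := by
    intro z
    rw [resolventKer, resolvent, integral_const_mul]
  simp_rw [e1]
  rw [integral_integral_swap]
  · have e2 : ∀ s ∈ Ioi (0 : ℝ), ∫ z, hk (α ^ 2 * r) (x - z) *
        (Real.exp (-s) * hk (α ^ 2 * s) (z - y))
        = Real.exp r * (Real.exp (-(s + r)) * hk (α ^ 2 * (s + r)) (x - y)) := by
      intro s hs
      have hs' : 0 < α ^ 2 * s := mul_pos (by positivity) hs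
      simp_rw [mul_left_comm _ (Real.exp (-s))]
      rw [integral_const_mul, integral_hk_mul_hk hδ hs', ← mul_assoc, ← Real.exp_add,
        show r + -(s + r) = -s by ring, show α ^ 2 * r + α ^ 2 * s = α ^ 2 * (s + r) by ring]
    rw [setIntegral_congr_fun measurableSet_Ioi e2, integral_const_mul]
    congr 1
    have h := (measurePreserving_add_right volume r).setIntegral_preimage_emb
      (measurableEmbedding_addRight r) (fun s => Real.exp (-s) * hk (α ^ 2 * s) (x - y)) (Ioi r)
    rw [preimage_add_const_Ioi, sub_self] at h
    exact h
  · have hm : Measurable (Function.uncurry fun (z : Plane) (s : ℝ) =>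
        hk (α ^ 2 * r) (x - z) * (Real.exp (-s) * hk (α ^ 2 * s) (z - y))) := by
      simp only [Function.uncurry_def]; fun_prop
    refine ⟨hm.aestronglyMeasurable, ?_⟩
    rw [HasFiniteIntegral, lintegral_prod_symm _ hm.enorm.aemeasurable]
    refine lt_of_le_of_lt (b := ∫⁻ s in Ioi (0 : ℝ), ENNReal.ofReal (Real.exp (-s)) *
      ENNReal.ofReal (1 / (4 * Real.pi * (α ^ 2 * r))))
      (setLIntegral_mono' measurableSet_Ioi fun s hs => ?_) ?_
    · have hs' : 0 < α ^ 2 * s := mul_pos (by positivity) hs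
      calc ∫⁻ z, ‖hk (α ^ 2 * r) (x - z) * (Real.exp (-s) * hk (α ^ 2 * s) (z - y))‖ₑ
          ≤ ∫⁻ z, ENNReal.ofReal (Real.exp (-s)) *
              ENNReal.ofReal (1 / (4 * Real.pi * (α ^ 2 * r))) *
              ENNReal.ofReal (hk (α ^ 2 * s) (z - y)) := by
            refine lintegral_mono fun z => ?_
            simp only [enorm_mul]
            rw [Real.enorm_of_nonneg (Real.exp_nonneg _), Real.enorm_of_nonneg (hk_nonneg _ _),
              Real.enorm_of_nonneg (hk_nonneg _ _), mul_left_comm, mul_assoc]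
            gcongr
            exact hk_le hδ _
        _ = _ := by rw [lintegral_const_mul _ (by fun_prop), lintegral_hk_sub hs', mul_one]
    · rw [lintegral_mul_const _ (by fun_prop), lintegral_exp_neg_Ioi, one_mul]
      exact ENNReal.ofReal_lt_top

lemma heatCLM_kerOp_resolvent {α r : ℝ} (hα : 0 < α) (hr : 0 < r) (f : L1) :
    heatCLM (α ^ 2 * r) (kerOp (resolventKer α (Ioi 0)) f)
      = Real.exp r • kerOp (resolventKer α (Ioi r)) f := by
  have hk := isKer_resolventKer α (Ioi_subset_Ioi hr.le)
  rw [heatCLM_apply, ← hk.smul_ker]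
  exact kerOp_kerOp (isKer_pushKer measurable_id _) (isKer_resolventKer α (subset_refl _))
    (hk.const_mul _) (integral_hk_mul_resolvent hα hr) f

lemma biotSavart_smul (c : ℝ) (g : Plane → ℝ) (x : Plane) :
    biotSavart (c • g) x = c • biotSavart g x := by
  rw [biotSavart_eq, biotSavart_eq, smul_comm c]
  simp_rw [Pi.smul_apply, smul_assoc]
  rw [integral_smul]

/-- The velocity field of the vorticity, regularised over the time `α² r` of the heat flow. -/
def smoothVelocity (α r : ℝ) (f : L1) (x : Plane) : Plane :=
  Real.exp (-r) • ∫ z, hk (α ^ 2 * r) (x - z) • velocity α f z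

lemma smoothVelocity_eq {α r : ℝ} (hα : 0 < α) (hr : 0 < r) (f : L1) (x : Plane) :
    smoothVelocity α r f x = biotSavart (kerOp (resolventKer α (Ioi r)) f) x := by
  have hδ : 0 < α ^ 2 * r := by positivity
  have h1 := integral_hk_smul_biotSavart hδ (rieszPot_helmholtz_le hα f) x
  rw [helmholtz_eq hα, heatCLM_kerOp_resolvent hα hr, biotSavart_congr (Lp.coeFn_smul _ _),
    biotSavart_smul] at h1
  unfold smoothVelocity velocity
  rw [helmholtz_eq hα, h1, smul_smul, ← Real.exp_add]
  simp

/-- The difference is the field generated by the discarded part s ∈ (0, r], of size governed by ∫₀^r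
s^{-1/2} ds = 2√r. -/
lemma norm_smoothVelocity_sub_le {α r : ℝ} (hα : 0 < α) (hr : 0 < r) (f : L1) (x : Plane) :
    ‖smoothVelocity α r f x - velocity α f x‖ ≤ velocityBound α * √r * ‖f‖ := by
  have hD := discConst_nonneg
  have k0 := isKer_resolventKer α (subset_refl (Ioi (0 : ℝ)))
  have kr := isKer_resolventKer α (Ioi_subset_Ioi hr.le)
  have e1 : kerOp (resolventKer α (Ioi 0)) f - kerOp (resolventKer α (Ioi r)) f
      = kerOp (resolventKer α (Ioc 0 r)) f := by
    rw [k0.sub_ker kr]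
    refine kerOp_congr (fun x => ?_) f
    filter_upwards [compl_mem_ae_iff.2 (measure_singleton x)] with y hy
    exact resolvent_sub hr.le (sub_ne_zero.2 (Ne.symm hy))
  have b0 := rieszPot_helmholtz_le hα f x
  rw [helmholtz_eq hα] at b0
  have br := rieszPot_resolvent_le hα (Ioi_subset_Ioi hr.le) measurableSet_Ioi zero_le_three
    ((lintegral_mono_set (Ioi_subset_Ioi hr.le)).trans lintegral_exp_mul_inv_sqrt_Ioi_le) f x
  have e2 : velocity α f x - smoothVelocity α r f x
      = biotSavart (kerOp (resolventKer α (Ioc 0 r)) f) x := by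
    rw [smoothVelocity_eq hα hr, velocity, helmholtz_eq hα, ← e1,
      biotSavart_congr (Lp.coeFn_sub _ _), biotSavart_sub (Lp.aestronglyMeasurable _)
      (Lp.aestronglyMeasurable _) (ne_top_of_le_ne_top ENNReal.ofReal_ne_top b0)
      (ne_top_of_le_ne_top ENNReal.ofReal_ne_top br)]
  rw [norm_sub_rev, e2]
  refine norm_biotSavart_le (mul_nonneg (mul_nonneg (velocityBound_nonneg hα) (by positivity))
    (norm_nonneg _)) ?_
  refine (rieszPot_resolvent_le hα Ioc_subset_Ioi_self measurableSet_Ioc (K := 2 * √r)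
    (by positivity) (lintegral_exp_mul_inv_sqrt_Ioc_le hr.le) f x).trans
    (ENNReal.ofReal_le_ofReal ?_)
  have : 0 ≤ (discConst + 1) / α * √r * ‖f‖ := by positivity
  unfold velocityBound
  nlinarith

lemma integrable_hk_smul {δ : ℝ} {v : Plane → Plane} (hv : Measurable v) {V : ℝ}
    (hV : ∀ z, ‖v z‖ ≤ V) (x : Plane) : Integrable fun z => hk δ (x - z) • v z := by
  have hi : Integrable fun z => hk δ (x - z) := (integrable_hk δ).comp_sub_left x
  refine Integrable.mono' (hi.mul_const V) (hi.aestronglyMeasurable.smul hv.aestronglyMeasurable)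
    (Filter.Eventually.of_forall fun z => ?_)
  rw [norm_smul, Real.norm_of_nonneg (hk_nonneg _ _)]
  exact mul_le_mul_of_nonneg_left (hV z) (hk_nonneg _ _)

lemma isDrift_smoothVelocity {α r : ℝ} (hα : 0 < α) (hr : 0 < r) :
    IsDrift (smoothVelocity α r) (velocityBound α) where
  meas f := by
    have : smoothVelocity α r f = biotSavart (kerOp (resolventKer α (Ioi r)) f) :=
      funext (smoothVelocity_eq hα hr f)
    rw [this]
    exact measurable_biotSavart _
  nonneg := velocityBound_nonneg hα
  map_sub f g x := by
    have hd := isDrift_velocity hα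
    unfold smoothVelocity
    rw [← smul_sub, ← integral_sub (integrable_hk_smul (hd.meas f) (hd.norm_le f) x)
      (integrable_hk_smul (hd.meas g) (hd.norm_le g) x)]
    simp_rw [hd.map_sub, smul_sub]
  norm_le f x := by
    rw [smoothVelocity_eq hα hr]
    refine norm_biotSavart_le (mul_nonneg (velocityBound_nonneg hα) (norm_nonneg _)) ?_
    refine (rieszPot_resolvent_le hα (Ioi_subset_Ioi hr.le) measurableSet_Ioi zero_le_three
      ((lintegral_mono_set (Ioi_subset_Ioi hr.le)).trans lintegral_exp_mul_inv_sqrt_Ioi_le)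
      f x).trans (ENNReal.ofReal_le_ofReal (le_of_eq ?_))
    rw [velocityBound]; ring

lemma inner_perp_right (a b : Plane) : inner ℝ a (perp b) = -inner ℝ (perp a) b := by
  simp [perp, PiLp.inner_apply, Fin.sum_univ_two]

lemma inner_perp_self (a : Plane) : inner ℝ a (perp a) = 0 := by
  simp [perp, PiLp.inner_apply, Fin.sum_univ_two]
  ring

/-- The Biot-Savart kernel is divergence free against radial weights. -/
lemma integral_inner_hkGrad_bsKer (δ : ℝ) (x y : Plane) :
    ∫ z, inner ℝ (hkGrad δ (x - z)) (bsKer (z - y)) = 0 := by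
  set a := x - y with ha
  set F : Plane → ℝ := fun ζ => inner ℝ (hkGrad δ (a - ζ)) (bsKer ζ) with hF
  have e1 : ∫ z, inner ℝ (hkGrad δ (x - z)) (bsKer (z - y)) = ∫ ζ, F ζ := by
    rw [← integral_sub_right_eq_self F y]
    refine integral_congr_ae (Filter.Eventually.of_forall fun z => ?_)
    simp only [hF, ha]
    rw [show x - y - (z - y) = x - z by abel]
  have e2 : ∀ ζ, F ζ = hk δ (a - ζ) / (2 * δ) * (1 / ‖ζ‖ ^ 2) * inner ℝ (perp a) ζ := by
    intro ζ
    simp only [hF, hkGrad, bsKer, inner_smul_left, inner_smul_right, inner_sub_left,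
      inner_perp_self, inner_perp_right a]
    simp
    ring
  -- Reflection in the line through a fixes |a - ζ| and |ζ| and reverses the component along a^⊥, so
  -- the integrand is odd under it.
  set R := (Submodule.span ℝ {a}).reflection with hR
  have hRa : R a = a :=
    Submodule.reflection_mem_subspace_eq_self (Submodule.mem_span_singleton_self a)
  have hRp : R (perp a) = -perp a := by
    refine Submodule.reflection_mem_subspace_orthogonalComplement_eq_neg ?_
    rw [Submodule.mem_orthogonal_singleton_iff_inner_right]
    exact inner_perp_self a
  have e3 : ∀ ζ, F (R ζ) = -F ζ := by
    intro ζ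
    have h1 : ‖a - R ζ‖ = ‖a - ζ‖ := by
      conv_lhs => rw [← hRa, ← map_sub]
      exact R.norm_map _
    have h2 : inner ℝ (perp a) (R ζ) = -inner ℝ (perp a) ζ := by
      have := R.inner_map_map (perp a) ζ
      rw [hRp, inner_neg_left] at this
      linarith
    rw [e2, e2, hk_eq_of_norm_eq δ h1, R.norm_map, h2]
    ring
  have e4 : ∫ ζ, F (R ζ) = ∫ ζ, F ζ :=
    R.measurePreserving.integral_comp R.toHomeomorph.measurableEmbedding F
  simp_rw [e3] at e4
  rw [integral_neg] at e4
  rw [e1]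
  linarith

/-- The integral is the divergence at x of the diffused field; Fubini reduces its vanishing to the
Biot–Savart kernel itself. -/
lemma integral_inner_hkGrad_biotSavart {δ : ℝ} (hδ : 0 < δ) {g : L1} {K : ℝ}
    (hK : ∀ x, rieszPot g x ≤ ENNReal.ofReal K) (x : Plane) :
    ∫ z, inner ℝ (hkGrad δ (x - z)) (biotSavart g z) = 0 := by
  have hgm : Measurable g := (Lp.stronglyMeasurable g).measurable
  have hm : Measurable (Function.uncurry fun z y =>
      inner ℝ (hkGrad δ (x - z)) (g y • bsKer (z - y))) := by
    simp only [Function.uncurry_def]; fun_prop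
  have hi : Integrable (Function.uncurry fun z y =>
      inner ℝ (hkGrad δ (x - z)) (g y • bsKer (z - y))) (volume.prod volume) := by
    refine ⟨hm.aestronglyMeasurable, ?_⟩
    rw [HasFiniteIntegral, lintegral_prod _ hm.enorm.aemeasurable]
    calc ∫⁻ z, ∫⁻ y, ‖inner ℝ (hkGrad δ (x - z)) (g y • bsKer (z - y))‖ₑ
        ≤ ∫⁻ z, ENNReal.ofReal (2 / √δ) * ENNReal.ofReal (hk (2 * δ) (x - z)) *
            ENNReal.ofReal K := by
          refine lintegral_mono fun z => ?_
          calc ∫⁻ y, ‖inner ℝ (hkGrad δ (x - z)) (g y • bsKer (z - y))‖ₑ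
              ≤ ∫⁻ y, ‖hkGrad δ (x - z)‖ₑ * (‖g y‖ₑ * ‖z - y‖ₑ⁻¹) := by
                refine lintegral_mono fun y => le_trans ?_
                  (mul_le_mul_right (enorm_smul_bsKer_le g z y) _)
                rw [← ofReal_norm, ← ofReal_norm, ← ofReal_norm,
                  ← ENNReal.ofReal_mul (norm_nonneg _)]
                exact ENNReal.ofReal_le_ofReal (norm_inner_le_norm _ _)
            _ = ‖hkGrad δ (x - z)‖ₑ * rieszPot g z := by
                rw [lintegral_const_mul _ (by fun_prop)]; rfl
            _ ≤ _ := by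
                gcongr
                · rw [← ofReal_norm, ← ENNReal.ofReal_mul (by positivity)]
                  exact ENNReal.ofReal_le_ofReal (norm_hkGrad_le hδ _)
                · exact hK z
      _ = ENNReal.ofReal (2 / √δ) * ENNReal.ofReal K := by
          rw [lintegral_mul_const _ (by fun_prop), lintegral_const_mul _ (by fun_prop),
            lintegral_hk_sub_left (by positivity), mul_one]
      _ < ⊤ := ENNReal.mul_lt_top ENNReal.ofReal_lt_top ENNReal.ofReal_lt_top
  calc ∫ z, inner ℝ (hkGrad δ (x - z)) (biotSavart g z)
      = ∫ z, (1 / (2 * Real.pi)) * ∫ y, inner ℝ (hkGrad δ (x - z)) (g y • bsKer (z - y)) := by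
        refine integral_congr_ae (Filter.Eventually.of_forall fun z => ?_)
        simp only
        rw [biotSavart_eq, inner_smul_right, ← integral_inner (integrable_smul_bsKer
          hgm.aestronglyMeasurable (ne_top_of_le_ne_top ENNReal.ofReal_ne_top (hK z)))]
    _ = (1 / (2 * Real.pi)) * ∫ y, ∫ z, inner ℝ (hkGrad δ (x - z)) (g y • bsKer (z - y)) := by
        rw [integral_const_mul, integral_integral_swap hi]
    _ = 0 := by
        simp_rw [inner_smul_right, integral_const_mul, integral_inner_hkGrad_bsKer]
        simp

end VCHE
end

/-! ### Derivative of the regularised velocity and area bound for the jumps. -/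

noncomputable section

namespace VCHE

/-- An integrable bound locally uniform in x, for differentiating under the integral sign. -/
lemma hk_sub_le_of_norm_sub_le {τ : ℝ} (hτ : 0 < τ) {x x₀ : Plane} (h : ‖x - x₀‖ ≤ 1) (z : Plane) :
    hk τ (x - z) ≤ 2 * Real.exp (1 / (4 * τ)) * hk (2 * τ) (x₀ - z) := by
  rw [hk_of_pos hτ, hk_of_pos (by positivity)]
  have h1 : ‖x₀ - z‖ ^ 2 ≤ 2 * ‖x - z‖ ^ 2 + 2 := by
    have h2 : ‖x₀ - z‖ ≤ ‖x - z‖ + 1 := by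
      have := norm_sub_le (x - z) (x - x₀)
      rw [show x - z - (x - x₀) = x₀ - z by abel] at this
      linarith
    nlinarith [norm_nonneg (x₀ - z), norm_nonneg (x - z), sq_nonneg (‖x - z‖ - 1)]
  have h3 : -‖x - z‖ ^ 2 / (4 * τ) ≤ 1 / (4 * τ) + -‖x₀ - z‖ ^ 2 / (4 * (2 * τ)) := by
    have e : 1 / (4 * τ) + -‖x₀ - z‖ ^ 2 / (4 * (2 * τ)) = (1 - ‖x₀ - z‖ ^ 2 / 2) / (4 * τ) := by
      field_simp
      ring
    rw [e]
    gcongr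
    linarith
  calc 1 / (4 * Real.pi * τ) * Real.exp (-‖x - z‖ ^ 2 / (4 * τ))
      ≤ 1 / (4 * Real.pi * τ) * (Real.exp (1 / (4 * τ)) *
          Real.exp (-‖x₀ - z‖ ^ 2 / (4 * (2 * τ)))) := by
        rw [← Real.exp_add]
        gcongr
    _ = _ := by field_simp

/-- The heat flow of a vector field. -/
def heatField (δ : ℝ) (v : Plane → Plane) (x : Plane) : Plane := ∫ z, hk δ (x - z) • v z

/-- The derivative of `heatField`. -/
def heatFieldDeriv (δ : ℝ) (v : Plane → Plane) (x : Plane) : Plane →L[ℝ] Plane :=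
  ∫ z, (innerSL ℝ (hkGrad δ (x - z))).smulRight (v z)

section HeatField

variable {v : Plane → Plane} {V δ : ℝ}

lemma aestronglyMeasurable_smulRight (hv : Measurable v) (x : Plane) :
    AEStronglyMeasurable (fun z => (innerSL ℝ (hkGrad δ (x - z))).smulRight (v z)) volume := by
  have h1 : AEStronglyMeasurable (fun z => innerSL ℝ (hkGrad δ (x - z))) volume :=
    ((innerSL ℝ).continuous.comp ((continuous_hkGrad δ).comp
      (continuous_const.sub continuous_id))).aestronglyMeasurable
  exact ((ContinuousLinearMap.smulRightL ℝ Plane Plane).aestronglyMeasurable_comp₂ h1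
    hv.aestronglyMeasurable)

lemma norm_smulRight_le (hδ : 0 < δ) (hV : ∀ z, ‖v z‖ ≤ V) (x z : Plane) :
    ‖(innerSL ℝ (hkGrad δ (x - z))).smulRight (v z)‖ ≤ 2 / √δ * V * hk (2 * δ) (x - z) := by
  rw [ContinuousLinearMap.norm_smulRight_apply, innerSL_apply_norm]
  calc _ ≤ (2 / √δ * hk (2 * δ) (x - z)) * V :=
        mul_le_mul (norm_hkGrad_le hδ _) (hV z) (norm_nonneg _)
          (mul_nonneg (by positivity) (hk_nonneg _ _))
    _ = _ := by ring

lemma integrable_smulRight (hδ : 0 < δ) (hv : Measurable v) (hV : ∀ z, ‖v z‖ ≤ V) (x : Plane) :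
    Integrable (fun z => (innerSL ℝ (hkGrad δ (x - z))).smulRight (v z)) volume :=
  Integrable.mono' (((integrable_hk (2 * δ)).comp_sub_left x).const_mul (2 / √δ * V))
    (aestronglyMeasurable_smulRight hv x) (Filter.Eventually.of_forall (norm_smulRight_le hδ hV x))

lemma norm_heatFieldDeriv_le (hδ : 0 < δ) (hV : ∀ z, ‖v z‖ ≤ V) (x : Plane) :
    ‖heatFieldDeriv δ v x‖ ≤ 2 / √δ * V := by
  have h := norm_integral_le_of_norm_le
    (((integrable_hk (2 * δ)).comp_sub_left x).const_mul (2 / √δ * V))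
    (Filter.Eventually.of_forall (norm_smulRight_le hδ hV x))
  refine h.trans (le_of_eq ?_)
  rw [integral_const_mul, integral_sub_left_eq_self (hk (2 * δ)) volume x,
    integral_hk (by positivity), mul_one]

lemma hasFDerivAt_heatField (hδ : 0 < δ) (hv : Measurable v) (hV : ∀ z, ‖v z‖ ≤ V) (x₀ : Plane) :
    HasFDerivAt (heatField δ v) (heatFieldDeriv δ v x₀) x₀ := by
  refine hasFDerivAt_integral_of_dominated_of_fderiv_le
    (F' := fun x z => (innerSL ℝ (hkGrad δ (x - z))).smulRight (v z))
    (bound := fun z => 2 / √δ * V * (2 * Real.exp (1 / (4 * (2 * δ))) * hk (2 * (2 * δ)) (x₀ - z)))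
    (Metric.ball_mem_nhds x₀ one_pos) (Filter.Eventually.of_forall fun x => ?_)
    (integrable_hk_smul hv hV x₀) (aestronglyMeasurable_smulRight hv x₀)
    (Filter.Eventually.of_forall fun z x hx => ?_) ?_
    (Filter.Eventually.of_forall fun z x _ => ?_)
  · exact (integrable_hk_smul hv hV x).aestronglyMeasurable
  · have hV0 : 0 ≤ V := (norm_nonneg _).trans (hV 0)
    refine (norm_smulRight_le hδ hV x z).trans ?_
    gcongr
    refine hk_sub_le_of_norm_sub_le (by positivity) ?_ z
    rw [← dist_eq_norm]
    exact (Metric.mem_ball.1 hx).le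
  · exact (((integrable_hk (2 * (2 * δ))).comp_sub_left x₀).const_mul _).const_mul _
  · have h1 : HasFDerivAt (fun x => hk δ (x - z)) (innerSL ℝ (hkGrad δ (x - z))) x := by
      have h := (hasFDerivAt_hk δ (x - z)).comp x ((hasFDerivAt_id x).sub_const z)
      rwa [ContinuousLinearMap.comp_id] at h
    exact h1.smul_const (v z)

end HeatField

/-- The trace of an endomorphism of the plane. -/
def planeTrace : (Plane →L[ℝ] Plane) →L[ℝ] ℝ :=
  (EuclideanSpace.proj (𝕜 := ℝ) (0 : Fin 2)).comp
      (ContinuousLinearMap.apply ℝ Plane (EuclideanSpace.single (0 : Fin 2) (1 : ℝ))) +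
    (EuclideanSpace.proj (𝕜 := ℝ) (1 : Fin 2)).comp
      (ContinuousLinearMap.apply ℝ Plane (EuclideanSpace.single (1 : Fin 2) (1 : ℝ)))

lemma planeTrace_apply (A : Plane →L[ℝ] Plane) :
    planeTrace A = A (EuclideanSpace.single 0 1) 0 + A (EuclideanSpace.single 1 1) 1 := rfl

lemma planeTrace_heatFieldDeriv {v : Plane → Plane} {V δ : ℝ} (hδ : 0 < δ) (hv : Measurable v)
    (hV : ∀ z, ‖v z‖ ≤ V) (x : Plane) :
    planeTrace (heatFieldDeriv δ v x) = ∫ z, inner ℝ (hkGrad δ (x - z)) (v z) := by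
  rw [heatFieldDeriv, ← ContinuousLinearMap.integral_comp_comm _ (integrable_smulRight hδ hv hV x)]
  refine integral_congr_ae (Filter.Eventually.of_forall fun z => ?_)
  simp [planeTrace_apply, PiLp.inner_apply, Fin.sum_univ_two]
  ring

/-- In det(1 + hA) = 1 + h tr A + h² det A the linear term vanishes. The change of area is thus of
second order in h, which permits a normalisation that stays harmless after division by h. -/
lemma le_abs_det_one_add {A : Plane →L[ℝ] Plane} (hA : planeTrace A = 0) {L : ℝ} (hL : ‖A‖ ≤ L)
    (h : ℝ) : 1 - 2 * (h * L) ^ 2 ≤ |(ContinuousLinearMap.id ℝ Plane + h • A).det| := by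
  set b := (EuclideanSpace.basisFun (Fin 2) ℝ).toBasis with hb
  have hbi : ∀ i, b i = EuclideanSpace.single i 1 := fun i => by simp [hb]
  have hdet : (ContinuousLinearMap.id ℝ Plane + h • A).det
      = 1 + h * planeTrace A + h ^ 2 * (A (b 0) 0 * A (b 1) 1 - A (b 1) 0 * A (b 0) 1) := by
    rw [ContinuousLinearMap.det, ← LinearMap.det_toMatrix b, Matrix.det_fin_two, planeTrace_apply,
      ← hbi, ← hbi]
    simp [LinearMap.toMatrix_apply, hb]
    ring
  have hL0 : 0 ≤ L := (norm_nonneg _).trans hL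
  have hc : ∀ i j, |A (b j) i| ≤ L := by
    intro i j
    refine ((PiLp.norm_apply_le (A (b j)) i).trans (A.le_opNorm _)).trans ?_
    rw [hbi]
    simpa using hL
  have hp : |A (b 0) 0 * A (b 1) 1 - A (b 1) 0 * A (b 0) 1| ≤ 2 * L ^ 2 := by
    refine (abs_sub _ _).trans ?_
    rw [abs_mul, abs_mul]
    have h1 := mul_le_mul (hc 0 0) (hc 1 1) (abs_nonneg _) hL0
    have h2 := mul_le_mul (hc 0 1) (hc 1 0) (abs_nonneg _) hL0
    linarith
  rw [hdet, hA]
  refine le_trans ?_ (le_abs_self _)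
  have h3 := (abs_le.1 hp).1
  nlinarith [sq_nonneg h]

/-- The area bound for a small step along a divergence free Lipschitz vector field. -/
lemma areaBound_jumpMap {w : Plane → Plane} {D : Plane → Plane →L[ℝ] Plane} {h L κ : ℝ}
    (hD : ∀ x, HasFDerivAt w (D x) x) (hL : ∀ x, ‖D x‖ ≤ L) (htr : ∀ x, planeTrace (D x) = 0)
    (hh : 0 < h) (hhL : h * L < 1) (hκ : 1 ≤ κ) (hκ' : κ⁻¹ ≤ 1 - 2 * (h * L) ^ 2) :
    AreaBound (jumpMap h w) κ := by
  have hX : ∀ x, HasFDerivAt (jumpMap h w) (ContinuousLinearMap.id ℝ Plane + h • D x) x :=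
    fun x => (hasFDerivAt_id x).add ((hD x).const_smul h)
  have hm : Measurable (jumpMap h w) :=
    (continuous_iff_continuousAt.2 fun x => (hX x).continuousAt).measurable
  have hlip : ∀ x y, ‖w y - w x‖ ≤ L * ‖y - x‖ := fun x y =>
    convex_univ.norm_image_sub_le_of_norm_hasFDerivWithin_le
      (fun z _ => (hD z).hasFDerivWithinAt) (fun z _ => hL z) (mem_univ x) (mem_univ y)
  have hinj : InjOn (jumpMap h w) univ := by
    intro x _ y _ hxy
    by_contra hne
    have hpos : 0 < ‖y - x‖ := norm_pos_iff.2 (sub_ne_zero.2 (Ne.symm hne))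
    have e : y - x = -(h • (w y - w x)) := by
      simp only [jumpMap] at hxy
      rw [smul_sub, neg_sub, sub_eq_sub_iff_add_eq_add, add_comm _ x, hxy]
    have h1 : ‖y - x‖ ≤ h * (L * ‖y - x‖) := by
      conv_lhs => rw [e, norm_neg, norm_smul, Real.norm_of_nonneg hh.le]
      gcongr
      exact hlip x y
    nlinarith
  have hκ0 : 0 < κ := by linarith
  refine ⟨hm, hκ, fun ψ hψ => ?_⟩
  have harea := lintegral_image_eq_lintegral_abs_det_fderiv_mul volume MeasurableSet.univ
    (fun x _ => (hX x).hasFDerivWithinAt) hinj ψ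
  rw [Measure.restrict_univ] at harea
  calc ∫⁻ y, ψ (jumpMap h w y)
      ≤ ∫⁻ y, ENNReal.ofReal κ * (ENNReal.ofReal
          |(ContinuousLinearMap.id ℝ Plane + h • D y).det| * ψ (jumpMap h w y)) := by
        refine lintegral_mono fun y => ?_
        rw [← mul_assoc, ← ENNReal.ofReal_mul hκ0.le]
        refine le_mul_of_one_le_left' ?_
        rw [ENNReal.one_le_ofReal]
        have := le_abs_det_one_add (htr y) (hL y) h
        calc (1 : ℝ) = κ * κ⁻¹ := by field_simp
          _ ≤ _ := by gcongr; exact hκ'.trans this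
    _ = ENNReal.ofReal κ * ∫⁻ y, ENNReal.ofReal
          |(ContinuousLinearMap.id ℝ Plane + h • D y).det| * ψ (jumpMap h w y) :=
        lintegral_const_mul' _ _ ENNReal.ofReal_ne_top
    _ = ENNReal.ofReal κ * ∫⁻ y in jumpMap h w '' univ, ψ y := by rw [harea]
    _ ≤ _ := by gcongr; exact Measure.restrict_le_self

lemma areaBound_smoothVelocity {α r : ℝ} (hα : 0 < α) (hr : 0 < r) {f : L1} {M L h κ : ℝ}
    (hf : ‖f‖ ≤ M) (hL : 2 / √(α ^ 2 * r) * (velocityBound α * M) ≤ L) (hh : 0 < h)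
    (hhL : h * L < 1) (hκ : 1 ≤ κ) (hκ' : κ⁻¹ ≤ 1 - 2 * (h * L) ^ 2) :
    AreaBound (jumpMap h (smoothVelocity α r f)) κ := by
  have hδ : 0 < α ^ 2 * r := by positivity
  have hd := isDrift_velocity hα
  have hV : ∀ z, ‖velocity α f z‖ ≤ velocityBound α * M := fun z =>
    (hd.norm_le f z).trans (mul_le_mul_of_nonneg_left hf hd.nonneg)
  refine areaBound_jumpMap
    (D := fun x => Real.exp (-r) • heatFieldDeriv (α ^ 2 * r) (velocity α f) x)
    (fun x => (hasFDerivAt_heatField hδ (hd.meas f) hV x).const_smul (Real.exp (-r)))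
    (fun x => ?_) (fun x => ?_) hh hhL hκ hκ'
  · rw [norm_smul, Real.norm_of_nonneg (Real.exp_nonneg _)]
    exact (mul_le_of_le_one_left (norm_nonneg _) (Real.exp_le_one_iff.2 (by linarith))).trans
      ((norm_heatFieldDeriv_le hδ hV x).trans hL)
  · rw [map_smul, planeTrace_heatFieldDeriv hδ (hd.meas f) hV]
    simp only [velocity]
    rw [integral_inner_hkGrad_biotSavart hδ (rieszPot_helmholtz_le hα f), smul_zero]

end VCHE
end

/-! ### Existence: choice of parameters and passage to the limit. -/

noncomputable section

namespace VCHE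

section Existence

open Filter Topology

/-- Existence of a solution of the integral equation in `L¹`, with decay estimates. -/
theorem exists_integral_solution {α : ℝ} (hα : 0 < α) (v₀ : L1) :
    ∃ v : ℝ → L1, Measurable v ∧ (∀ t, ‖v t‖ ≤ ‖v₀‖) ∧
      (∀ t > 0, v t = heatCLM t v₀ + ∫ s in Ioc 0 t, driftOp (velocity α) (t - s) (v s)) ∧
      ∀ k, ∀ t > 0, powInt k (v t) ≤ ENNReal.ofReal (decayBound ‖v₀‖ k t) := by
  set M := ‖v₀‖ with hMdef
  have hM : 0 ≤ M := norm_nonneg _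
  set U := velocityBound α with hUdef
  have hu : IsDrift (velocity α) U := isDrift_velocity hα
  have hU : 0 ≤ U := hu.nonneg
  set V := U * M with hV
  have hV0 : 0 ≤ V := mul_nonneg hU hM
  -- The velocity is regularised over r = ε, so its Lipschitz constant is L = 2V/(α√ε). With h =
  -- ε²/c and κ⁻¹ = 1 - ε³/c, the consistency error (1 - κ⁻¹)/h equals ε, while 2(hL)² = (8V²/α²)
  -- ε³/c² ≤ ε³/c gives the area bound. The summand 2 in c keeps ε³/c ≤ 1/2.
  set c := 2 + 8 * V ^ 2 / α ^ 2 with hc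
  have hc2 : 2 ≤ c := by have : 0 ≤ 8 * V ^ 2 / α ^ 2 := by positivity
                         linarith
  have hc0 : 0 < c := by linarith
  set ε : ℕ → ℝ := fun n => 1 / ((n : ℝ) + 1) with hε
  have hε0 : ∀ n, 0 < ε n := fun n => by positivity
  have hε1 : ∀ n, ε n ≤ 1 := fun n => by
    simp only [hε]
    rw [div_le_one (by positivity)]
    linarith [n.cast_nonneg (α := ℝ)]
  have hεt : Tendsto ε atTop (𝓝 0) := tendsto_one_div_add_atTop_nhds_zero_nat
  set h : ℕ → ℝ := fun n => c⁻¹ * ε n ^ 2 with hh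
  have hh0 : ∀ n, 0 < h n := fun n => by have := hε0 n; positivity
  set κ : ℕ → ℝ := fun n => (1 - c⁻¹ * ε n ^ 3)⁻¹ with hκ
  have hsmall : ∀ n, c⁻¹ * ε n ^ 3 ≤ 1 / 2 := by
    intro n
    have h1 : c⁻¹ ≤ 1 / 2 := by rw [one_div]; exact inv_anti₀ two_pos hc2
    have h2 : ε n ^ 3 ≤ 1 := pow_le_one₀ (hε0 n).le (hε1 n)
    have h3 : 0 < ε n ^ 3 := by have := hε0 n; positivity
    have h4 : 0 < c⁻¹ := by positivity
    nlinarith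
  have hpos : ∀ n, 0 < c⁻¹ * ε n ^ 3 := fun n => by have := hε0 n; positivity
  have hκ1 : ∀ n, 1 ≤ κ n := fun n => by
    have h1 := hsmall n
    have h2 := hpos n
    exact (one_le_inv₀ (by linarith)).2 (by linarith)
  have hκi : ∀ n, (κ n)⁻¹ = 1 - c⁻¹ * ε n ^ 3 := fun n => inv_inv _
  set L : ℕ → ℝ := fun n => 2 / √(α ^ 2 * ε n) * V with hL
  have hhL : ∀ n, 2 * (h n * L n) ^ 2 ≤ c⁻¹ * ε n ^ 3 := by
    intro n
    have he := hε0 n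
    have e1 : 2 * (h n * L n) ^ 2 = (8 * V ^ 2 / α ^ 2) * (c⁻¹ ^ 2 * ε n ^ 3) := by
      simp only [hh, hL, mul_pow, div_pow]
      rw [Real.sq_sqrt (by positivity)]
      field_simp
      ring
    have e2 : c⁻¹ * ε n ^ 3 = c * (c⁻¹ ^ 2 * ε n ^ 3) := by field_simp
    rw [e1, e2]
    gcongr
    linarith
  have hLlt : ∀ n, h n * L n < 1 := by
    intro n
    have h1 := hhL n
    have h2 := hsmall n
    nlinarith [sq_nonneg (h n * L n - 1)]
  have hw : ∀ n, IsDrift (smoothVelocity α (ε n)) U := fun n =>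
    isDrift_smoothVelocity hα (hε0 n)
  have hsol : ∀ n, _ := fun n => exists_jump_solution (hw n) (hh0 n) (hκ1 n) (v₀ := v₀)
    (M := M) le_rfl fun f hf => areaBound_smoothVelocity hα (hε0 n) hf (le_refl (L n)) (hh0 n)
      (hLlt n) (hκ1 n) (by rw [hκi]; linarith [hhL n])
  choose vn hvm hvM heq hpow using hsol
  set e : ℕ → ℝ := fun n =>
    (ε n + √(10 * h n * V ^ 3) + 2 * (U * √(ε n)) * M) * M with he
  have he0 : ∀ n, 0 ≤ e n := fun n => by
    have := (hε0 n).le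
    positivity
  have het : Tendsto e atTop (𝓝 0) := by
    have hcont : Continuous fun x : ℝ =>
        (x + √(10 * (c⁻¹ * x ^ 2) * V ^ 3) + 2 * (U * √x) * M) * M := by fun_prop
    have h1 := (hcont.tendsto 0).comp hεt
    rw [show (0 + √(10 * (c⁻¹ * 0 ^ 2) * V ^ 3) + 2 * (U * √0) * M) * M = 0 by simp] at h1
    exact h1
  have hBm : ∀ n, Measurable (Function.uncurry fun τ f =>
      (h n)⁻¹ • (jumpOp (h n) (κ n) (smoothVelocity α (ε n)) τ f - heatCLM τ f)) := by
    intro n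
    have hm : Measurable (Function.uncurry fun τ (f : L1) => heatCLM τ f) :=
      measurable_uncurry_of_continuous_L1 (fun τ => (heatCLM τ).continuous) measurable_heatCLM
    exact ((measurable_jumpOp (hw n) (hh0 n).le (hκ1 n)).sub hm).const_smul ((h n)⁻¹)
  have happ : ∀ n, ∀ τ > 0, ∀ f : L1, ‖f‖ ≤ M →
      ‖(h n)⁻¹ • (jumpOp (h n) (κ n) (smoothVelocity α (ε n)) τ f - heatCLM τ f)
        - driftOp (velocity α) τ f‖ ≤ e n * errorWeight τ := by
    intro n τ hτ f hf
    have hη : ∀ f x, ‖smoothVelocity α (ε n) f x - velocity α f x‖ ≤ U * √(ε n) * ‖f‖ :=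
      fun f x => norm_smoothVelocity_sub_le hα (hε0 n) f x
    refine (norm_jump_sub_drift_le hu (hw n) hη (by positivity) (hh0 n) (hκ1 n) hM hτ hf).trans
      (le_of_eq ?_)
    have e1 : (h n)⁻¹ * (1 - (κ n)⁻¹) = ε n := by
      rw [hκi]
      simp only [hh]
      have := hε0 n
      field_simp
      ring
    rw [e1]
  obtain ⟨v, hv1, hv2, hv3, hv4⟩ := exists_tendsto_volterra (B := driftOp (velocity α))
    (z := fun t => heatCLM t v₀) (b := 4 * U * M) hM (by positivity) hBm
    (fun τ _ f g hf hg => norm_driftOp_sub_le hu τ hf hg) (driftOp_zero hu) he0 het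
    errorWeight_nonneg integrableOn_errorWeight happ hvm hvM heq
  -- The decay bounds involve neither n nor α, and they survive convergence in L¹.
  exact ⟨v, hv1, hv2, hv3, fun k t ht => powInt_le_of_tendsto (hv4 t ht) fun n => hpow n k t ht⟩

end Existence

/-! ### From dyadic powers to the L^p decay. -/

section Decay

lemma decayBound_eq (M : ℝ) (k : ℕ) {t : ℝ} (ht : 0 < t) :
    decayBound M k t = (128 * M / t) ^ 2 ^ k * (t / 2 ^ (k + 7)) := by
  have h1 : t ^ 2 ^ k = t ^ (2 ^ k - 1) * t := by
    rw [← pow_succ, Nat.sub_add_cancel Nat.one_le_two_pow]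
  rw [decayBound, div_pow, mul_pow, h1, pow_mul]
  norm_num
  field_simp

/-- Chebyshev's inequality at the level 128M/t: the powers cancel, and the set where |f| reaches
this level has measure at most t/2^{k+7} for every k. -/
lemma ae_enorm_le_of_powInt_le {f : L1} {M t : ℝ} (hM : ‖f‖ ≤ M) (ht : 0 < t)
    (h : ∀ k, powInt k f ≤ ENNReal.ofReal (decayBound M k t)) :
    ∀ᵐ x, ‖f x‖ₑ ≤ ENNReal.ofReal (128 * M / t) := by
  have hM0 : 0 ≤ M := (norm_nonneg _).trans hM
  rcases hM0.eq_or_lt with h0 | h0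
  · have hf : f = 0 := norm_le_zero_iff.1 (hM.trans h0.symm.le)
    filter_upwards [Lp.coeFn_zero ℝ 1 (volume : Measure Plane)] with x hx
    rw [hf, hx]
    simp
  · set a := 128 * M / t with ha
    have ha0 : 0 < a := by positivity
    have hfm : Measurable f := (Lp.stronglyMeasurable f).measurable
    have hS : ∀ k : ℕ, volume {x | ENNReal.ofReal a ≤ ‖f x‖ₑ} ≤
        ENNReal.ofReal (t / 2 ^ (k + 7)) := by
      intro k
      have h1 := (meas_ge_le_lintegral_div (μ := volume)
        (f := fun x => ‖f x‖ₑ ^ 2 ^ k) (hfm.enorm.pow_const _).aemeasurable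
        (ε := ENNReal.ofReal a ^ 2 ^ k) (by simp [ha0]) (by simp))
      have hsub : {x | ENNReal.ofReal a ≤ ‖f x‖ₑ} ⊆
          {x | ENNReal.ofReal a ^ 2 ^ k ≤ ‖f x‖ₑ ^ 2 ^ k} := fun x hx => by
        have hx' : ENNReal.ofReal a ≤ ‖f x‖ₑ := hx
        exact pow_le_pow_left' hx' _
      refine (measure_mono hsub).trans (h1.trans ?_)
      refine ENNReal.div_le_of_le_mul ((h k).trans (le_of_eq ?_))
      rw [decayBound_eq M k ht, ← ha, ENNReal.ofReal_mul (by positivity),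
        ENNReal.ofReal_pow ha0.le, mul_comm]
    have hlim : Filter.Tendsto (fun k : ℕ => ENNReal.ofReal (t / 2 ^ (k + 7))) Filter.atTop
        (nhds 0) := by
      have h2 : Filter.Tendsto (fun k : ℕ => t / 2 ^ (k + 7)) Filter.atTop (nhds 0) := by
        have h3 := (tendsto_pow_atTop_nhds_zero_of_lt_one (r := (1 / 2 : ℝ)) (by norm_num)
          (by norm_num)).const_mul (t / 2 ^ 7)
        rw [mul_zero] at h3
        refine h3.congr fun k => ?_
        rw [pow_add, one_div, inv_pow]
        field_simp
      simpa using ENNReal.tendsto_ofReal h2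
    have hz : volume {x | ENNReal.ofReal a ≤ ‖f x‖ₑ} = 0 :=
      le_antisymm (ge_of_tendsto' hlim hS) zero_le
    have hz' : ∀ᵐ x, ¬ ENNReal.ofReal a ≤ ‖f x‖ₑ := by
      rw [ae_iff]; simpa using hz
    filter_upwards [hz'] with x hx
    exact (not_le.1 hx).le

/-- Interpolation between `L¹` and `L^∞`. -/
lemma eLpNorm_le_of_norm_le_of_ae_le {f : L1} {M t : ℝ} (hM : ‖f‖ ≤ M) (ht : 0 < t)
    (h : ∀ᵐ x, ‖f x‖ₑ ≤ ENNReal.ofReal (128 * M / t)) {p : ℝ≥0∞} (hp : 1 ≤ p) :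
    eLpNorm f p volume ≤ ENNReal.ofReal (128 * t ^ (-(1 - (p⁻¹).toReal)) * M) := by
  have hM0 : 0 ≤ M := (norm_nonneg _).trans hM
  have hfm : Measurable f := (Lp.stronglyMeasurable f).measurable
  rcases eq_or_ne p ⊤ with rfl | hpt
  · rw [eLpNorm_exponent_top]
    refine (essSup_le_of_ae_le _ h).trans (ENNReal.ofReal_le_ofReal (le_of_eq ?_))
    simp only [ENNReal.inv_top, ENNReal.toReal_zero, sub_zero]
    rw [Real.rpow_neg_one]
    ring
  · set q := p.toReal with hq
    have hq1 : 1 ≤ q := by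
      rw [hq, ← ENNReal.toReal_one]
      exact (ENNReal.toReal_le_toReal ENNReal.one_ne_top hpt).2 hp
    have hq0 : 0 < q := by linarith
    have hp0 : p ≠ 0 := (zero_lt_one.trans_le hp).ne'
    rw [eLpNorm_eq_lintegral_rpow_enorm_toReal hp0 hpt, ← hq, ENNReal.toReal_inv, ← hq]
    have h1 : ∫⁻ x, ‖f x‖ₑ ^ q ≤ ENNReal.ofReal (128 * M / t) ^ (q - 1) * ENNReal.ofReal M := by
      calc ∫⁻ x, ‖f x‖ₑ ^ q ≤ ∫⁻ x, ENNReal.ofReal (128 * M / t) ^ (q - 1) * ‖f x‖ₑ := by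
            refine lintegral_mono_ae ?_
            filter_upwards [h] with x hx
            calc ‖f x‖ₑ ^ q = ‖f x‖ₑ ^ (q - 1) * ‖f x‖ₑ ^ (1 : ℝ) := by
                  rw [← ENNReal.rpow_add_of_nonneg _ _ (by linarith) zero_le_one,
                    sub_add_cancel]
              _ ≤ _ := by
                  rw [ENNReal.rpow_one]
                  gcongr
        _ = ENNReal.ofReal (128 * M / t) ^ (q - 1) * ENNReal.ofReal ‖f‖ := by
            rw [lintegral_const_mul _ hfm.enorm, L1.lintegral_enorm]
        _ ≤ _ := by gcongr
    have e0 : ENNReal.ofReal (128 * M / t) ^ (q - 1) * ENNReal.ofReal M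
        = ENNReal.ofReal ((128 * M / t) ^ (q - 1) * M) := by
      rw [ENNReal.ofReal_rpow_of_nonneg (by positivity) (by linarith),
        ← ENNReal.ofReal_mul (by positivity)]
    calc (∫⁻ x, ‖f x‖ₑ ^ q) ^ (1 / q)
        ≤ ENNReal.ofReal ((128 * M / t) ^ (q - 1) * M) ^ (1 / q) := by
          rw [← e0]
          gcongr
      _ = ENNReal.ofReal (((128 * M / t) ^ (q - 1) * M) ^ (1 / q)) :=
          ENNReal.ofReal_rpow_of_nonneg (by positivity) (by positivity)
      _ ≤ _ := by
          refine ENNReal.ofReal_le_ofReal ?_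
          have e1 : (128 * M / t) ^ (q - 1) * M
              ≤ (128 * t ^ (-(1 - q⁻¹)) * M) ^ q := by
            rw [Real.mul_rpow (by positivity) hM0, Real.mul_rpow (by positivity) (by positivity),
              ← Real.rpow_mul ht.le, show -(1 - q⁻¹) * q = -(q - 1) by field_simp,
              Real.div_rpow (by positivity) ht.le, Real.mul_rpow (by positivity) hM0,
              Real.rpow_neg ht.le]
            have e2 : M ^ q = M ^ (q - 1) * M := by
              rcases hM0.eq_or_lt with h0 | h0
              · rw [← h0, Real.zero_rpow hq0.ne', mul_zero]
              · rw [Real.rpow_sub_one h0.ne']; field_simp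
            have e3 : (128 : ℝ) ^ (q - 1) ≤ 128 ^ q :=
              Real.rpow_le_rpow_of_exponent_le (by norm_num) (by linarith)
            rw [e2]
            calc (128 : ℝ) ^ (q - 1) * M ^ (q - 1) / t ^ (q - 1) * M
                = 128 ^ (q - 1) * (t ^ (q - 1))⁻¹ * (M ^ (q - 1) * M) := by ring
              _ ≤ _ := by gcongr
          calc ((128 * M / t) ^ (q - 1) * M) ^ (1 / q)
              ≤ ((128 * t ^ (-(1 - q⁻¹)) * M) ^ q) ^ (1 / q) := by gcongr
            _ = _ := by
                rw [one_div, Real.rpow_rpow_inv (by positivity) hq0.ne']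

end Decay

end VCHE
end

/-! ### Pointwise form of the mild equation, uniqueness and conclusion. -/

noncomputable section

namespace VCHE

/-- The pointwise form of `driftOp`. -/
def driftFun (u : L1 → Plane → Plane) (f : L1) (p : ℝ × Plane) : ℝ :=
  ∫ y, driftKer (u f) p.1 p.2 y * f y

section Pointwise

variable {u : L1 → Plane → Plane} {U : ℝ}

lemma norm_driftKer_le {w : Plane → Plane} {V : ℝ} (hw : ∀ y, ‖w y‖ ≤ V) (τ : ℝ) (x y : Plane) :
    ‖driftKer w τ x y‖ ≤ 2 / √τ * (1 / (4 * Real.pi * (2 * τ))) * V := by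
  by_cases hτ : 0 < τ
  · rw [driftKer, norm_neg]
    refine (norm_inner_le_norm _ _).trans ?_
    refine mul_le_mul ((norm_hkGrad_le hτ _).trans ?_) (hw y) (norm_nonneg _) (by positivity)
    gcongr
    exact hk_le (by positivity) _
  · rw [driftKer, hkGrad_of_nonpos (not_lt.1 hτ), Real.sqrt_eq_zero'.2 (not_lt.1 hτ)]
    simp

lemma integrable_driftKer_mul (hu : IsDrift u U) (f g : L1) (τ : ℝ) (x : Plane) :
    Integrable fun y => driftKer (u g) τ x y * f y := by
  have hm : Measurable fun y => driftKer (u g) τ x y := by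
    have := hu.meas g
    unfold driftKer
    fun_prop
  exact (L1.integrable f).bdd_mul hm.aestronglyMeasurable
    (Filter.Eventually.of_forall fun y => norm_driftKer_le (hu.norm_le g) τ x y)

lemma norm_integral_driftKer_mul_le (hu : IsDrift u U) (f g : L1) (τ : ℝ) (x : Plane) :
    ‖∫ y, driftKer (u g) τ x y * f y‖ ≤
      2 / √τ * (1 / (4 * Real.pi * (2 * τ))) * (U * ‖g‖) * ‖f‖ := by
  rw [L1.norm_eq_integral_norm f, ← integral_const_mul]
  refine norm_integral_le_of_norm_le ((L1.integrable f).norm.const_mul _)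
    (Filter.Eventually.of_forall fun y => ?_)
  rw [norm_mul]
  gcongr
  exact norm_driftKer_le (hu.norm_le g) τ x y

lemma continuous_driftFun (hu : IsDrift u U) (p : ℝ × Plane) :
    Continuous fun f => driftFun u f p := by
  obtain ⟨τ, x⟩ := p
  have hU := hu.nonneg
  refine continuous_of_lipschitz_on_balls fun M hM =>
    ⟨2 * (2 / √τ * |1 / (4 * Real.pi * (2 * τ))| * (U * M)), fun f g hf hg => ?_⟩
  have e : driftFun u f (τ, x) - driftFun u g (τ, x)
      = (∫ y, driftKer (u f) τ x y * (f - g) y) + ∫ y, driftKer (u (f - g)) τ x y * g y := by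
    simp only [driftFun]
    rw [← integral_sub (integrable_driftKer_mul hu f f τ x) (integrable_driftKer_mul hu g g τ x),
      ← integral_add (integrable_driftKer_mul hu _ _ τ x) (integrable_driftKer_mul hu _ _ τ x)]
    refine integral_congr_ae ?_
    filter_upwards [Lp.coeFn_sub f g] with y hy
    rw [hy, Pi.sub_apply]
    simp only [driftKer, hu.map_sub, inner_sub_right]
    ring
  rw [e]
  refine (norm_add_le _ _).trans ((add_le_add (norm_integral_driftKer_mul_le hu _ _ τ x)
    (norm_integral_driftKer_mul_le hu _ _ τ x)).trans ?_)
  have hle := le_abs_self (1 / (4 * Real.pi * (2 * τ)))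
  calc 2 / √τ * (1 / (4 * Real.pi * (2 * τ))) * (U * ‖f‖) * ‖f - g‖
        + 2 / √τ * (1 / (4 * Real.pi * (2 * τ))) * (U * ‖f - g‖) * ‖g‖
      ≤ 2 / √τ * |1 / (4 * Real.pi * (2 * τ))| * (U * M) * ‖f - g‖
        + 2 / √τ * |1 / (4 * Real.pi * (2 * τ))| * (U * ‖f - g‖) * M := by gcongr
    _ = _ := by ring

/-- Joint measurability in (f, τ, x), including the dependence on f ∈ L¹, lets the Bochner integral
of the nonlinearity be computed pointwise in x. -/
lemma measurable_driftFun (hu : IsDrift u U) : Measurable (Function.uncurry (driftFun u)) := by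
  refine measurable_uncurry_of_continuous_of_measurable (continuous_driftFun hu) fun f => ?_
  have hf : Measurable f := (Lp.stronglyMeasurable f).measurable
  have huf := hu.meas f
  have hm : Measurable fun q : (ℝ × Plane) × Plane => driftKer (u f) q.1.1 q.1.2 q.2 * f q.2 := by
    unfold driftKer
    fun_prop
  exact (hm.stronglyMeasurable.integral_prod_right').measurable

lemma norm_driftOp_le (hu : IsDrift u U) {M : ℝ} (τ : ℝ) {f : L1} (hf : ‖f‖ ≤ M) :
    ‖driftOp u τ f‖ ≤ 4 * U * M * M / √τ := by
  have hM : 0 ≤ M := (norm_nonneg _).trans hf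
  have h := norm_driftOp_sub_le hu τ hf (g := 0) (by simpa using hM)
  rw [driftOp_zero hu, sub_zero, sub_zero] at h
  have hU := hu.nonneg
  rw [show 4 * U * M * M / √τ = 4 * U * M / √τ * M by ring]
  exact h.trans (by gcongr)

lemma integrableOn_driftOp (hu : IsDrift u U) {v : ℝ → L1} (hv : Measurable v) {M : ℝ}
    (hvM : ∀ s, ‖v s‖ ≤ M) (t : ℝ) : IntegrableOn (fun s => driftOp u (t - s) (v s)) (Ioc 0 t) := by
  refine integrableOn_volterra (measurable_driftOp hu) (ρ := fun τ => 4 * U * M * M / √τ) ?_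
    (fun τ _ f hf => norm_driftOp_le hu τ hf) hv hvM
  have h := (integrableOn_inv_sqrt t).const_mul (4 * U * M * M)
  simp only [mul_one_div] at h
  exact h

end Pointwise

lemma duhamel_congr {α t : ℝ} (ht : 0 ≤ t) {v w : ℝ → L1}
    (h : ∀ᵐ s ∂volume.restrict (Ioc 0 t), v s = w s) (x : Plane) :
    duhamel α v t x = duhamel α w t x := by
  unfold duhamel
  rw [intervalIntegral.integral_of_le ht, intervalIntegral.integral_of_le ht]
  refine integral_congr_ae ?_
  filter_upwards [h] with s hs
  rw [hs]

/-- The Duhamel term is the pointwise form of a Bochner integral in `L¹`. -/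
lemma integral_driftOp_ae_eq {α t : ℝ} (hα : 0 < α) (ht : 0 < t) {v : ℝ → L1} (hv : Measurable v)
    {M : ℝ} (hvM : ∀ s, ‖v s‖ ≤ M) :
    (∫ s in Ioc 0 t, driftOp (velocity α) (t - s) (v s) : L1)
      =ᵐ[volume] fun x => -duhamel α v t x := by
  have hu := isDrift_velocity hα
  have h := coeFn_integral_L1 (μ := volume.restrict (Ioc 0 t))
    (F := fun s => driftOp (velocity α) (t - s) (v s))
    (φ := fun s x => driftFun (velocity α) (v s) (t - s, x)) (integrableOn_driftOp hu hv hvM t)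
    ?_ ?_
  · filter_upwards [h] with x hx
    rw [hx, duhamel, intervalIntegral.integral_of_le ht.le, ← integral_neg]
    refine integral_congr_ae ?_
    filter_upwards [ae_Ioc_sub_pos t] with s hs
    rw [driftFun, ← integral_neg]
    refine integral_congr_ae (Filter.Eventually.of_forall fun y => ?_)
    simp only
    rw [gradient_heatKernel hs, inner_smul_right, driftKer]
    ring
  · refine ((measurable_driftFun hu).comp (f := fun p : ℝ × Plane => (v p.1, (t - p.1, p.2)))
      ?_).aestronglyMeasurable
    have hv1 : Measurable fun p : ℝ × Plane => v p.1 := hv.comp measurable_fst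
    exact hv1.prodMk (by fun_prop)
  · refine Filter.Eventually.of_forall fun s => ?_
    exact (isKer_driftKer (hu.meas _) (hu.norm_le _) (t - s)).coeFn (v s)

lemma heatCLM_ae_eq {t : ℝ} (ht : 0 < t) (f : L1) : heatCLM t f =ᵐ[volume] heatFlow t f := by
  filter_upwards [(isKer_pushKer measurable_id t).coeFn f] with x hx
  rw [heatCLM_apply, hx, heatFlow]
  simp [pushKer, hk, ht]

/-- The integral equation in `L¹` and its pointwise form agree. -/
lemma mild_iff {α t : ℝ} (hα : 0 < α) (ht : 0 < t) (v₀ : L1) {v : ℝ → L1} (hv : Measurable v)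
    {M : ℝ} (hvM : ∀ s, ‖v s‖ ≤ M) (f : L1) :
    (∀ᵐ x, f x = heatFlow t v₀ x - duhamel α v t x) ↔
      f = heatCLM t v₀ + ∫ s in Ioc 0 t, driftOp (velocity α) (t - s) (v s) := by
  have h1 := heatCLM_ae_eq ht v₀
  have h2 := integral_driftOp_ae_eq hα ht hv hvM
  have h3 := Lp.coeFn_add (heatCLM t v₀)
    (∫ s in Ioc 0 t, driftOp (velocity α) (t - s) (v s))
  constructor
  · intro h
    refine Lp.ext ?_
    filter_upwards [h, h1, h2, h3] with x e e1 e2 e3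
    rw [e, e3, Pi.add_apply, e1, e2, sub_eq_add_neg]
  · intro h
    filter_upwards [h1, h2, h3] with x e1 e2 e3
    rw [h, e3, Pi.add_apply, e1, e2, sub_eq_add_neg]

/-- A bounded measurable representative of an element of `L^∞([0, ∞); L¹)`. -/
lemma MemLinftyL1.exists_representative {w : ℝ → L1} (hw : MemLinftyL1 w) :
    ∃ w' : ℝ → L1, ∃ B : ℝ, 0 ≤ B ∧ Measurable w' ∧ (∀ s, ‖w' s‖ ≤ B) ∧
      ∀ᵐ s ∂volume.restrict (Ici (0 : ℝ)), w s = w' s := by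
  set μ := volume.restrict (Ici (0 : ℝ))
  set B := (eLpNorm w ⊤ μ).toReal with hB
  have hm := hw.1
  set w₁ := hm.mk w with hw₁
  have hw₁m : Measurable w₁ := hm.stronglyMeasurable_mk.measurable
  have hs : MeasurableSet {s | ‖w₁ s‖ ≤ B} := measurableSet_le hw₁m.norm measurable_const
  refine ⟨{s | ‖w₁ s‖ ≤ B}.indicator w₁, B, ENNReal.toReal_nonneg, hw₁m.indicator hs,
    fun s => ?_, ?_⟩
  · by_cases h : s ∈ {s | ‖w₁ s‖ ≤ B}
    · rw [indicator_of_mem h]; exact h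
    · rw [indicator_of_notMem h, norm_zero]; exact ENNReal.toReal_nonneg
  · filter_upwards [hm.ae_eq_mk, ae_le_eLpNormEssSup (f := w) (μ := μ)] with s h1 h2
    have h3 : ‖w₁ s‖ ≤ B := by
      rw [hw₁, ← h1, hB, ← toReal_enorm]
      rw [← eLpNorm_exponent_top] at h2
      exact ENNReal.toReal_mono hw.2.ne h2
    rw [indicator_of_mem (show s ∈ {s | ‖w₁ s‖ ≤ B} from h3), hw₁, ← h1]

/-- Solutions of the integral equation which are bounded in `L¹` agree almost everywhere. -/
lemma ae_eq_of_integral_equation {α : ℝ} (hα : 0 < α) {v₀ : L1} {v w : ℝ → L1} {M : ℝ}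
    (hv : Measurable v) (hw : Measurable w) (hvM : ∀ s, ‖v s‖ ≤ M) (hwM : ∀ s, ‖w s‖ ≤ M)
    (hveq : ∀ᵐ t ∂volume.restrict (Ioi (0 : ℝ)),
      v t = heatCLM t v₀ + ∫ s in Ioc 0 t, driftOp (velocity α) (t - s) (v s))
    (hweq : ∀ᵐ t ∂volume.restrict (Ioi (0 : ℝ)),
      w t = heatCLM t v₀ + ∫ s in Ioc 0 t, driftOp (velocity α) (t - s) (w s)) :
    ∀ᵐ t ∂volume.restrict (Ioi (0 : ℝ)), w t = v t := by
  have hu := isDrift_velocity hα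
  have hU := hu.nonneg
  have hM : 0 ≤ M := (norm_nonneg _).trans (hvM 0)
  set b := 4 * velocityBound α * M with hb
  have hb0 : 0 ≤ b := by positivity
  obtain ⟨lam, hl0, hlam⟩ := exists_exp_weight hb0
  have key : ∀ n : ℕ, ∀ᵐ t ∂volume.restrict (Ioc 0 (n : ℝ)), w t = v t := by
    intro n
    -- Both solutions share the free term, so Grönwall's lemma applies with a = 0.
    have hg := gronwall_singular_ae hb0 hl0 hlam (D := fun t => ‖w t - v t‖) (a := 0)
      (B := 2 * M) (T := n) le_rfl (fun s => norm_nonneg _)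
      (Filter.Eventually.of_forall fun s => (norm_sub_le _ _).trans
        (by linarith [hvM s, hwM s])) ?_
    · filter_upwards [hg] with t ht
      rw [mul_zero, zero_mul] at ht
      exact sub_eq_zero.1 (norm_le_zero_iff.1 ht)
    · filter_upwards [ae_restrict_of_ae_restrict_of_subset Ioc_subset_Ioi_self hveq,
        ae_restrict_of_ae_restrict_of_subset Ioc_subset_Ioi_self hweq] with t h1 h2
      have e : w t - v t = ∫ s in Ioc 0 t, (driftOp (velocity α) (t - s) (w s)
          - driftOp (velocity α) (t - s) (v s)) := by
        rw [integral_sub (integrableOn_driftOp hu hw hwM t) (integrableOn_driftOp hu hv hvM t)]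
        exact (congrArg₂ (· - ·) h2 h1).trans (add_sub_add_left_eq_sub _ _ _)
      rw [e, zero_add]
      refine norm_integral_le_of_norm_le ?_ (Filter.Eventually.of_forall fun s => ?_)
      · refine (integrableOn_inv_sqrt_sub b t).mul_bdd (c := 2 * M)
          (hw.sub hv).norm.aestronglyMeasurable (Filter.Eventually.of_forall fun s => ?_)
        rw [norm_norm]
        exact (norm_sub_le _ _).trans (by linarith [hvM s, hwM s])
      · exact norm_driftOp_sub_le hu _ (hwM s) (hvM s)
  rw [← iUnion_Ioc_eq_Ioi_self_iff.2 fun x _ => exists_nat_ge x]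
  exact ae_restrict_iUnion_iff _ _ |>.2 key

/-- Existence, uniqueness and decay for the vorticity equation, with an explicit constant. -/
theorem exists_unique_mild_solution {α : ℝ} (hα : 0 < α) (v₀ : L1) :
    ∃ v : ℝ → L1, IsMildSolution α v₀ v ∧
      (∀ w : ℝ → L1, IsMildSolution α v₀ w → ∀ t : ℝ, 0 ≤ t → w t = v t) ∧
      (∀ w : ℝ → L1, MemLinftyL1 w → (∀ᵐ t : ℝ, 0 ≤ t → MildEquationAt α v₀ w t) →
        ∀ᵐ t : ℝ, 0 ≤ t → w t = v t) ∧
      (∀ p : ℝ≥0∞, 1 ≤ p → ∀ t : ℝ, 0 < t → eLpNorm (v t) p volume ≤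
        ENNReal.ofReal (128 * t ^ (-(1 - (p⁻¹).toReal)) * ‖v₀‖)) := by
  obtain ⟨v₁, hm, hM, heq, hpow⟩ := exists_integral_solution hα v₀
  -- The integral equation for t > 0 leaves the value at time 0 open; it is set to v₀, a change on a
  -- null set that no integral in time sees.
  set v : ℝ → L1 := Function.update v₁ 0 v₀ with hv
  have hv0 : v 0 = v₀ := Function.update_self _ _ _
  have hvt : ∀ t ≠ 0, v t = v₁ t := fun t ht => Function.update_of_ne ht _ _
  have hvM : ∀ t, ‖v t‖ ≤ ‖v₀‖ := by
    intro t
    rcases eq_or_ne t 0 with rfl | ht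
    · rw [hv0]
    · rw [hvt t ht]; exact hM t
  have hvm : Measurable v := by
    rw [show v = fun t => if t = 0 then v₀ else v₁ t from funext fun t =>
      Function.update_apply _ _ _ _]
    exact Measurable.ite (measurableSet_singleton 0) measurable_const hm
  have hveq : ∀ t > 0,
      v t = heatCLM t v₀ + ∫ s in Ioc 0 t, driftOp (velocity α) (t - s) (v s) := by
    intro t ht
    rw [hvt t ht.ne', heq t ht]
    congr 1
    refine setIntegral_congr_fun measurableSet_Ioc fun s hs => ?_
    rw [hvt s hs.1.ne']
  have huniq : ∀ w : ℝ → L1, MemLinftyL1 w → (∀ᵐ t : ℝ, 0 ≤ t → MildEquationAt α v₀ w t) →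
      ∀ᵐ t ∂volume.restrict (Ioi (0 : ℝ)), w t = v t := by
    intro w hw hweq
    obtain ⟨w', B, hB, hwm, hwB, hae⟩ := hw.exists_representative
    have hae' : ∀ᵐ s ∂volume.restrict (Ioi (0 : ℝ)), w s = w' s :=
      ae_restrict_of_ae_restrict_of_subset Ioi_subset_Ici_self hae
    have hw'eq : ∀ᵐ t ∂volume.restrict (Ioi (0 : ℝ)),
        w' t = heatCLM t v₀ + ∫ s in Ioc 0 t, driftOp (velocity α) (t - s) (w' s) := by
      filter_upwards [hae', ae_restrict_of_ae hweq, ae_restrict_mem measurableSet_Ioi]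
        with t h1 h2 ht
      have ht0 : 0 < t := ht
      -- The Duhamel term depends only on the class of w almost everywhere in time, so the bounded
      -- representative solves the equation at almost every t.
      rw [← mild_iff hα ht0 v₀ hwm hwB, ← h1]
      filter_upwards [(h2 ht0.le).2 ht0] with x hx
      rw [hx, duhamel_congr ht0.le
        (ae_restrict_of_ae_restrict_of_subset Ioc_subset_Ioi_self hae')]
    have h := ae_eq_of_integral_equation hα (M := max B ‖v₀‖) hvm hwm
      (fun s => (hvM s).trans (le_max_right _ _)) (fun s => (hwB s).trans (le_max_left _ _))
      ((ae_restrict_mem measurableSet_Ioi).mono hveq) hw'eq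
    filter_upwards [h, hae'] with t h1 h2
    rw [h2, h1]
  have hmem : MemLinftyL1 v := memLp_top_of_bound hvm.aestronglyMeasurable ‖v₀‖
    (Filter.Eventually.of_forall hvM)
  refine ⟨v, ⟨hmem, fun t _ => ⟨fun h0 => hv0, fun ht =>
    (mild_iff hα ht v₀ hvm hvM (v t)).2 (hveq t ht)⟩⟩, fun w hw t ht => ?_, fun w hw hweq => ?_,
    fun p hp t ht => ?_⟩
  · rcases ht.eq_or_lt with rfl | ht0
    · rw [(hw.equation 0 le_rfl).1 rfl, hv0]
    -- Almost everywhere equality already makes the Duhamel terms agree, and the equation at t then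
    -- gives equality at that very t.
    · have hae := huniq w hw.mem (Filter.Eventually.of_forall hw.equation)
      rw [hveq t ht0, ← mild_iff hα ht0 v₀ hvm hvM]
      filter_upwards [(hw.equation t ht).2 ht0] with x hx
      rw [hx, duhamel_congr ht (ae_restrict_of_ae_restrict_of_subset Ioc_subset_Ioi_self hae)]
  · have hae := huniq w hw hweq
    rw [ae_restrict_iff' measurableSet_Ioi] at hae
    filter_upwards [hae, compl_mem_ae_iff.2 (measure_singleton (0 : ℝ))] with t h1 h2 h3
    exact h1 (lt_of_le_of_ne h3 (Ne.symm h2))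
  · rw [hvt t ht.ne']
    exact eLpNorm_le_of_norm_le_of_ae_le (hM t) ht
      (ae_enorm_le_of_powInt_le (hM t) ht fun k => hpow k t ht) hp

end VCHE
end

theorem theorem1 :
    ∃ C : ℝ, ∀ α : ℝ, 0 < α → ∀ v₀ : VCHE.L1,
      ∃ v : ℝ → VCHE.L1,
        -- existence
        VCHE.IsMildSolution α v₀ v ∧
        -- uniqueness, at every time
        (∀ w : ℝ → VCHE.L1, VCHE.IsMildSolution α v₀ w → ∀ t : ℝ, 0 ≤ t → w t = v t) ∧
        -- uniqueness almost everywhere, if the equation is only required at almost every time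
        (∀ w : ℝ → VCHE.L1, VCHE.MemLinftyL1 w →
          (∀ᵐ t : ℝ, 0 ≤ t → VCHE.MildEquationAt α v₀ w t) →
          ∀ᵐ t : ℝ, 0 ≤ t → w t = v t) ∧
        -- decay
        (∀ p : ℝ≥0∞, 1 ≤ p → ∀ t : ℝ, 0 < t →
          eLpNorm (v t) p volume ≤
            ENNReal.ofReal (C * t ^ (-(1 - (p⁻¹).toReal)) * ‖v₀‖)) := by
  exact ⟨128, fun _ hα v₀ => VCHE.exists_unique_mild_solution hα v₀⟩
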